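/- **Conventions.** For $\sigma>0$, $D_{\mathbb Z,\sigma}$ is the discrete Gaussian on $\mathbb Z$ with mass at $x$ proportional to $e^{-\pi x^2/\sigma^2}$, and $D_{\mathbb Z^m,\sigma}$ is its $m$-fold product. $U(X)$ is the uniform distribution on a finite set $X$. $\mathcal S_{n,k}$ is the set of vectors in $\{-1,0,1\}^n$ with exactly $k$ non-zero entries. As a distribution of secrets, a finite set stands for its uniform distribution. $\mathsf{LWE}(N,\mathbb Z_q^d,\mathcal S,\mathcal E)$ is the distribution of $N$ samples $(\mathbf a_i,\ \mathbf s^{\top}\mathbf a_i+e_i \bmod q)$, where $\mathbf s\sim\mathcal S$ is drawn once and $\mathbf a_i\sim U(\mathbb Z_q^d)$, $e_i\sim\mathcal E$ are drawn independently. For secret matrices $S\in\mathbb Z_q^{m\times d}$ and noise vectors $\mathbf e_i\in\mathbb Z^m$ the samples are $(\mathbf a_i,\ S\mathbf a_i+\mathbf e_i \bmod q)$. Distinguishers are randomized Boolean circuits reading the input in binary; the running time is the number of gates plus the number of coin tosses. The advantage of $\mathcal A$ between $\mathcal D_1$ and $\mathcal D_2$ is $|\Pr_{x\sim \mathcal D_1}[\mathcal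 A(x)=1]-\Pr_{x\sim \mathcal D_2}[\mathcal A(x)=1]|$; "no time-$T$ distinguisher with advantage $\epsilon$" means that no distinguisher of running time at most $T$ has advantage at least $\epsilon$. A function $\nu:\mathbb N\to\mathbb R$ is negligible if $\lambda^c\nu(\lambda)\to0$ for every $c$, and $f=\omega(\log\lambda)$ means $f(\lambda)/\log\lambda\to+\infty$. Put $\sigma'=2\sigma\sqrt{k+1}$. **Theorem.** There are polynomials $P_1,P_2$ in four variables with the following property. Let $\mu$ be negligible and let $f,g$ be functions in $\omega(\log\lambda)$. Then there are negligible functions $\nu_1,\nu_2$ such that (1) and (2) hold for every security parameter $\lambda\in\mathbb N$, all natural numbers $q,m,n,\ell,k$ with $q\ge1$ and $1<k<n$, all reals $\sigma,\epsilon>0$ and every real $T$ that satisfy $$\frac{\log q}{2^{\ell}}\le\mu(\lambda),\qquad \sigma\ge4\sqrt{f(\lambda)+\ln n+\ln m},\qquad k\log_2(n/k)\ge(\ell+1)\log_2 q+g(\lambda).$$ (1) Let $T_1=T+P_1(n,m,\log q,\log\lambda)$. Suppose that there is no time-$T_1$ distinguisher with advantage $\epsilon-\nu_1(\lambda)$ between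 $\mathsf{LWE}(n-1,\mathbb Z_q^{\ell},\mathbb Z_q^{m\times\ell},D_{\mathbb Z^m,\sigma})$ and $U((\mathbb Z_q^{\ell}\times\mathbb Z_q^{m})^{n-1})$, and no time-$T_1$ distinguisher with advantage $\epsilon-\nu_1(\lambda)$ between $\mathsf{LWE}(n+1,\mathbb Z_q^{\ell+1},\mathbb Z_q^{m\times(\ell+1)},D_{\mathbb Z^m,2\sigma})$ and $U((\mathbb Z_q^{\ell+1}\times\mathbb Z_q^{m})^{n+1})$. Then there is no time-$T$ distinguisher with advantage $2\epsilon$ between $\mathsf{LWE}(m,\mathbb Z_q^n,\mathcal S_{n,k},D_{\mathbb Z,\sigma'})$ and $U((\mathbb Z_q^{n}\times\mathbb Z_q)^m)$. (2) Suppose that there is no distinguisher of running time $T+P_2(n,m,q,\lambda)$ with advantage $\epsilon$ between $\mathsf{LWE}(n,\mathbb Z_q^{\ell},\mathbb Z_q^{\ell},D_{\mathbb Z,\sigma})$ and $U((\mathbb Z_q^{\ell}\times\mathbb Z_q)^{n})$. Then there is no time-$T$ distinguisher with advantage $2\epsilon m+\nu_2(\lambda)$ between $\mathsf{LWE}(m,\mathbb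 Z_q^n,\mathcal S_{n,k},D_{\mathbb Z,\sigma'})$ and $U((\mathbb Z_q^{n}\times\mathbb Z_q)^m)$. (At $\lambda=0$, $m=0$ the convention $\log 0=0$ is used, and the square root of a negative number is read as $0$.) -/

import Mathlib

open scoped ENNReal

namespace SparseLWE

/-! ## Asymptotic notions in the security parameter -/

/-- `ν` is a negligible function of the security parameter: `λ ^ c * ν(λ) → 0` for every `c`. -/
def Negligible (ν : ℕ → ℝ) : Prop :=
  Asymptotics.SuperpolynomialDecay Filter.atTop (fun lam : ℕ => (lam : ℝ)) ν

/-- `f` is `ω(log λ)`: the quotient `f(λ) / log λ` tends to `+∞`. -/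
def SuperLogarithmic (f : ℕ → ℝ) : Prop :=
  Filter.Tendsto (fun lam : ℕ => f lam / Real.log lam) Filter.atTop Filter.atTop

/-! ## Distributions -/

theorem tsum_prod_eq_one {α : Type} (p : PMF α) (N : ℕ) :
    ∑' x : Fin N → α, ∏ i, p (x i) = 1 := by
  induction N with
  | zero => simp
  | succ N ih =>
    rw [← (Fin.consEquiv (fun _ : Fin (N + 1) => α)).tsum_eq, ENNReal.tsum_prod']
    simp only [Fin.consEquiv_apply, Fin.prod_univ_succ, Fin.cons_zero, Fin.cons_succ]
    simp [ENNReal.tsum_mul_left, ih, p.tsum_coe]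

/-- The `N`-fold product distribution `p ^ N`: a vector of `N` independent samples from `p`. -/
noncomputable def iid {α : Type} (N : ℕ) (p : PMF α) : PMF (Fin N → α) :=
  ⟨fun x => ∏ i, p (x i), tsum_prod_eq_one p N ▸ ENNReal.summable.hasSum⟩

theorem summable_gaussian {σ : ℝ} (hσ : 0 < σ) :
    Summable fun x : ℤ => Real.exp (-Real.pi * ((x : ℝ) / σ) ^ 2) := by
  have key : Summable fun n : ℕ => Real.exp (-Real.pi * ((n : ℝ) / σ) ^ 2) := by
    have hc : -(Real.pi / σ ^ 2) < 0 := by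
      have := Real.pi_pos
      have : 0 < Real.pi / σ ^ 2 := by positivity
      linarith
    refine Summable.of_nonneg_of_le (fun _ => (Real.exp_pos _).le) (fun n => ?_)
      (Real.summable_exp_nat_mul_iff.2 hc)
    rw [Real.exp_le_exp]
    have h1 : (n : ℝ) ≤ (n : ℝ) ^ 2 := by
      rcases Nat.eq_zero_or_pos n with h | h
      · simp [h]
      · have : (1 : ℝ) ≤ n := by exact_mod_cast h
        nlinarith
    have h2 : -Real.pi * ((n : ℝ) / σ) ^ 2 = (n : ℝ) ^ 2 * -(Real.pi / σ ^ 2) := by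
      rw [div_pow]; ring
    rw [h2]
    exact mul_le_mul_of_nonpos_right h1 hc.le
  refine Summable.of_nat_of_neg (by simpa using key) ?_
  simpa [neg_div] using key

/-- The discrete Gaussian `D_{ℤ,σ}` of width `σ > 0`: the mass at `x` is proportional to
`ρ_σ(x) = exp (-π (x / σ)²)`. (For `σ ≤ 0`, which is never used, the point mass at `0`.) -/
noncomputable def discreteGaussian (σ : ℝ) : PMF ℤ :=
  if hσ : 0 < σ then
    PMF.normalize (fun x : ℤ => ENNReal.ofReal (Real.exp (-Real.pi * ((x : ℝ) / σ) ^ 2)))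
      (by
        intro h
        have := ENNReal.tsum_eq_zero.1 h 0
        simp at this)
      (by
        rw [← ENNReal.ofReal_tsum_of_nonneg (fun _ => (Real.exp_pos _).le) (summable_gaussian hσ)]
        exact ENNReal.ofReal_ne_top)
  else PMF.pure 0

/-- The set `𝒮_{n,k}` of `k`-sparse vectors: the vectors in `{-1, 0, 1}ⁿ` with exactly `k`
non-zero entries. -/
def sparseVectors (n k : ℕ) : Finset (Fin n → ℤ) :=
  (Fintype.piFinset fun _ => ({-1, 0, 1} : Finset ℤ)).filter fun s =>
    (Finset.univ.filter fun i => s i ≠ 0).card = k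

theorem sparseVectors_nonempty {n k : ℕ} (h : k ≤ n) : (sparseVectors n k).Nonempty := by
  refine ⟨fun i => if (i : ℕ) < k then 1 else 0, ?_⟩
  simp only [sparseVectors, Finset.mem_filter, Fintype.mem_piFinset]
  refine ⟨fun i => by split_ifs <;> simp, ?_⟩
  simp [Fin.card_filter_val_lt, h]

/-- The uniform distribution on `𝒮_{n,k}`, as a distribution of secrets modulo `q`. -/
noncomputable def sparseSecret (q : ℕ) {n k : ℕ} (h : k ≤ n) : PMF (Fin n → ZMod q) :=
  (PMF.uniformOfFinset (sparseVectors n k) (sparseVectors_nonempty h)).map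
    fun s i => (s i : ZMod q)

/-! ## Learning with errors -/

/-- One LWE sample `(a, sᵀ a + e mod q)`. -/
abbrev Sample (q d : ℕ) : Type := (Fin d → ZMod q) × ZMod q

/-- One LWE sample `(a, S a + e mod q)` for a secret matrix `S` with `r` rows. -/
abbrev MatrixSample (q d r : ℕ) : Type := (Fin d → ZMod q) × (Fin r → ZMod q)

/-- The distribution `LWE(N, ℤ_q^d, 𝒮, ℰ)` of `N` samples in dimension `d`, with uniform `a`'s:
a secret `s ∼ 𝒮` is drawn once, and then `N` independent samples `(a, sᵀ a + e mod q)` with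
`a ∼ U(ℤ_q^d)` and `e ∼ ℰ`. -/
noncomputable def lwe (q d : ℕ) [NeZero q] (N : ℕ) (𝒮 : PMF (Fin d → ZMod q)) (ℰ : PMF ℤ) :
    PMF (Fin N → Sample q d) :=
  𝒮.bind fun s => iid N <|
    (PMF.uniformOfFintype (Fin d → ZMod q)).bind fun a =>
      ℰ.map fun e => (a, s ⬝ᵥ a + (e : ZMod q))

/-- The distribution `LWE(N, ℤ_q^d, 𝒮, ℰ)` with matrix secrets: a secret `S ∼ 𝒮`, a matrix with
`r` rows of length `d`, is drawn once, and then `N` independent samples `(a, S a + e mod q)`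
with `a ∼ U(ℤ_q^d)` and `e ∼ ℰ` a noise vector with `r` entries. -/
noncomputable def matrixLwe (q d r : ℕ) [NeZero q] (N : ℕ) (𝒮 : PMF (Fin r → Fin d → ZMod q))
    (ℰ : PMF (Fin r → ℤ)) : PMF (Fin N → MatrixSample q d r) :=
  𝒮.bind fun S => iid N <|
    (PMF.uniformOfFintype (Fin d → ZMod q)).bind fun a =>
      ℰ.map fun e => (a, fun i => S i ⬝ᵥ a + (e i : ZMod q))

/-- The uniform distribution on a finite non-empty set. -/
noncomputable abbrev unif (α : Type) [Fintype α] [Nonempty α] : PMF α := PMF.uniformOfFintype α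

/-! ## Distinguishers and their running time -/

/-- A binary format of the elements of `Ω`: a string of bits, with positions in `Idx`. -/
class BitEncoding (Ω : Type) where
  Idx : Type
  enc : Ω → Idx → Bool

/-- An element of `ℤ_q` is given by the `⌈log₂ q⌉` binary digits of its representative in
`{0, …, q - 1}`. -/
instance (q : ℕ) : BitEncoding (ZMod q) where
  Idx := Fin (Nat.clog 2 q)
  enc x b := x.val.testBit b

instance {Ω Ω' : Type} [BitEncoding Ω] [BitEncoding Ω'] : BitEncoding (Ω × Ω') where
  Idx := BitEncoding.Idx Ω ⊕ BitEncoding.Idx Ω'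
  enc x := Sum.elim (BitEncoding.enc x.1) (BitEncoding.enc x.2)

instance {ι Ω : Type} [BitEncoding Ω] : BitEncoding (ι → Ω) where
  Idx := ι × BitEncoding.Idx Ω
  enc x p := BitEncoding.enc (x p.1) p.2

/-- The operands of a step of a computation: an input bit, or the result of step number `t`. -/
inductive Operand (ι : Type) : Type
  | input (i : ι)
  | step (t : ℕ)

/-- The value of an operand, given the input `x` and the list `v` of the results of the previous
steps. A reference to a step that has not been executed yet reads `false`. -/
def Operand.val {ι : Type} (x : ι → Bool) (v : List Bool) : Operand ι → Bool
  | .input i => x i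
  | .step t => v.getD t false

/-- A step of a computation: an arbitrary Boolean operation applied to two operands. -/
structure Gate (ι : Type) where
  op : Bool → Bool → Bool
  fst : Operand ι
  snd : Operand ι

/-- The list of the results of the steps `gs`, executed in order on the input `x`. -/
def runGates {ι : Type} (x : ι → Bool) (gs : List (Gate ι)) : List Bool :=
  gs.foldl (fun v g => v ++ [g.op (g.fst.val x v) (g.snd.val x v)]) []

/-- A randomized algorithm that reads input bits with positions in `ι` and outputs one bit: a
Boolean circuit (of fan-in two, over all the binary Boolean operations), written as a list of steps
that may also use `coins` independent fair coin tosses. -/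
structure Algorithm (ι : Type) where
  coins : ℕ
  gates : List (Gate (ι ⊕ Fin coins))
  out : Operand (ι ⊕ Fin coins)

namespace Algorithm

variable {ι : Type} (A : Algorithm ι)

/-- The running time: the number of coin tosses plus the number of bit operations. -/
def time : ℕ := A.coins + A.gates.length

/-- The output on the input `x`, when the coin tosses are `r`. -/
def eval (x : ι → Bool) (r : Fin A.coins → Bool) : Bool :=
  A.out.val (Sum.elim x r) (runGates (Sum.elim x r) A.gates)

/-- The distribution of the output on an input drawn from `D`; it is over the input and the
internal randomness. -/
noncomputable def output {Ω : Type} [BitEncoding Ω] (A : Algorithm (BitEncoding.Idx Ω))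
    (D : PMF Ω) : PMF Bool :=
  D.bind fun ω => (unif (Fin A.coins → Bool)).map fun r => A.eval (BitEncoding.enc ω) r

/-- The advantage `|Pr_{x ∼ D₁}[A(x) = 1] - Pr_{x ∼ D₂}[A(x) = 1]|` as a distinguisher. -/
noncomputable def advantage {Ω : Type} [BitEncoding Ω] (A : Algorithm (BitEncoding.Idx Ω))
    (D₁ D₂ : PMF Ω) : ℝ :=
  |(A.output D₁ true).toReal - (A.output D₂ true).toReal|

end Algorithm

/-- There is a distinguisher between `D₁` and `D₂` with running time at most `T` and advantage at
least `ε`. -/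
def Distinguishable {Ω : Type} [BitEncoding Ω] (D₁ D₂ : PMF Ω) (T ε : ℝ) : Prop :=
  ∃ A : Algorithm (BitEncoding.Idx Ω), (A.time : ℝ) ≤ T ∧ ε ≤ A.advantage D₁ D₂

end SparseLWE

open SparseLWE

/-! A sparse sample (a, ⟨s,a⟩ + e), read as a vector of length n + 1, is up to noise orthogonal to
(s, -1). As s is ternary, the orthogonal module has an explicit basis with entries in {-1, 0, 1}:
walk along the support of (s, -1) and let each generator live on two consecutive positions of it,
with cancelling contributions; positions outside the support are free. `pathMap` is this basis as a
linear map. It carries a uniform w to (a, ⟨s,a⟩) with a uniform (`pathMap_last`,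
`pathMap_injective`). Gaussian noise of width σ on its inputs can be completed, by independent noise
that the reduction samples itself, to nearly spherical noise of width 2σ on its outputs
(`dom_noisePath`). Spherical noise x on a and e on the last coordinate act together as the error e -
⟨s,x⟩, which is nearly Gaussian of width 2σ√(k+1) (`dom_pathRow_sparseRow`). All comparisons of
Gaussians are pointwise ratio bounds (`Dom`). They come from Poisson summation and multiply along
independent coordinates.

Hence m sparse samples with the same s are, statistically, the path map of a uniform m × n matrix,
row by row, plus noise. The chain `near_sparse_lwe` continues as follows. The uniform matrix is
exchanged for an LWE matrix: n - 1 columns come from a challenge of dimension ℓ. The reduction adds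
w b_t, with its own uniform w in each row and b shared by the rows, so that S B_t + w b_t = (w,
S)(b_t, B_t) has dimension ℓ + 1. The missing column is w = (w, S) e₀. The noise is then made
spherical, hence independent of s. A change of basis exchanges the column e₀ for a uniform one,
except when that column vanishes modulo a prime divisor of q (`near_unimodular`). Now s enters only
through the columns D₁, …, D_n, ∑ s_j D_j, where the D_j are uniform in ℤ_q^{ℓ+1}. The entropy of
the support of s exceeds (ℓ + 1) log q, so the leftover hash lemma (`near_leftover_hash`) makes the
last column uniform. What is left is an LWE matrix with n + 1 samples, dimension ℓ + 1 and width 2σ,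
and the second assumption ends the chain.

For standard LWE both uses of a matrix assumption reduce to one secret: a hybrid over the m rows
(`near_lweMatrix_of_rows`) costs the factor m, and the instance with parameters n + 1, ℓ + 1, 2σ is
built from one with n, ℓ, σ by the same trick with w and b (`near_lweMatrix_double`).

Distinguishers are circuits, so s and all sampled constants can be fixed and wired in; only the
arithmetic on the challenge costs gates. The path map needs additions and subtractions only, hence a
polynomial in log q. Simulating the other rows of a hybrid multiplies by constants, done by repeated
addition, hence a polynomial in q. -/

namespace SparseLWE

/-! ## Expectations, domination and closeness of distributions -/

/-- The expectation of `a` under `P`. -/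
noncomputable def expect {Ω : Type} (P : PMF Ω) (a : Ω → ℝ≥0∞) : ℝ≥0∞ := ∑' x, P x * a x

theorem expect_pure {Ω : Type} (x : Ω) (a : Ω → ℝ≥0∞) : expect (PMF.pure x) a = a x := by
  unfold expect
  rw [tsum_eq_single x]
  · simp
  · intro y hy
    simp [PMF.pure_apply, hy]

theorem expect_bind {Ω Ω' : Type} (P : PMF Ω) (F : Ω → PMF Ω') (a : Ω' → ℝ≥0∞) :
    expect (P.bind F) a = expect P fun x => expect (F x) a := by
  simp only [expect, PMF.bind_apply]
  simp_rw [← ENNReal.tsum_mul_right, ← ENNReal.tsum_mul_left]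
  rw [ENNReal.tsum_comm]
  simp_rw [mul_assoc]

theorem expect_map {Ω Ω' : Type} (P : PMF Ω) (F : Ω → Ω') (a : Ω' → ℝ≥0∞) :
    expect (P.map F) a = expect P fun x => a (F x) := by
  rw [← PMF.bind_pure_comp, expect_bind]
  simp [expect_pure]

theorem expect_const {Ω : Type} (P : PMF Ω) (c : ℝ≥0∞) : expect P (fun _ => c) = c := by
  simp [expect, ENNReal.tsum_mul_right, P.tsum_coe]

theorem expect_mono {Ω : Type} (P : PMF Ω) {a b : Ω → ℝ≥0∞} (h : ∀ x, a x ≤ b x) :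
    expect P a ≤ expect P b :=
  ENNReal.tsum_le_tsum fun x => by gcongr; exact h x

theorem expect_add {Ω : Type} (P : PMF Ω) (a b : Ω → ℝ≥0∞) :
    expect P (fun x => a x + b x) = expect P a + expect P b := by
  simp [expect, mul_add, ENNReal.tsum_add]

theorem expect_le_one {Ω : Type} (P : PMF Ω) {a : Ω → ℝ≥0∞} (h : ∀ x, a x ≤ 1) :
    expect P a ≤ 1 :=
  (expect_mono P h).trans (expect_const P 1).le

theorem expect_unif {α : Type} [Fintype α] [Nonempty α] (a : α → ℝ≥0∞) :
    expect (unif α) a = ∑ x, (Fintype.card α : ℝ≥0∞)⁻¹ * a x := by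
  simp [expect, tsum_fintype, PMF.uniformOfFintype_apply]

/-- `P` is pointwise at most `c` times `Q`. -/
def Dom {Ω : Type} (c : ℝ≥0∞) (P Q : PMF Ω) : Prop := ∀ x, P x ≤ c * Q x

theorem Dom.refl {Ω : Type} (P : PMF Ω) : Dom 1 P P := fun x => by simp

theorem Dom.mono {Ω : Type} {c d : ℝ≥0∞} {P Q : PMF Ω} (h : Dom c P Q) (hcd : c ≤ d) :
    Dom d P Q := fun x => (h x).trans (by gcongr)

theorem Dom.trans {Ω : Type} {c d : ℝ≥0∞} {P Q S : PMF Ω} (h : Dom c P Q) (h' : Dom d Q S) :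
    Dom (c * d) P S := fun x => (h x).trans <| by
  rw [mul_assoc]
  gcongr
  exact h' x

theorem Dom.bind {Ω Ω' : Type} {c : ℝ≥0∞} {P Q : PMF Ω} (h : Dom c P Q) (F : Ω → PMF Ω') :
    Dom c (P.bind F) (Q.bind F) := fun y => by
  simp only [PMF.bind_apply, ← ENNReal.tsum_mul_left]
  refine ENNReal.tsum_le_tsum fun x => ?_
  rw [← mul_assoc]
  gcongr
  exact h x

theorem Dom.map {Ω Ω' : Type} {c : ℝ≥0∞} {P Q : PMF Ω} (h : Dom c P Q) (F : Ω → Ω') :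
    Dom c (P.map F) (Q.map F) := h.bind _

theorem Dom.bind_right {Ω Ω' : Type} {c : ℝ≥0∞} (P : PMF Ω) {F G : Ω → PMF Ω'}
    (h : ∀ x, Dom c (F x) (G x)) : Dom c (P.bind F) (P.bind G) := fun y => by
  simp only [PMF.bind_apply, ← ENNReal.tsum_mul_left]
  refine ENNReal.tsum_le_tsum fun x => ?_
  rw [mul_left_comm]
  gcongr
  exact h x y

/-- Summing over y removes the second argument. In the cross ratio the unknown normalizing constants
of P and Q appear on both sides, so they never have to be estimated. -/
theorem Dom.of_cross_ratio {Ω : Type} {c : ℝ≥0∞} {P Q : PMF Ω}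
    (h : ∀ x y, P x * Q y ≤ c * (Q x * P y)) : Dom c P Q := fun x => by
  have := ENNReal.tsum_le_tsum (h x)
  simpa [ENNReal.tsum_mul_left, P.tsum_coe, Q.tsum_coe] using this

theorem Dom.expect_le {Ω : Type} {c : ℝ≥0∞} {P Q : PMF Ω} (h : Dom c P Q) (a : Ω → ℝ≥0∞) :
    expect P a ≤ c * expect Q a := by
  unfold expect
  rw [← ENNReal.tsum_mul_left]
  refine ENNReal.tsum_le_tsum fun x => ?_
  rw [← mul_assoc]
  gcongr
  exact h x

/-- The test `a` distinguishes `P` from `Q` with advantage at most `δ`. -/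
def Near {Ω : Type} (a : Ω → ℝ≥0∞) (δ : ℝ≥0∞) (P Q : PMF Ω) : Prop :=
  expect P a ≤ expect Q a + δ ∧ expect Q a ≤ expect P a + δ

theorem Near.symm {Ω : Type} {a : Ω → ℝ≥0∞} {δ : ℝ≥0∞} {P Q : PMF Ω} (h : Near a δ P Q) :
    Near a δ Q P := ⟨h.2, h.1⟩

theorem Near.refl {Ω : Type} (a : Ω → ℝ≥0∞) (P : PMF Ω) : Near a 0 P P := by simp [Near]

theorem Near.mono {Ω : Type} {a : Ω → ℝ≥0∞} {δ δ' : ℝ≥0∞} {P Q : PMF Ω} (h : Near a δ P Q)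
    (hd : δ ≤ δ') : Near a δ' P Q := ⟨h.1.trans (by gcongr), h.2.trans (by gcongr)⟩

theorem Near.trans {Ω : Type} {a : Ω → ℝ≥0∞} {δ δ' : ℝ≥0∞} {P Q S : PMF Ω} (h : Near a δ P Q)
    (h' : Near a δ' Q S) : Near a (δ + δ') P S := by
  refine ⟨h.1.trans ?_, h'.2.trans ?_⟩
  · rw [add_comm δ, ← add_assoc]
    gcongr
    exact h'.1
  · rw [← add_assoc]
    gcongr
    exact h.2

theorem near_one {Ω : Type} {a : Ω → ℝ≥0∞} (ha : ∀ x, a x ≤ 1) (P Q : PMF Ω) :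
    Near a 1 P Q :=
  ⟨(expect_le_one P ha).trans le_add_self, (expect_le_one Q ha).trans le_add_self⟩

theorem near_map_iff {Ω Ω' : Type} {a : Ω' → ℝ≥0∞} {δ : ℝ≥0∞} {P Q : PMF Ω}
    {F : Ω → Ω'} : Near a δ (P.map F) (Q.map F) ↔ Near (fun x => a (F x)) δ P Q := by
  simp [Near, expect_map]

theorem Near.bind_right {Ω Ω' : Type} {a : Ω' → ℝ≥0∞} {δ : ℝ≥0∞} (P : PMF Ω)
    {F G : Ω → PMF Ω'} (h : ∀ x, Near a δ (F x) (G x)) : Near a δ (P.bind F) (P.bind G) := by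
  constructor <;> simp only [expect_bind]
  · exact (expect_mono P fun x => (h x).1).trans (by rw [expect_add, expect_const])
  · exact (expect_mono P fun x => (h x).2).trans (by rw [expect_add, expect_const])

theorem expect_one_sub {Ω : Type} (P : PMF Ω) {a : Ω → ℝ≥0∞} (ha : ∀ x, a x ≤ 1) :
    expect P a + expect P (fun x => 1 - a x) = 1 := by
  rw [← expect_add]
  simp [ha, expect_const]

/-- A one-sided bound that holds for all tests is two-sided. -/
theorem near_of_forall_le {Ω : Type} {δ : ℝ≥0∞} {P Q : PMF Ω}
    (h : ∀ a : Ω → ℝ≥0∞, (∀ x, a x ≤ 1) → expect P a ≤ expect Q a + δ)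
    {a : Ω → ℝ≥0∞} (ha : ∀ x, a x ≤ 1) : Near a δ P Q := by
  refine ⟨h a ha, ?_⟩
  have h1 := h (fun x => 1 - a x) fun x => tsub_le_self
  have hP := expect_one_sub P ha
  have hQ := expect_one_sub Q ha
  have hQ' : expect Q (fun x => 1 - a x) ≠ ∞ := ne_top_of_le_ne_top (by simp) (hQ ▸ le_add_self)
  refine (ENNReal.add_le_add_iff_right hQ').1 ?_
  calc _ = expect P a + expect P (fun x => 1 - a x) := by rw [hQ, hP]
    _ ≤ expect P a + (expect Q (fun x => 1 - a x) + δ) := by gcongr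
    _ = _ := by rw [add_assoc, add_comm δ]

/-- Upper ratio bounds alone suffice: the reverse inequality comes from the complementary test 1 -
a. -/
theorem Dom.near {Ω : Type} {δ : ℝ≥0∞} {P Q : PMF Ω} (h : Dom (1 + δ) P Q)
    {a : Ω → ℝ≥0∞} (ha : ∀ x, a x ≤ 1) : Near a δ P Q :=
  near_of_forall_le (fun a ha => (h.expect_le a).trans <| by
    rw [add_mul, one_mul]
    gcongr
    exact mul_le_of_le_one_right' (expect_le_one Q ha)) ha

/-! ## Independent products -/

theorem prod_tsum_eq_tsum_prod {α : Type} :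
    ∀ {N : ℕ} (f : Fin N → α → ℝ≥0∞), ∏ i, ∑' x, f i x = ∑' x : Fin N → α, ∏ i, f i (x i)
  | 0, f => by simp
  | N + 1, f => by
    rw [← (Fin.consEquiv (fun _ : Fin (N + 1) => α)).tsum_eq, ENNReal.tsum_prod']
    simp only [Fin.consEquiv_apply, Fin.prod_univ_succ, Fin.cons_zero, Fin.cons_succ]
    simp [ENNReal.tsum_mul_left, ← prod_tsum_eq_tsum_prod, ENNReal.tsum_mul_right]

/-- A vector of independent samples from the distributions `p i`. -/
noncomputable def indep {α : Type} {N : ℕ} (p : Fin N → PMF α) : PMF (Fin N → α) :=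
  ⟨fun x => ∏ i, p i (x i), by
    have : ∑' x : Fin N → α, ∏ i, p i (x i) = 1 := by
      simp [← prod_tsum_eq_tsum_prod fun i x => p i x, PMF.tsum_coe]
    exact this ▸ ENNReal.summable.hasSum⟩

theorem indep_apply {α : Type} {N : ℕ} (p : Fin N → PMF α) (x : Fin N → α) :
    indep p x = ∏ i, p i (x i) := rfl

theorem iid_eq_indep {α : Type} (N : ℕ) (p : PMF α) : iid N p = indep fun _ => p := rfl

theorem indep_bind {α β : Type} {N : ℕ} (p : Fin N → PMF α) (f : Fin N → α → PMF β) :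
    indep (fun i => (p i).bind (f i)) = (indep p).bind fun x => indep fun i => f i (x i) := by
  ext y
  simp only [indep_apply, PMF.bind_apply, prod_tsum_eq_tsum_prod, Finset.prod_mul_distrib]

theorem indep_pure {α : Type} {N : ℕ} (x : Fin N → α) :
    indep (fun i => PMF.pure (x i)) = PMF.pure x := by
  classical
  ext y
  simp only [indep_apply, PMF.pure_apply]
  by_cases h : y = x
  · simp [h]
  · obtain ⟨i, hi⟩ := Function.ne_iff.1 h
    rw [if_neg h]
    exact Finset.prod_eq_zero (Finset.mem_univ i) (by simp [hi])

theorem indep_map {α β : Type} {N : ℕ} (p : Fin N → PMF α) (f : Fin N → α → β) :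
    indep (fun i => (p i).map (f i)) = (indep p).map fun x i => f i (x i) := by
  simp only [PMF.map, indep_bind, Function.comp_def, indep_pure]

theorem iid_bind {α β : Type} (N : ℕ) (p : PMF α) (f : α → PMF β) :
    iid N (p.bind f) = (iid N p).bind fun x => indep fun i => f (x i) :=
  indep_bind _ _

theorem iid_map {α β : Type} (N : ℕ) (p : PMF α) (f : α → β) :
    iid N (p.map f) = (iid N p).map fun x i => f (x i) :=
  indep_map _ _

/-! ### Bijections, uniform distributions and coordinates of products. -/

theorem map_equiv_apply {α β : Type} (p : PMF α) (e : α ≃ β) (y : β) :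
    p.map e y = p (e.symm y) := by
  rw [PMF.map_apply, tsum_eq_single (e.symm y)]
  · simp
  · intro x hx
    rw [if_neg]
    rintro rfl
    simp at hx

theorem unif_map_equiv {α β : Type} [Fintype α] [Nonempty α] [Fintype β] [Nonempty β]
    (e : α ≃ β) : (unif α).map e = unif β := by
  ext y
  rw [map_equiv_apply]
  simp [Fintype.card_congr e]

theorem unif_map_bijective {α β : Type} [Fintype α] [Nonempty α] [Fintype β] [Nonempty β]
    {f : α → β} (hf : f.Bijective) : (unif α).map f = unif β :=
  unif_map_equiv (Equiv.ofBijective f hf)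

theorem iid_unif {α : Type} [Fintype α] [Nonempty α] (N : ℕ) :
    iid N (unif α) = unif (Fin N → α) := by
  ext x
  simp [iid_eq_indep, indep_apply, ENNReal.inv_pow]

theorem indep_cons {α : Type} {N : ℕ} (p : Fin (N + 1) → PMF α) :
    indep p = (p 0).bind fun x => (indep fun i => p i.succ).map (Fin.cons x) := by
  ext y
  rw [PMF.bind_apply, tsum_eq_single (y 0)]
  · rw [indep_apply, Fin.prod_univ_succ, PMF.map_apply, tsum_eq_single (Fin.tail y)]
    · simp [indep_apply, Fin.tail]
    · intro b hb
      rw [if_neg]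
      rintro h
      exact hb (by rw [h, Fin.tail_cons])
  · intro b hb
    rw [PMF.map_apply, ENNReal.tsum_eq_zero.2, mul_zero]
    intro x
    rw [if_neg]
    rintro h
    exact hb (by rw [h, Fin.cons_zero])

theorem iid_succ {α : Type} (N : ℕ) (p : PMF α) :
    iid (N + 1) p = p.bind fun x => (iid N p).map (Fin.cons x) :=
  indep_cons _

theorem iid_swap {α : Type} (m N : ℕ) (p : PMF α) :
    (iid m (iid N p)).map Function.swap = iid N (iid m p) := by
  ext y
  have := map_equiv_apply (iid m (iid N p)) (Equiv.piComm fun _ _ => α) y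
  refine this.trans ?_
  simp only [iid_eq_indep, indep_apply]
  rw [Finset.prod_comm]
  rfl

theorem Dom.indep {α : Type} {N : ℕ} {c : ℝ≥0∞} {p r : Fin N → PMF α}
    (h : ∀ i, Dom c (p i) (r i)) : Dom (c ^ N) (indep p) (indep r) := fun x => by
  simp only [indep_apply]
  calc ∏ i, p i (x i) ≤ ∏ i, c * r i (x i) := Finset.prod_le_prod' fun i _ => h i (x i)
    _ = _ := by simp [Finset.prod_mul_distrib]

theorem Dom.iid {α : Type} (N : ℕ) {c : ℝ≥0∞} {p r : PMF α} (h : Dom c p r) :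
    Dom (c ^ N) (iid N p) (iid N r) := Dom.indep fun _ => h

/-- Resampling one coordinate of an independent vector. -/
theorem indep_update {α : Type} {N : ℕ} (p : Fin N → PMF α) (i : Fin N) (r : PMF α) :
    indep (Function.update p i r) =
      (indep p).bind fun x => r.map fun v => Function.update x i v := by
  have h1 : Function.update p i r =
      fun j => (p j).bind fun x => if j = i then r else PMF.pure x := by
    funext j
    by_cases h : j = i
    · subst h; simp
    · simp [h]
  rw [h1, indep_bind]
  congr 1
  funext x
  ext y
  rw [indep_apply]
  by_cases hy : ∀ j, j ≠ i → y j = x j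
  · rw [Finset.prod_eq_single i, PMF.map_apply, tsum_eq_single (y i)]
    · rw [if_pos rfl, if_pos]
      funext j
      by_cases h : j = i
      · subst h; simp
      · simp [h, hy j h]
    · intro v hv
      rw [if_neg]
      rintro rfl
      simp at hv
    · intro j _ hj
      simp [hj, hy j hj]
    · simp
  · push Not at hy
    obtain ⟨j, hj, hne⟩ := hy
    rw [Finset.prod_eq_zero (Finset.mem_univ j), PMF.map_apply, ENNReal.tsum_eq_zero.2]
    · intro v
      rw [if_neg]
      rintro rfl
      simp [hj] at hne
    · simp [hj, hne]

/-! ## Smoothness of one-dimensional discrete Gaussians -/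

theorem exp_neg_sq_le_pow {a : ℝ} (ha : 0 ≤ a) (n : ℕ) :
    Real.exp (-(a * (n : ℝ) ^ 2)) ≤ Real.exp (-a) ^ n := by
  rw [← Real.exp_nat_mul, Real.exp_le_exp]
  have h1 : (n : ℝ) ≤ (n : ℝ) ^ 2 := by exact_mod_cast Nat.le_self_pow two_ne_zero n
  nlinarith

/-- Since n ≤ n², each half of the series without its central term is dominated by a geometric
series of ratio exp(-a). This is applied to the Fourier side of Poisson summation. -/
theorem norm_tsum_int_sub_zero_le {a : ℝ} (ha : 0 < a) {f : ℤ → ℂ}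
    (hf : ∀ n, ‖f n‖ = Real.exp (-(a * (n : ℝ) ^ 2))) :
    ‖∑' n, f n - f 0‖ ≤ 2 * Real.exp (-a) / (1 - Real.exp (-a)) := by
  set r := Real.exp (-a)
  have hr0 : 0 ≤ r := (Real.exp_pos _).le
  have hr1 : r < 1 := by simpa [r] using ha
  have hgeo : HasSum (fun n : ℕ => r ^ (n + 1)) (r / (1 - r)) := by
    simpa [pow_succ', div_eq_mul_inv] using (hasSum_geometric_of_lt_one hr0 hr1).mul_left r
  have hp : ∀ n : ℕ, ‖f (n + 1)‖ ≤ r ^ (n + 1) := fun n => by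
    rw [hf]
    simpa using exp_neg_sq_le_pow ha.le (n + 1)
  have hm : ∀ n : ℕ, ‖f (-(n + 1))‖ ≤ r ^ (n + 1) := fun n => by
    rw [hf]
    have := exp_neg_sq_le_pow ha.le (n + 1)
    push_cast at this ⊢
    rwa [neg_sq]
  have sp : Summable fun n : ℕ => f (n + 1) := Summable.of_norm_bounded hgeo.summable hp
  have sm : Summable fun n : ℕ => f (-(n + 1)) := Summable.of_norm_bounded hgeo.summable hm
  have sp0 : Summable fun n : ℕ => f n := (summable_nat_add_iff 1).1 (by simpa using sp)
  have key : ∑' n, f n - f 0 = ∑' n : ℕ, f (n + 1) + ∑' n : ℕ, f (-(n + 1)) := by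
    rw [tsum_of_nat_of_neg_add_one sp0 sm, sp0.tsum_eq_zero_add]
    push_cast
    ring
  rw [key]
  have h1 := tsum_of_norm_bounded hgeo hp
  have h2 := tsum_of_norm_bounded hgeo hm
  calc _ ≤ r / (1 - r) + r / (1 - r) := (norm_add_le _ _).trans (add_le_add h1 h2)
    _ = _ := by ring

/-- The mass of a Gaussian of width `s` on the shifted integers. -/
noncomputable def thetaSum (s t : ℝ) : ℝ≥0∞ :=
  ∑' j : ℤ, ENNReal.ofReal (Real.exp (-Real.pi * (((j : ℝ) + t) / s) ^ 2))

/-- By Poisson summation the sum is s times a series with terms of modulus exp(-π s² n²). The shift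
t enters only through phases, and the central term is 1. -/
theorem thetaSum_bounds {s : ℝ} (hs : 0 < s) (t : ℝ) :
    ∃ v : ℝ, thetaSum s t = ENNReal.ofReal (s * v) ∧
      |v - 1| ≤ 2 * Real.exp (-(Real.pi * s ^ 2)) / (1 - Real.exp (-(Real.pi * s ^ 2))) := by
  have hpi := Real.pi_pos
  have hs2 : (0 : ℝ) < s ^ 2 := by positivity
  have hq := Complex.tsum_exp_neg_quadratic (a := ((s ^ 2 : ℝ) : ℂ)) (by rwa [Complex.ofReal_re])
    (-(Complex.I * t))
  set f : ℤ → ℂ := fun n => Complex.exp (-Real.pi * ((s ^ 2 : ℝ) : ℂ) * n ^ 2 +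
    2 * Real.pi * (-(Complex.I * t)) * n) with hf
  have hnorm : ∀ n, ‖f n‖ = Real.exp (-((Real.pi * s ^ 2) * (n : ℝ) ^ 2)) := fun n => by
    rw [hf, Complex.norm_exp]
    congr 1
    simp [pow_two]
  have hb := norm_tsum_int_sub_zero_le (by positivity) hnorm
  have hf0 : f 0 = 1 := by simp [hf]
  set g : ℤ → ℝ := fun j => Real.exp (-Real.pi * (((j : ℝ) + t) / s) ^ 2) with hg
  have hgr : ∀ n : ℤ, Complex.exp (-Real.pi / ((s ^ 2 : ℝ) : ℂ) *
      (n + Complex.I * (-(Complex.I * t))) ^ 2) = (g n : ℂ) := fun n => by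
    rw [hg]
    push_cast
    congr 1
    have hI : Complex.I * (-(Complex.I * t)) = t := by
      linear_combination (-(t : ℂ)) * Complex.I_mul_I
    rw [hI]
    field_simp
  have hroot : ((s ^ 2 : ℝ) : ℂ) ^ (1 / 2 : ℂ) = (s : ℂ) := by
    rw [show (1 / 2 : ℂ) = ((1 / 2 : ℝ) : ℂ) by simp, ← Complex.ofReal_cpow hs2.le,
      ← Real.sqrt_eq_rpow, Real.sqrt_sq hs.le]
  simp_rw [hgr] at hq
  rw [hroot, ← Complex.ofReal_tsum] at hq
  have hs' : (s : ℂ) ≠ 0 := by exact_mod_cast hs.ne'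
  have hv : ∑' n, f n = (((∑' n, g n) / s : ℝ) : ℂ) := by
    rw [hq]
    push_cast
    field_simp
  refine ⟨(∑' n, g n) / s, ?_, ?_⟩
  · rw [mul_div_cancel₀ _ hs.ne', thetaSum, ENNReal.ofReal_tsum_of_nonneg]
    · exact fun _ => (Real.exp_pos _).le
    · by_contra hns
      have h0 : ∑' n, g n = 0 := tsum_eq_zero_of_not_summable hns
      obtain ⟨N, hN⟩ : ∃ N : ℤ, |(N : ℝ) + t| ≤ 1 :=
        ⟨-⌊t⌋, by
          push_cast
          rw [abs_le]
          constructor <;> linarith [Int.floor_le t, Int.lt_floor_add_one t]⟩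
      have hsm : Summable fun n : ℤ => Real.exp (-Real.pi * ((n : ℝ) / (2 * s)) ^ 2) :=
        summable_gaussian (by positivity)
      refine hns ?_
      -- The factor exp(-π (t/s)²) absorbs the shift: (n/(2s))² ≤ (t/s)² + ((n+t)/s)² compares the
      -- series with an unshifted Gaussian of width 2s.
      refine (summable_mul_left_iff (Real.exp_ne_zero (-(Real.pi * (t / s) ^ 2)))).1 ?_
      refine Summable.of_nonneg_of_le (fun _ => by positivity) (fun n => ?_) hsm
      rw [hg, ← Real.exp_add, Real.exp_le_exp]
      have : ((n : ℝ) / (2 * s)) ^ 2 ≤ (t / s) ^ 2 + (((n : ℝ) + t) / s) ^ 2 := by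
        have : (n : ℝ) / (2 * s) = (((n : ℝ) + t) / s - t / s) / 2 := by field_simp; ring
        rw [this]
        nlinarith [sq_nonneg (((n : ℝ) + t) / s + t / s), sq_nonneg (((n : ℝ) + t) / s),
          sq_nonneg (t / s)]
      nlinarith
  · rw [hv, hf0, ← Complex.ofReal_one, ← Complex.ofReal_sub, Complex.norm_real,
      Real.norm_eq_abs] at hb
    exact hb

/-- Gaussians of width at least `s₀` have almost the same mass on all shifts of the integers. -/
theorem thetaSum_le {s₀ s : ℝ} (hs₀ : 0 < s₀) (hs : s₀ ≤ s)
    (h : Real.exp (-(Real.pi * s₀ ^ 2)) ≤ 1 / 4) (t t' : ℝ) :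
    thetaSum s t ≤ (1 + ENNReal.ofReal (16 * Real.exp (-(Real.pi * s₀ ^ 2)))) * thetaSum s t' := by
  have hs' : 0 < s := hs₀.trans_le hs
  obtain ⟨v, hv, hv1⟩ := thetaSum_bounds hs' t
  obtain ⟨w, hw, hw1⟩ := thetaSum_bounds hs' t'
  set r := Real.exp (-(Real.pi * s ^ 2))
  set r₀ := Real.exp (-(Real.pi * s₀ ^ 2))
  have hr0 : 0 < r := Real.exp_pos _
  have hr : r ≤ r₀ := by
    rw [Real.exp_le_exp]
    have := Real.pi_pos
    have : s₀ ^ 2 ≤ s ^ 2 := by gcongr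
    nlinarith
  have hd : 2 * r / (1 - r) ≤ 8 / 3 * r₀ := by
    rw [div_le_iff₀ (by linarith)]
    nlinarith
  have h1 := abs_le.1 (hv1.trans hd)
  have h2 := abs_le.1 (hw1.trans hd)
  rw [hv, hw, ← ENNReal.ofReal_one, ← ENNReal.ofReal_add (by norm_num) (by positivity),
    ← ENNReal.ofReal_mul (by positivity)]
  apply ENNReal.ofReal_le_ofReal
  -- From v ≤ 1 + 8r₀/3 and w ≥ 1 - 8r₀/3: the product (1 + 16r₀)(1 - 8r₀/3) is at least 1 + 8r₀/3
  -- exactly when r₀ ≤ 1/4 (for r₀ > 0), which explains the constants.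
  have : v ≤ (1 + 16 * r₀) * w := by nlinarith
  nlinarith

/-- The unnormalized Gaussian weight. -/
noncomputable def gaussianWeight (σ x : ℝ) : ℝ≥0∞ :=
  ENNReal.ofReal (Real.exp (-Real.pi * (x / σ) ^ 2))

theorem exists_discreteGaussian_apply {σ : ℝ} (hσ : 0 < σ) :
    ∃ K : ℝ≥0∞, ∀ x : ℤ, discreteGaussian σ x = K * gaussianWeight σ x := by
  refine ⟨(∑' x : ℤ, gaussianWeight σ x)⁻¹, fun x => ?_⟩
  rw [discreteGaussian, dif_pos hσ, PMF.normalize_apply, mul_comm]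
  rfl

theorem discreteGaussian_map_neg {σ : ℝ} (hσ : 0 < σ) :
    (discreteGaussian σ).map Neg.neg = discreteGaussian σ := by
  obtain ⟨K, hK⟩ := exists_discreteGaussian_apply hσ
  ext x
  have := map_equiv_apply (discreteGaussian σ) (Equiv.neg ℤ) x
  refine this.trans ?_
  simp [hK, gaussianWeight, neg_div]

/-- Completing the square in z. The factor that still depends on z has width s = ab/c, the width
whose smoothness decides how well a convolution is approximated. -/
theorem gaussianWeight_mul {a b c s : ℝ} (ha : 0 < a) (hb : 0 < b) (hc : 0 < c)
    (hs : 0 < s) (hc2 : c ^ 2 = a ^ 2 + b ^ 2) (hsc : s * c = a * b) (x z : ℝ) :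
    gaussianWeight a z * gaussianWeight b (x - z) =
      gaussianWeight c x * gaussianWeight s (z - x * a ^ 2 / c ^ 2) := by
  unfold gaussianWeight
  rw [← ENNReal.ofReal_mul (Real.exp_pos _).le, ← ENNReal.ofReal_mul (Real.exp_pos _).le,
    ← Real.exp_add, ← Real.exp_add, ← mul_add, ← mul_add]
  congr 3
  have hs2 : s = a * b / c := by field_simp; linarith
  subst hs2
  have hb2 : b ^ 2 = c ^ 2 - a ^ 2 := by linarith
  have : (z / a) ^ 2 + ((x - z) / b) ^ 2 - ((x / c) ^ 2 +
      ((z - x * a ^ 2 / c ^ 2) / (a * b / c)) ^ 2) = 0 := by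
    field_simp
    rw [hb2]
    ring
  linarith

theorem tsum_gaussianWeight_add (s t : ℝ) :
    ∑' z : ℤ, gaussianWeight s (z + t) = thetaSum s t := rfl

theorem bind_map_add_apply (p r : PMF ℤ) (x : ℤ) :
    (p.bind fun z => r.map fun y => z + y) x = ∑' z, p z * r (x - z) := by
  rw [PMF.bind_apply]
  congr 1
  funext z
  congr 1
  have := map_equiv_apply r (Equiv.addLeft z) x
  refine this.trans ?_
  congr 1
  simp
  ring

/-- The sum of two independent discrete Gaussians is close to a discrete Gaussian. -/
theorem dom_gaussian_add {a b c s : ℝ} (ha : 0 < a) (hb : 0 < b) (hc : 0 < c)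
    (hs : 0 < s) (hc2 : c ^ 2 = a ^ 2 + b ^ 2) (hsc : s * c = a * b) {κ : ℝ≥0∞}
    (h : ∀ t t', thetaSum s t ≤ κ * thetaSum s t') :
    Dom κ ((discreteGaussian a).bind fun z => (discreteGaussian b).map fun y => z + y)
      (discreteGaussian c) := by
  obtain ⟨A, hA⟩ := exists_discreteGaussian_apply ha
  obtain ⟨B, hB⟩ := exists_discreteGaussian_apply hb
  obtain ⟨C, hC⟩ := exists_discreteGaussian_apply hc
  have key : ∀ x : ℤ, ((discreteGaussian a).bind fun z =>
      (discreteGaussian b).map fun y => z + y) x =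
      A * B * gaussianWeight c x * thetaSum s (-(x * a ^ 2 / c ^ 2)) := fun x => by
    rw [bind_map_add_apply, ← tsum_gaussianWeight_add, ← ENNReal.tsum_mul_left]
    congr 1
    funext z
    have := gaussianWeight_mul ha hb hc hs hc2 hsc x z
    rw [hA, hB, ← sub_eq_add_neg, mul_assoc (A * B), ← this]
    push_cast
    ring
  refine Dom.of_cross_ratio fun x y => ?_
  rw [key, key, hC, hC]
  calc _ = A * B * C * gaussianWeight c x * gaussianWeight c y *
        thetaSum s (-(x * a ^ 2 / c ^ 2)) := by ring
    _ ≤ A * B * C * gaussianWeight c x * gaussianWeight c y *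
        (κ * thetaSum s (-(y * a ^ 2 / c ^ 2))) := by gcongr; exact h _ _
    _ = _ := by ring

/-- The step of the noise path: the sum and the difference of two discrete Gaussians have the same
parity, which is hidden by adding a further Gaussian to the sum. -/
theorem dom_gaussian_path {σ : ℝ} (hσ : 0 < σ) {κ : ℝ≥0∞}
    (h : ∀ t t', thetaSum (σ / 2) t ≤ κ * thetaSum (σ / 2) t') :
    Dom κ ((discreteGaussian (√2 * σ)).bind fun b => (discreteGaussian σ).bind fun z =>
        (discreteGaussian σ).map fun t => (z + t + b, t - z))
      ((discreteGaussian (2 * σ)).bind fun x => (discreteGaussian (√2 * σ)).map fun c => (x, c)) := by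
  have h2 : (0 : ℝ) < √2 := by positivity
  obtain ⟨A, hA⟩ := exists_discreteGaussian_apply hσ
  obtain ⟨B, hB⟩ := exists_discreteGaussian_apply (σ := √2 * σ) (by positivity)
  obtain ⟨C, hC⟩ := exists_discreteGaussian_apply (σ := 2 * σ) (by positivity)
  have hP : ∀ x c : ℤ, ((discreteGaussian (√2 * σ)).bind fun b => (discreteGaussian σ).bind fun z =>
      (discreteGaussian σ).map fun t => (z + t + b, t - z)) (x, c) =
      A * A * B * gaussianWeight (2 * σ) x * gaussianWeight (√2 * σ) c *
        thetaSum (σ / 2) ((c - x / 2) / 2) := fun x c => by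
    rw [PMF.bind_comm, PMF.bind_apply, ← tsum_gaussianWeight_add, ← ENNReal.tsum_mul_left]
    congr 1
    funext z
    -- For a given outcome (x, c) only z is free: t = c + z and b = x - 2z - c are forced.
    rw [PMF.bind_apply, tsum_eq_single (x - 2 * z - c), PMF.map_apply, tsum_eq_single (c + z),
      if_pos, hA, hA, hB]
    -- In z² + (c+z)² + (x-2z-c)²/2 the coefficient of z² is 4. Completing the square therefore
    -- leaves a Gaussian in z of width σ/2, the narrowest one that has to be smooth.
    · have : gaussianWeight σ z * gaussianWeight σ (c + z) *
          gaussianWeight (√2 * σ) (x - 2 * z - c) =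
          gaussianWeight (2 * σ) x * gaussianWeight (√2 * σ) c *
            gaussianWeight (σ / 2) (z + (c - x / 2) / 2) := by
        unfold gaussianWeight
        simp only [← ENNReal.ofReal_mul (Real.exp_pos _).le, ← Real.exp_add, ← mul_add]
        congr 3
        simp only [div_pow, mul_pow, Real.sq_sqrt zero_le_two]
        field_simp
        ring
      push_cast
      rw [mul_assoc (A * A * B), mul_assoc (A * A * B), ← this]
      ring
    · ext
      · simp; ring
      · simp
    · intro t ht
      rw [if_neg]
      rintro h
      have := congrArg Prod.snd h
      simp only at this
      omega
    · intro b hb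
      rw [PMF.map_apply, ENNReal.tsum_eq_zero.2, mul_zero]
      intro t
      rw [if_neg]
      rintro h
      have h1 := congrArg Prod.fst h
      have h2 := congrArg Prod.snd h
      simp only at h1 h2
      omega
  have hQ : ∀ x c : ℤ, ((discreteGaussian (2 * σ)).bind fun x =>
      (discreteGaussian (√2 * σ)).map fun c => (x, c)) (x, c) =
      B * C * gaussianWeight (2 * σ) x * gaussianWeight (√2 * σ) c := fun x c => by
    rw [PMF.bind_apply, tsum_eq_single x, PMF.map_apply, tsum_eq_single c, if_pos rfl, hB, hC]
    · ring
    · intro t ht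
      rw [if_neg]
      rintro h
      exact ht (congrArg Prod.snd h).symm
    · intro b hb
      rw [PMF.map_apply, ENNReal.tsum_eq_zero.2, mul_zero]
      intro t
      rw [if_neg]
      rintro h
      exact hb (congrArg Prod.fst h).symm
  refine Dom.of_cross_ratio fun ⟨x, c⟩ ⟨x', c'⟩ => ?_
  rw [hP, hP, hQ, hQ]
  calc _ = A * A * B * (B * C) * gaussianWeight (2 * σ) x * gaussianWeight (√2 * σ) c *
        (gaussianWeight (2 * σ) x' * gaussianWeight (√2 * σ) c') *
        thetaSum (σ / 2) ((c - x / 2) / 2) := by ring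
    _ ≤ A * A * B * (B * C) * gaussianWeight (2 * σ) x * gaussianWeight (√2 * σ) c *
        (gaussianWeight (2 * σ) x' * gaussianWeight (√2 * σ) c') *
        (κ * thetaSum (σ / 2) ((c' - x' / 2) / 2)) := by gcongr; exact h _ _
    _ = _ := by ring

/-! ## The path map

For a ternary vector `s`, the vectors `pathMap s z 0 0 0` are the vectors orthogonal to `(s, -1)`:
each `z i` with `s i ≠ 0` is added at position `i` and subtracted at the next position of the
support of `(s, -1)`, up to signs. The other arguments carry compensating noise along the path. -/

/-- The path map. -/
def pathMap {M : Type} [AddCommGroup M] :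
    ∀ {N : ℕ}, (Fin N → ℤ) → (Fin N → M) → (Fin N → M) → M → M → Fin (N + 1) → M
  | 0, _, _, _, b, u => fun _ => -(b + u)
  | _ + 1, s, z, t, b, u =>
    Fin.cons (if s 0 = 0 then z 0 + t 0 else s 0 • (z 0 + t 0 + b))
      (pathMap (Fin.tail s) (Fin.tail z) (Fin.tail t) (if s 0 = 0 then b else t 0 - z 0) u)

section PathMap

variable {M M' : Type} [AddCommGroup M] [AddCommGroup M']

/-- Needed for two homomorphisms: reduction of integer noise modulo q, and the pairing of column
vectors with a row S of the secret. -/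
theorem pathMap_map (f : M →+ M') : ∀ {N : ℕ} (s : Fin N → ℤ) (z t : Fin N → M) (b u : M)
    (i : Fin (N + 1)), f (pathMap s z t b u i) =
      pathMap s (fun i => f (z i)) (fun i => f (t i)) (f b) (f u) i
  | 0, s, z, t, b, u, i => by simp [pathMap]
  | N + 1, s, z, t, b, u, i => by
    refine Fin.cases ?_ (fun i => ?_) i
    · by_cases h : s 0 = 0 <;> simp [pathMap, h]
    · simp only [pathMap, Fin.cons_succ, pathMap_map f (Fin.tail s)]
      by_cases h : s 0 = 0 <;> simp [h, Fin.tail_def]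

theorem pathMap_add : ∀ {N : ℕ} (s : Fin N → ℤ) (z t z' t' : Fin N → M) (b u b' u' : M),
    pathMap s (z + z') (t + t') (b + b') (u + u') =
      pathMap s z t b u + pathMap s z' t' b' u'
  | 0, s, z, t, z', t', b, u, b', u' => by
    funext i
    simp [pathMap]
    abel
  | N + 1, s, z, t, z', t', b, u, b', u' => by
    have h1 : ∀ x y : Fin (N + 1) → M, Fin.tail (x + y) = Fin.tail x + Fin.tail y :=
      fun _ _ => rfl
    funext i
    refine Fin.cases ?_ (fun i => ?_) i
    · by_cases h : s 0 = 0
      · simp [pathMap, h]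
        abel
      · simp only [pathMap, h, if_false, Fin.cons_zero, Pi.add_apply, ← smul_add]
        congr 1
        abel
    · have h2 : (if s 0 = 0 then b + b' else (t + t') 0 - (z + z') 0) =
          (if s 0 = 0 then b else t 0 - z 0) + (if s 0 = 0 then b' else t' 0 - z' 0) := by
        split_ifs
        · rfl
        · simp only [Pi.add_apply]
          abel
      simp only [pathMap, Fin.cons_succ]
      rw [h2, h1, h1, pathMap_add (Fin.tail s)]
      simp only [Pi.add_apply, Fin.cons_succ]

/-- The entries are in `{-1, 0, 1}`. -/
def IsTernary {N : ℕ} (s : Fin N → ℤ) : Prop := ∀ i, s i = -1 ∨ s i = 0 ∨ s i = 1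

theorem IsTernary.tail {N : ℕ} {s : Fin (N + 1) → ℤ} (h : IsTernary s) : IsTernary (Fin.tail s) :=
  fun i => h i.succ

/-- A telescoping sum: on the support s_j² = 1, so position j contributes z_j plus the carry, and
the carry is minus the previous z on the support. The initial carry b and the final z survive. -/
theorem pathMap_last : ∀ {N : ℕ} {s : Fin N → ℤ} (_ : IsTernary s) (z : Fin N → M) (b : M),
    pathMap s z 0 b 0 (Fin.last N) = ∑ j, s j • pathMap s z 0 b 0 j.castSucc - b
  | 0, s, _, z, b => by simp [pathMap]
  | N + 1, s, hs, z, b => by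
    have h0 : Fin.tail (0 : Fin (N + 1) → M) = 0 := rfl
    have ih := pathMap_last hs.tail (Fin.tail z) (if s 0 = 0 then b else -z 0)
    rw [Fin.sum_univ_succ, ← Fin.succ_last]
    simp only [pathMap, Fin.castSucc_zero, ← Fin.succ_castSucc, Fin.cons_zero, Fin.cons_succ, h0,
      Pi.zero_apply, zero_sub, add_zero, ih]
    rcases hs 0 with h | h | h
    · simp [h, Fin.tail_def]
      abel
    · simp [h, Fin.tail_def]
    · simp [h, Fin.tail_def]
      abel

/-- The map is triangular with diagonal entries ±1: each coordinate determines its own z once the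
carry, made of earlier entries, is known. -/
theorem pathMap_injective : ∀ {N : ℕ} {s : Fin N → ℤ} (_ : IsTernary s) (z z' : Fin N → M) (b : M)
    (_ : ∀ j : Fin N, pathMap s z 0 b 0 j.castSucc = pathMap s z' 0 b 0 j.castSucc), z = z'
  | 0, _, _, _, _, _, _ => Subsingleton.elim _ _
  | N + 1, s, hs, z, z', b, h => by
    have h0 : z 0 = z' 0 := by
      have := h 0
      rcases hs 0 with h | h | h <;> simpa [pathMap, h] using this
    have ht : Fin.tail z = Fin.tail z' := by
      refine pathMap_injective hs.tail _ _ (if s 0 = 0 then b else -z 0) fun j => ?_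
      have := h j.succ
      have e : Fin.tail (0 : Fin (N + 1) → M) = 0 := rfl
      simp only [pathMap, ← Fin.succ_castSucc, Fin.cons_succ, e, Pi.zero_apply, zero_sub] at this
      rw [this, h0]
    rw [← Fin.cons_self_tail z, ← Fin.cons_self_tail z', h0, ht]

/-- Every coordinate of the path map is a signed sum of the inputs. -/
theorem pathMap_eq_sum : ∀ {N : ℕ} {s : Fin N → ℤ} (_ : IsTernary s) (j : Fin (N + 1)),
    ∃ (c : Fin N → ℤ) (d : ℤ), IsTernary c ∧ (d = -1 ∨ d = 0 ∨ d = 1) ∧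
      ∀ (z : Fin N → M) (b : M), pathMap s z 0 b 0 j = ∑ i, c i • z i + d • b
  | 0, s, _, j => ⟨0, -1, fun _ => by simp, by simp, fun z b => by simp [pathMap]⟩
  | N + 1, s, hs, j => by
    have h0 : Fin.tail (0 : Fin (N + 1) → M) = 0 := rfl
    refine Fin.cases ?_ (fun j => ?_) j
    · refine ⟨Fin.cons (if s 0 = 0 then 1 else s 0) 0, s 0, fun i => ?_, hs 0, fun z b => ?_⟩
      · refine Fin.cases ?_ (fun i => ?_) i
        · rcases hs 0 with h | h | h <;> simp [h]
        · simp
      · rw [Fin.sum_univ_succ]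
        by_cases h : s 0 = 0 <;> simp [pathMap, h, smul_add]
    · obtain ⟨c, d, hc, hd, h⟩ := pathMap_eq_sum hs.tail j
      refine ⟨Fin.cons (if s 0 = 0 then 0 else -d) c, if s 0 = 0 then d else 0, fun i => ?_, ?_,
        fun z b => ?_⟩
      · refine Fin.cases ?_ (fun i => ?_) i
        · rcases hd with rfl | rfl | rfl <;> by_cases h : s 0 = 0 <;> simp [h]
        · simpa using hc i
      · split_ifs
        · exact hd
        · simp
      · rw [Fin.sum_univ_succ]
        simp only [pathMap, Fin.cons_succ, h0, h, Pi.zero_apply, zero_sub, Fin.cons_zero]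
        by_cases h : s 0 = 0
        · simp [h, Fin.tail_def]
        · simp [h, Fin.tail_def]
          abel

end PathMap

/-! ## The noise on the path -/

theorem iid_zero {α : Type} (p : PMF α) : iid 0 p = PMF.pure Fin.elim0 := by
  have := indep_pure (N := 0) (α := α) Fin.elim0
  rw [← this, iid_eq_indep]
  congr 1
  exact Subsingleton.elim _ _

theorem indep_zero {α : Type} (p : Fin 0 → PMF α) : indep p = PMF.pure Fin.elim0 := by
  rw [← indep_pure (N := 0) (α := α) Fin.elim0]
  congr 1
  exact Subsingleton.elim _ _

theorem discreteGaussian_map_smul {σ : ℝ} (hσ : 0 < σ) {v : ℤ} (hv : v = -1 ∨ v = 1) :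
    (discreteGaussian σ).map (fun x => v * x) = discreteGaussian σ := by
  rcases hv with rfl | rfl
  · simpa using discreteGaussian_map_neg hσ
  · simp only [one_mul]
    exact PMF.map_id _

/-- The widths of the compensating noise on the path. -/
noncomputable def pathNoise (σ : ℝ) {N : ℕ} (s : Fin N → ℤ) : PMF (Fin N → ℤ) :=
  indep fun j => discreteGaussian (if s j = 0 then √3 * σ else σ)

/-- The noise on the path, started with the carry `b`. -/
noncomputable def noisePath (σ : ℝ) {N : ℕ} (s : Fin N → ℤ) (b : ℤ) : PMF (Fin (N + 1) → ℤ) :=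
  (iid N (discreteGaussian σ)).bind fun z => (pathNoise σ s).bind fun t =>
    (discreteGaussian (√2 * σ)).map fun u => pathMap s z t b u

theorem noisePath_succ (σ : ℝ) {N : ℕ} (s : Fin (N + 1) → ℤ) (b : ℤ) :
    noisePath σ s b = (discreteGaussian σ).bind fun z =>
      (discreteGaussian (if s 0 = 0 then √3 * σ else σ)).bind fun t =>
        (noisePath σ (Fin.tail s) (if s 0 = 0 then b else t - z)).map
          (Fin.cons (if s 0 = 0 then z + t else s 0 * (z + t + b))) := by
  unfold noisePath pathNoise
  rw [iid_succ, indep_cons]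
  simp only [PMF.bind_bind, PMF.map_bind, PMF.bind_map, PMF.map_comp, Function.comp_def, pathMap,
    Fin.cons_zero, Fin.tail_cons, smul_eq_mul]
  congr 1
  funext z
  rw [PMF.bind_comm]
  rfl

/-- All Gaussians of width at least `s₀` have, up to the factor `κ`, the same mass on all shifts of
the integers. -/
def SmoothAbove (κ : ℝ≥0∞) (s₀ : ℝ) : Prop :=
  1 ≤ κ ∧ ∀ s, s₀ ≤ s → ∀ t t', thetaSum s t ≤ κ * thetaSum s t'

/-- The invariant is a carry of width √2 σ independent of everything already output. On the support,
z + t + b and t - z behave like independent Gaussians of widths 2σ and √2 σ, so the invariant is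
restored; each output costs one factor κ. At the end -(b + u) has squared width 2σ² + 2σ². -/
theorem dom_noisePath {σ : ℝ} (hσ : 0 < σ) {κ : ℝ≥0∞} (h : SmoothAbove κ (σ / 2)) :
    ∀ {N : ℕ} {s : Fin N → ℤ} (_ : IsTernary s),
      Dom (κ ^ (N + 1)) ((discreteGaussian (√2 * σ)).bind (noisePath σ s))
        (iid (N + 1) (discreteGaussian (2 * σ)))
  | 0, s, hs => by
    have h2 : (0 : ℝ) < √2 := by positivity
    have h3 := dom_gaussian_add (a := √2 * σ) (b := √2 * σ) (c := 2 * σ) (s := σ)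
      (by positivity) (by positivity) (by positivity) hσ
      (by simp only [mul_pow, Real.sq_sqrt zero_le_two]; ring)
      (by ring_nf; simp only [Real.sq_sqrt zero_le_two])
      (h.2 σ (by linarith))
    have h4 := h3.map fun x => (fun _ => -x : Fin 1 → ℤ)
    have h5 : iid 1 (discreteGaussian (2 * σ)) =
        (discreteGaussian (2 * σ)).map fun x => (fun _ => -x : Fin 1 → ℤ) := by
      conv_lhs => rw [← discreteGaussian_map_neg (σ := 2 * σ) (by positivity)]
      rw [iid_succ, iid_zero]
      simp only [PMF.bind_map, Function.comp_def, PMF.pure_map]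
      rw [← PMF.bind_pure_comp]
      congr 1
      funext x
      simp only [Function.comp_apply]
      congr 1
      funext i
      rw [Fin.fin_one_eq_zero i, Fin.cons_zero]
    rw [h5]
    simp only [zero_add, pow_one]
    convert h4 using 1
    unfold noisePath pathNoise
    rw [iid_zero, indep_zero]
    simp only [PMF.map_bind, PMF.pure_bind, PMF.map_comp, Function.comp_def, pathMap]
  | N + 1, s, hs => by
    have ih := dom_noisePath hσ h hs.tail
    rw [iid_succ (N + 1), pow_succ']
    by_cases h0 : s 0 = 0
    -- Off the support the carry passes unchanged and σ² + 3σ² = (2σ)².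
    · have h3 := dom_gaussian_add (a := σ) (b := √3 * σ) (c := 2 * σ) (s := √3 / 2 * σ)
        hσ (by positivity) (by positivity) (by positivity)
        (by rw [mul_pow, mul_pow, Real.sq_sqrt (by norm_num)]; ring) (by ring)
        (h.2 _ (by
          have : (1 : ℝ) ≤ √3 := Real.one_le_sqrt.2 (by norm_num)
          nlinarith))
      refine Dom.trans (Q := (discreteGaussian (2 * σ)).bind fun x =>
        ((discreteGaussian (√2 * σ)).bind (noisePath σ (Fin.tail s))).map (Fin.cons (α := fun _ => ℤ) x)) ?_
        (Dom.bind_right _ fun x => ih.map _)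
      convert h3.bind (fun x => ((discreteGaussian (√2 * σ)).bind (noisePath σ (Fin.tail s))).map
        (Fin.cons (α := fun _ => ℤ) x)) using 1
      have e : noisePath σ s = fun b => noisePath σ s b := rfl
      rw [e]
      simp only [noisePath_succ, h0, if_true, PMF.bind_bind, PMF.bind_map, Function.comp_def,
        PMF.map_bind]
      rw [PMF.bind_comm]
      congr 1
      funext z
      rw [PMF.bind_comm]
    -- On the support the second component of the pair is the next carry; the sign s 0 is harmless
    -- because the Gaussian is symmetric.
    · have h3 := (dom_gaussian_path hσ (h.2 _ le_rfl)).bind fun x =>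
        (noisePath σ (Fin.tail s) x.2).map (Fin.cons (α := fun _ => ℤ) (s 0 * x.1))
      have hs0 : s 0 = -1 ∨ s 0 = 1 := by have := hs 0; tauto
      refine Dom.trans (Q := (discreteGaussian (2 * σ)).bind fun x =>
        ((discreteGaussian (√2 * σ)).bind (noisePath σ (Fin.tail s))).map (Fin.cons (α := fun _ => ℤ) x)) ?_
        (Dom.bind_right _ fun x => ih.map _)
      convert h3 using 1
      · have e : noisePath σ s = fun b => noisePath σ s b := rfl
        rw [e]
        simp only [noisePath_succ, h0, if_false, PMF.bind_bind, PMF.bind_map, Function.comp_def]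
      · conv_lhs => rw [← discreteGaussian_map_smul (σ := 2 * σ) (by positivity) hs0]
        simp only [PMF.bind_bind, PMF.bind_map, Function.comp_def, PMF.map_bind]

/-- The inner product of a spherical Gaussian with a ternary vector is close to a Gaussian. -/
theorem dom_gaussian_inner {σ : ℝ} (hσ : 0 < σ) {κ : ℝ≥0∞} (h : SmoothAbove κ (σ / 2)) :
    ∀ {N : ℕ} {s : Fin N → ℤ} (_ : IsTernary s) (j : ℕ) (_ : 1 ≤ j),
      Dom (κ ^ N)
        ((discreteGaussian (2 * σ * √j)).bind fun e =>
          (iid N (discreteGaussian (2 * σ))).map fun x => e - ∑ i, s i * x i)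
        (discreteGaussian (2 * σ * √((j + (Finset.univ.filter fun i => s i ≠ 0).card : ℕ))))
  | 0, s, hs, j, hj => by
    simpa [iid_zero, PMF.pure_map, PMF.bind_pure] using Dom.refl _
  | N + 1, s, hs, j, hj => by
    have hj' : (0 : ℝ) < j := by exact_mod_cast hj
    have hcard : (Finset.univ.filter fun i => s i ≠ 0).card =
        (if s 0 ≠ 0 then 1 else 0) + (Finset.univ.filter fun i => Fin.tail s i ≠ 0).card := by
      rw [Fin.card_filter_univ_succ]
      split_ifs
      · rw [add_comm]
        rfl
      · rw [zero_add]
        rfl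
    rw [hcard, iid_succ]
    by_cases h0 : s 0 = 0
    · have ih := (dom_gaussian_inner hσ h hs.tail j hj).mono
        (pow_le_pow_right₀ h.1 (Nat.le_succ N))
      simp only [h0, ne_eq, not_true_eq_false, if_false, zero_add]
      convert ih using 2
      funext e
      simp only [PMF.map_bind, PMF.map_comp, Function.comp_def, Fin.sum_univ_succ, Fin.cons_succ, h0,
        zero_mul, zero_add, PMF.bind_const]
      rfl
    · have hs0 : -s 0 = -1 ∨ -s 0 = 1 := by have := hs 0; omega
      -- The first term of the inner product is absorbed into e, whose squared width grows from 4σ²j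
      -- to 4σ²(j + 1). The relevant smoothing width 2σ√(j/(j+1)) is at least σ because j ≥ 1.
      have ih := dom_gaussian_inner hσ h hs.tail (j + 1) (by omega)
      have hsq : (√(j : ℝ)) ^ 2 = j := Real.sq_sqrt hj'.le
      have hsq' : (√((j + 1 : ℕ) : ℝ)) ^ 2 = j + 1 := by
        rw [Real.sq_sqrt (by positivity)]
        push_cast
        ring
      have p1 : 0 < √(j : ℝ) := Real.sqrt_pos.2 hj'
      have p2 : 0 < √((j + 1 : ℕ) : ℝ) := Real.sqrt_pos.2 (by positivity)
      have h3 := dom_gaussian_add (a := 2 * σ * √j) (b := 2 * σ) (c := 2 * σ * √(j + 1 : ℕ))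
        (s := 2 * σ * (√j / √(j + 1 : ℕ)))
        (by positivity) (by positivity) (by positivity) (by positivity)
        (by rw [mul_pow, mul_pow, mul_pow, hsq, hsq']; ring) (by field_simp)
        (h.2 _ (by
          have : 1 / 2 ≤ √(j : ℝ) / √((j + 1 : ℕ) : ℝ) := by
            rw [le_div_iff₀ p2]
            refine (sq_le_sq₀ (by positivity) p1.le).1 ?_
            rw [mul_pow, hsq, hsq']
            have : (1 : ℝ) ≤ j := by exact_mod_cast hj
            linarith
          nlinarith))
      have h4 := h3.bind fun e => (iid N (discreteGaussian (2 * σ))).map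
        fun x : Fin N → ℤ => e - ∑ i, (Fin.tail s : Fin N → ℤ) i * x i
      have h5 := h4.trans ih
      simp only [h0, ne_eq, not_false_eq_true, if_true, ← add_assoc]
      rw [pow_succ']
      convert h5 using 1
      rw [PMF.bind_bind]
      congr 1
      funext e
      conv_rhs => rw [← discreteGaussian_map_smul (σ := 2 * σ) (by positivity) hs0]
      simp only [PMF.map_bind, PMF.bind_map, PMF.map_comp, Function.comp_def, Fin.sum_univ_succ,
        Fin.cons_zero, Fin.cons_succ]
      congr 1
      funext x
      rw [discreteGaussian_map_smul (by positivity) hs0]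
      congr 1
      funext y
      simp only [Fin.tail]
      ring

/-! ## Unimodular vectors modulo `q` -/

/-- No prime divisor of `q` divides all entries of `r`. -/
def IsPrimitiveVec {q d : ℕ} (r : Fin d → ZMod q) : Prop :=
  ∀ p ∈ q.primeFactors, ∃ i, ¬ p ∣ (r i).val

theorem isUnit_of_forall_not_dvd {q : ℕ} [NeZero q] {x : ZMod q}
    (h : ∀ p ∈ q.primeFactors, ¬ p ∣ x.val) : IsUnit x := by
  rw [← ZMod.natCast_zmod_val x, ZMod.isUnit_iff_coprime]
  refine Nat.coprime_of_dvd fun p hp hpx hpq => ?_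
  exact h p (Nat.mem_primeFactors.2 ⟨hp, hpq, NeZero.ne q⟩) hpx

theorem dvd_val_iff {q p : ℕ} [NeZero q] (hp : p ∣ q) (x : ZMod q) :
    p ∣ x.val ↔ ZMod.castHom hp (ZMod p) x = 0 := by
  rw [← ZMod.natCast_eq_zero_iff, ZMod.castHom_apply, ZMod.cast_eq_val]

/-- For each prime p dividing q choose an index `idx p` at which r is nonzero modulo p. Take c i to
be the product of the primes that do not need the entry i + 1, a prime needing it when it divides r
0 and has `idx p = i.succ`. Modulo p exactly one term of the sum then survives: r 0 if p does not
divide it, and otherwise the term of the chosen index. -/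
theorem IsPrimitiveVec.exists_isUnit {q d : ℕ} [NeZero q] {r : Fin (d + 1) → ZMod q}
    (h : IsPrimitiveVec r) : ∃ c : Fin d → ZMod q, IsUnit (r 0 + ∑ i, c i * r i.succ) := by
  classical
  choose! idx hidx using h
  set B : Fin d → Finset ℕ := fun i =>
    q.primeFactors.filter fun p => ¬ (p ∣ (r 0).val ∧ idx p = i.succ) with hB
  refine ⟨fun i => ((∏ p ∈ B i, p : ℕ) : ZMod q), isUnit_of_forall_not_dvd fun p hp => ?_⟩
  have hpp : p.Prime := Nat.prime_of_mem_primeFactors hp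
  have := Fact.mk hpp
  have hpq : p ∣ q := Nat.dvd_of_mem_primeFactors hp
  have hzero : ∀ i, p ∈ B i →
      ZMod.castHom hpq (ZMod p) ((∏ p ∈ B i, p : ℕ) : ZMod q) = 0 := fun i hi => by
    rw [map_natCast, ZMod.natCast_eq_zero_iff]
    exact Finset.dvd_prod_of_mem _ hi
  rw [dvd_val_iff hpq, map_add, map_sum]
  simp only [map_mul]
  by_cases h0 : p ∣ (r 0).val
  · have hne : idx p ≠ 0 := fun h => hidx p hp (h ▸ h0)
    obtain ⟨i, hi⟩ := Fin.exists_succ_eq.2 hne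
    rw [(dvd_val_iff hpq _).1 h0, zero_add, Finset.sum_eq_single i]
    · have h1 : ZMod.castHom hpq (ZMod p) (r i.succ) ≠ 0 := by
        rw [Ne, ← dvd_val_iff, hi]
        exact hidx p hp
      refine mul_ne_zero ?_ h1
      rw [map_natCast, Ne, ZMod.natCast_eq_zero_iff, hpp.prime.dvd_finsetProd_iff]
      rintro ⟨p', hp', hd⟩
      rw [Finset.mem_filter] at hp'
      have := (Nat.prime_dvd_prime_iff_eq hpp (Nat.prime_of_mem_primeFactors hp'.1)).1 hd
      subst this
      exact hp'.2 ⟨h0, hi.symm⟩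
    · intro j _ hj
      rw [hzero j, zero_mul]
      refine Finset.mem_filter.2 ⟨hp, fun h => hj ?_⟩
      exact Fin.succ_injective _ (h.2.symm.trans hi.symm)
    · simp
  · rw [Finset.sum_eq_zero, add_zero, ← dvd_val_iff]
    · exact h0
    · intro j _
      rw [hzero j, zero_mul]
      exact Finset.mem_filter.2 ⟨hp, fun h => h0 h.1⟩

/-- A row operation T₁ turns the first entry of r into a unit, and then the identity with first
column T₁ r is an invertible T₂. The matrix is T₁⁻¹ T₂. -/
theorem IsPrimitiveVec.exists_matrix {q d : ℕ} [NeZero q] {r : Fin (d + 1) → ZMod q}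
    (h : IsPrimitiveVec r) : ∃ R : Matrix (Fin (d + 1)) (Fin (d + 1)) (ZMod q),
      IsUnit R ∧ R.mulVec (Pi.single 0 1) = r := by
  obtain ⟨c, hc⟩ := h.exists_isUnit
  set T₁ : Matrix (Fin (d + 1)) (Fin (d + 1)) (ZMod q) :=
    Matrix.updateRow 1 0 (Fin.cons 1 c) with hT₁
  set r' := T₁.mulVec r with hr'
  have h0 : r' 0 = r 0 + ∑ i, c i * r i.succ := by
    simp [hr', hT₁, Matrix.mulVec, dotProduct, Fin.sum_univ_succ]
  set T₂ : Matrix (Fin (d + 1)) (Fin (d + 1)) (ZMod q) := Matrix.updateCol 1 0 r' with hT₂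
  have u1 : IsUnit T₁ := by
    -- By Cramer's rule for the identity matrix, the determinant is the diagonal entry of the
    -- replaced row, here 1. For T₂ below it is the unit r' 0.
    rw [Matrix.isUnit_iff_isUnit_det, ← Matrix.det_transpose, hT₁, ← Matrix.updateCol_transpose,
      Matrix.transpose_one, ← Matrix.cramer_apply, Matrix.cramer_one]
    simp
  have u2 : IsUnit T₂ := by
    rw [Matrix.isUnit_iff_isUnit_det, hT₂, ← Matrix.cramer_apply, Matrix.cramer_one]
    simpa [h0] using hc
  have e2 : T₂.mulVec (Pi.single 0 1) = r' := by
    rw [Matrix.mulVec_single_one]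
    funext i
    simp [hT₂, Matrix.col]
  refine ⟨T₁⁻¹ * T₂, ?_, ?_⟩
  · exact ((Matrix.isUnit_nonsing_inv_iff).2 u1).mul u2
  · rw [← Matrix.mulVec_mulVec, e2, hr', Matrix.mulVec_mulVec,
      Matrix.nonsing_inv_mul _ ((Matrix.isUnit_iff_isUnit_det _).1 u1), Matrix.one_mulVec]

/-- The residues divisible by p and their translates by 1 are disjoint sets of the same size. -/
theorem two_mul_card_dvd_val_le {q p : ℕ} [NeZero q] (hp : p ∈ q.primeFactors) :
    2 * (Finset.univ.filter fun x : ZMod q => p ∣ x.val).card ≤ q := by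
  classical
  have := Fact.mk (Nat.prime_of_mem_primeFactors hp)
  have hpq : p ∣ q := Nat.dvd_of_mem_primeFactors hp
  set S := Finset.univ.filter fun x : ZMod q => p ∣ x.val
  have hinj : Function.Injective fun x : ZMod q => x + 1 := add_left_injective 1
  have hdisj : Disjoint S (S.image fun x => x + 1) := by
    rw [Finset.disjoint_left]
    intro x hx hx'
    obtain ⟨y, hy, rfl⟩ := Finset.mem_image.1 hx'
    have h1 := (dvd_val_iff hpq _).1 (Finset.mem_filter.1 hx).2
    have h2 := (dvd_val_iff hpq _).1 (Finset.mem_filter.1 hy).2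
    rw [map_add, h2, map_one, zero_add] at h1
    exact one_ne_zero h1
  have := Finset.card_le_univ (S ∪ S.image fun x => x + 1)
  rw [Finset.card_union_of_disjoint hdisj, Finset.card_image_of_injective _ hinj, ZMod.card] at this
  omega

/-- A union bound over the primes dividing q: each divides a uniform entry with probability at most
1/2, and the d entries are independent. -/
theorem card_not_isPrimitiveVec_le (q d : ℕ) [NeZero q]
    [DecidablePred fun r : Fin d → ZMod q => ¬ IsPrimitiveVec r] :
    2 ^ d * (Finset.univ.filter fun r : Fin d → ZMod q => ¬ IsPrimitiveVec r).card ≤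
      q.primeFactors.card * q ^ d := by
  classical
  have hsub : (Finset.univ.filter fun r : Fin d → ZMod q => ¬ IsPrimitiveVec r) ⊆
      q.primeFactors.biUnion fun p =>
        Fintype.piFinset fun _ => Finset.univ.filter fun x : ZMod q => p ∣ x.val := by
    intro r hr
    have := (Finset.mem_filter.1 hr).2
    unfold IsPrimitiveVec at this
    push Not at this
    obtain ⟨p, hp, h⟩ := this
    refine Finset.mem_biUnion.2 ⟨p, hp, ?_⟩
    simpa [Fintype.mem_piFinset] using h
  calc _ ≤ 2 ^ d * ∑ p ∈ q.primeFactors,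
        (Finset.univ.filter fun x : ZMod q => p ∣ x.val).card ^ d := by
        gcongr
        refine (Finset.card_le_card hsub).trans (Finset.card_biUnion_le.trans ?_)
        simp
    _ = ∑ p ∈ q.primeFactors,
        (2 * (Finset.univ.filter fun x : ZMod q => p ∣ x.val).card) ^ d := by
        simp_rw [mul_pow, Finset.mul_sum]
    _ ≤ ∑ p ∈ q.primeFactors, q ^ d := by
        refine Finset.sum_le_sum fun p hp => ?_
        gcongr
        exact two_mul_card_dvd_val_le hp
    _ = _ := by simp

theorem expect_not_isPrimitiveVec_le (q d : ℕ) [NeZero q]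
    [DecidablePred fun r : Fin d → ZMod q => IsPrimitiveVec r] :
    expect (unif (Fin d → ZMod q)) (fun r => if IsPrimitiveVec r then 0 else 1) ≤
      q.primeFactors.card / 2 ^ d := by
  have h := card_not_isPrimitiveVec_le q d
  rw [expect_unif, ← Finset.mul_sum]
  have h1 : ∑ r : Fin d → ZMod q, (if IsPrimitiveVec r then (0 : ℝ≥0∞) else 1) =
      ((Finset.univ.filter fun r : Fin d → ZMod q => ¬ IsPrimitiveVec r).card : ℝ≥0∞) := by
    rw [Finset.card_filter]
    push_cast
    refine Finset.sum_congr rfl fun r _ => ?_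
    split_ifs <;> rfl
  rw [h1, ENNReal.le_div_iff_mul_le (by simp) (by simp)]
  have hq : (q : ℝ≥0∞) ^ d ≠ 0 := by simp [NeZero.ne q]
  have hq' : (q : ℝ≥0∞) ^ d ≠ ∞ := by simp
  have h2 : (2 : ℝ≥0∞) ^ d *
      ((Finset.univ.filter fun r : Fin d → ZMod q => ¬ IsPrimitiveVec r).card : ℝ≥0∞) ≤
      q.primeFactors.card * (q : ℝ≥0∞) ^ d := by exact_mod_cast h
  simp only [Fintype.card_pi, ZMod.card, Finset.prod_const, Finset.card_univ, Fintype.card_fin]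
  push_cast
  rw [mul_assoc, ENNReal.inv_mul_le_iff hq hq', mul_comm, mul_comm ((q : ℝ≥0∞) ^ d)]
  exact h2

/-- If the distributions `G E` are invariant under a change of basis of the columns of `E`, then a
uniform first column may be replaced by the first unit vector. -/
theorem near_unimodular {q d N : ℕ} [NeZero q] {Ω : Type}
    (G : (Fin (N + 1) → Fin (d + 1) → ZMod q) → PMF Ω)
    (hG : ∀ R : Matrix (Fin (d + 1)) (Fin (d + 1)) (ZMod q), IsUnit R →
      ∀ E, G (fun j => R.mulVec (E j)) = G E)
    {a : Ω → ℝ≥0∞} (ha : ∀ x, a x ≤ 1) :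
    Near a (q.primeFactors.card / 2 ^ (d + 1))
      ((unif (Fin (N + 1) → Fin (d + 1) → ZMod q)).bind G)
      ((unif (Fin N → Fin (d + 1) → ZMod q)).bind fun C =>
        G (Fin.cons (Pi.single 0 1) C)) := by
  classical
  refine near_of_forall_le (fun a ha => ?_) ha
  have h1 : (unif (Fin (N + 1) → Fin (d + 1) → ZMod q)).bind G =
      (unif (Fin (d + 1) → ZMod q)).bind fun r =>
        (unif (Fin N → Fin (d + 1) → ZMod q)).bind fun C => G (Fin.cons r C) := by
    rw [← iid_unif, iid_succ, iid_unif]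
    simp only [PMF.bind_bind, PMF.bind_map]
    rfl
  rw [h1, expect_bind]
  refine le_trans ?_ (add_le_add_right (expect_not_isPrimitiveVec_le q (d + 1)) _)
  rw [← expect_const (unif (Fin (d + 1) → ZMod q))
    (expect ((unif (Fin N → Fin (d + 1) → ZMod q)).bind fun C => G (Fin.cons (Pi.single 0 1) C)) a),
    ← expect_add]
  refine expect_mono _ fun r => ?_
  split_ifs with hr
  · rw [add_zero]
    refine le_of_eq ?_
    congr 1
    -- With r = R e₀ and R permuting the uniform remaining columns, the invariance of G removes R
    -- from all columns at once. Vectors r that are not primitive are charged to the error.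
    obtain ⟨R, hR, rfl⟩ := hr.exists_matrix
    have hbij : Function.Bijective fun C : Fin N → Fin (d + 1) → ZMod q =>
        fun j => R.mulVec (C j) := by
      rw [← Finite.injective_iff_bijective]
      intro C C' h
      funext j
      exact Matrix.mulVec_injective_of_isUnit hR (congrFun h j)
    conv_lhs => rw [← unif_map_bijective hbij]
    rw [PMF.bind_map]
    congr 1
    funext C
    rw [← hG R hR, Function.comp_apply]
    congr 1
    funext j
    refine Fin.cases ?_ (fun j => ?_) j <;> simp
  · exact (expect_le_one _ ha).trans le_add_self

/-! ## A leftover hash lemma for sparse ternary vectors -/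

theorem mem_sparseVectors {n k : ℕ} {s : Fin n → ℤ} :
    s ∈ sparseVectors n k ↔ IsTernary s ∧ (Finset.univ.filter fun i => s i ≠ 0).card = k := by
  simp [sparseVectors, IsTernary]

theorem card_sparseVectors_fiber {n : ℕ} (k : ℕ) (S : Finset (Fin n)) (hS : S.card = k) :
    ((sparseVectors n k).filter fun s => (Finset.univ.filter fun i => s i ≠ 0) = S).card =
      2 ^ k := by
  classical
  have : (sparseVectors n k).filter (fun s => (Finset.univ.filter fun i => s i ≠ 0) = S) =
      Fintype.piFinset fun i => if i ∈ S then ({-1, 1} : Finset ℤ) else {0} := by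
    ext s
    rw [Finset.mem_filter, mem_sparseVectors, Fintype.mem_piFinset]
    constructor
    · rintro ⟨⟨hs, -⟩, h⟩ i
      have hi : s i ≠ 0 ↔ i ∈ S := by rw [← h]; simp
      split_ifs with hiS
      · have := hi.2 hiS
        have := hs i
        simp only [Finset.mem_insert, Finset.mem_singleton]
        tauto
      · simp only [Finset.mem_singleton]
        tauto
    · intro h
      have h' : (Finset.univ.filter fun i => s i ≠ 0) = S := by
        ext i
        have := h i
        by_cases hi : i ∈ S
        · simp only [hi, if_true, Finset.mem_insert, Finset.mem_singleton] at this
          simp only [Finset.mem_filter, Finset.mem_univ, true_and, hi, iff_true]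
          omega
        · simp only [hi, if_false, Finset.mem_singleton] at this
          simp [hi, this]
      refine ⟨⟨fun i => ?_, by rw [h', hS]⟩, h'⟩
      have := h i
      by_cases hi : i ∈ S
      · simp only [hi, if_true, Finset.mem_insert, Finset.mem_singleton] at this
        tauto
      · simp only [hi, if_false, Finset.mem_singleton] at this
        tauto
  rw [this, Fintype.card_piFinset]
  have h2 : ∀ i, (if i ∈ S then ({-1, 1} : Finset ℤ) else {0}).card = if i ∈ S then 2 else 1 := by
    intro i
    split_ifs <;> simp
  simp_rw [h2]
  rw [Finset.prod_ite, Finset.prod_const, Finset.prod_const_one, mul_one]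
  simp [hS]

theorem card_sparseVectors (n k : ℕ) : (sparseVectors n k).card = n.choose k * 2 ^ k := by
  classical
  rw [Finset.card_eq_sum_card_fiberwise (f := fun s => Finset.univ.filter fun i => s i ≠ 0)
    (t := Finset.powersetCard k Finset.univ)]
  · rw [Finset.sum_congr rfl fun S hS =>
      card_sparseVectors_fiber k S (Finset.mem_powersetCard.1 hS).2]
    simp
  · intro s hs
    simp only [Finset.mem_coe] at hs ⊢
    exact Finset.mem_powersetCard.2 ⟨Finset.subset_univ _, (mem_sparseVectors.1 hs).2⟩

section LeftoverHash

variable {G : Type} [AddCommGroup G] [Fintype G] [DecidableEq G]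

/-- Adding v at position i to a kernel vector changes the combination from 0 to ±v, so the pair (D,
v) can be recovered from the result. -/
theorem card_kernel_mul_le {n : ℕ} {t : Fin n → ℤ} {i : Fin n} (hi : t i = -1 ∨ t i = 1) :
    (Finset.univ.filter fun D : Fin n → G => ∑ j, t j • D j = 0).card * Fintype.card G ≤
      Fintype.card (Fin n → G) := by
  rw [← Finset.card_univ (α := G), ← Finset.card_product]
  refine Finset.card_le_card_of_injOn (fun x => x.1 + Pi.single i x.2) (fun _ _ => by simp) ?_
  rintro ⟨D, v⟩ hD ⟨D', v'⟩ hD' h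
  simp only [Finset.coe_product, Set.mem_prod, Finset.mem_coe, Finset.mem_filter, Finset.mem_univ,
    true_and, and_true] at hD hD' h
  have key : ∀ (D : Fin n → G) (v : G),
      ∑ j, t j • (D + Pi.single i v : Fin n → G) j = ∑ j, t j • D j + t i • v := fun D v => by
    simp only [Pi.add_apply, smul_add, Finset.sum_add_distrib]
    congr 1
    rw [Finset.sum_eq_single i]
    · simp
    · intro j _ hj
      simp [hj]
    · simp
  have h1 := key D v
  rw [h, key, hD, hD'] at h1
  have hv : v = v' := by
    rcases hi with h | h <;> simpa [h] using h1.symm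
  subst hv
  simpa using h

/-- At a position in only one of the supports the difference is ±1. With equal supports all
differences are 0 or ±2, possibly zero divisors modulo an even q, so only the entropy of the support
is exploited. -/
theorem exists_sub_eq_of_support_ne {n : ℕ} {s s' : Fin n → ℤ} (hs : IsTernary s)
    (hs' : IsTernary s')
    (h : (Finset.univ.filter fun i => s i ≠ 0) ≠ Finset.univ.filter fun i => s' i ≠ 0) :
    ∃ i, s i - s' i = -1 ∨ s i - s' i = 1 := by
  by_contra hc
  push Not at hc
  refine h (Finset.filter_congr fun i _ => ?_)
  have h1 := hc i
  have h2 := hs i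
  have h3 := hs' i
  omega

/-- For a fixed s, the 2^k vectors with the same support are given the trivial collision bound; for
all others a collision has probability at most 1/|G|. -/
theorem sum_card_collision_le (n k : ℕ) :
    ∑ s ∈ sparseVectors n k, ∑ s' ∈ sparseVectors n k,
      ((Finset.univ.filter fun D : Fin n → G => ∑ j, s j • D j = ∑ j, s' j • D j).card : ℝ) ≤
    (sparseVectors n k).card * (2 ^ k * Fintype.card (Fin n → G) +
      (sparseVectors n k).card * (Fintype.card (Fin n → G) / Fintype.card G)) := by
  have hG : (0 : ℝ) < Fintype.card G := by exact_mod_cast Fintype.card_pos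
  rw [← nsmul_eq_mul]
  refine Finset.sum_le_card_nsmul _ _ _ fun s hs => ?_
  have hs1 := mem_sparseVectors.1 hs
  calc _ ≤ ∑ s' ∈ sparseVectors n k,
        ((if (Finset.univ.filter fun i => s' i ≠ 0) = Finset.univ.filter fun i => s i ≠ 0
          then (Fintype.card (Fin n → G) : ℝ) else 0) +
          (Fintype.card (Fin n → G) : ℝ) / Fintype.card G) := ?_
    _ = _ := by
      rw [Finset.sum_add_distrib, ← Finset.sum_filter, Finset.sum_const, Finset.sum_const,
        card_sparseVectors_fiber k _ hs1.2]
      simp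
  refine Finset.sum_le_sum fun s' hs' => ?_
  have hs2 := mem_sparseVectors.1 hs'
  split_ifs with h
  · refine le_add_of_le_of_nonneg ?_ (by positivity)
    exact_mod_cast Finset.card_le_univ _
  · rw [zero_add, le_div_iff₀ hG]
    obtain ⟨i, hi⟩ := exists_sub_eq_of_support_ne hs1.1 hs2.1 (Ne.symm h)
    have := card_kernel_mul_le (G := G) (t := fun j => s j - s' j) hi
    simp only [sub_smul, Finset.sum_sub_distrib, sub_eq_zero] at this
    exact_mod_cast this

/-- The classical second-moment argument. With `c D y` the conditional probability of y given D, the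
average collision probability is at most 1/|G| + 1/C(n,k), since the factor 2^k of signs cancels.
The excess 1/C(n,k) is the squared ℓ² distance to uniform, and Cauchy–Schwarz turns it into an ℓ¹
bound. -/
theorem leftover_hash_real {n k : ℕ} (hkn : k ≤ n) (a : (Fin n → G) → G → ℝ)
    (ha0 : ∀ D y, 0 ≤ a D y) (ha1 : ∀ D y, a D y ≤ 1) :
    (∑ D, ∑ s ∈ sparseVectors n k, a D (∑ j, s j • D j) / (sparseVectors n k).card) /
        Fintype.card (Fin n → G) ≤
      (∑ D, ∑ y, a D y / Fintype.card G) / Fintype.card (Fin n → G) +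
        √(Fintype.card G / n.choose k) := by
  set S := sparseVectors n k with hS
  set M : ℝ := (Fintype.card (Fin n → G) : ℝ) with hM
  set Q : ℝ := (Fintype.card G : ℝ) with hQ
  have hM0 : 0 < M := Nat.cast_pos.2 Fintype.card_pos
  have hQ0 : 0 < Q := Nat.cast_pos.2 Fintype.card_pos
  have hC0 : (0 : ℝ) < n.choose k := by exact_mod_cast Nat.choose_pos hkn
  have hS0 : (0 : ℝ) < S.card := by exact_mod_cast (sparseVectors_nonempty hkn).card_pos
  set c : (Fin n → G) → G → ℝ := fun D y =>
    ((S.filter fun s => ∑ j, s j • D j = y).card : ℝ) / S.card with hc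
  have hsum : ∀ D, ∑ y, c D y = 1 := fun D => by
    simp only [hc]
    rw [← Finset.sum_div, ← Nat.cast_sum, ← Finset.card_eq_sum_card_fiberwise, div_self hS0.ne']
    intro s _
    simp
  have h1 : ∀ D, ∑ s ∈ S, a D (∑ j, s j • D j) / S.card = ∑ y, a D y * c D y := fun D => by
    rw [← Finset.sum_fiberwise (s := S) (g := fun s => ∑ j, s j • D j)]
    refine Finset.sum_congr rfl fun y _ => ?_
    rw [Finset.sum_congr rfl (g := fun _ => a D y / S.card)]
    · simp [hc]
      ring
    · intro s hs
      rw [(Finset.mem_filter.1 hs).2]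
  have hsq : ∑ D, ∑ y, (c D y) ^ 2 ≤ M / n.choose k + M / Q := by
    have e1 : ∀ D, ∑ y, (c D y) ^ 2 =
        (∑ s ∈ S, ∑ s' ∈ S, if ∑ j, s j • D j = ∑ j, s' j • D j then (1 : ℝ) else 0) /
          (S.card : ℝ) ^ 2 := fun D => by
      simp only [hc, div_pow, ← Finset.sum_div]
      congr 1
      have : ∀ y, ((S.filter fun s => ∑ j, s j • D j = y).card : ℝ) =
          ∑ s ∈ S, if ∑ j, s j • D j = y then (1 : ℝ) else 0 := fun y => by
        rw [Finset.card_filter]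
        push_cast
        rfl
      simp_rw [this, pow_two, Finset.sum_mul_sum]
      rw [Finset.sum_comm]
      refine Finset.sum_congr rfl fun s _ => ?_
      rw [Finset.sum_comm]
      refine Finset.sum_congr rfl fun s' _ => ?_
      rw [Finset.sum_eq_single (∑ j, s j • D j)]
      · simp [eq_comm]
      · intro y _ hy
        rw [if_neg (Ne.symm hy), zero_mul]
      · simp
    simp_rw [e1]
    rw [← Finset.sum_div, Finset.sum_comm]
    have e2 : ∑ s ∈ S, ∑ D : Fin n → G, ∑ s' ∈ S,
        (if ∑ j, s j • D j = ∑ j, s' j • D j then (1 : ℝ) else 0) =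
        ∑ s ∈ S, ∑ s' ∈ S, ((Finset.univ.filter fun D : Fin n → G =>
          ∑ j, s j • D j = ∑ j, s' j • D j).card : ℝ) := by
      refine Finset.sum_congr rfl fun s _ => ?_
      rw [Finset.sum_comm]
      refine Finset.sum_congr rfl fun s' _ => ?_
      rw [Finset.card_filter]
      push_cast
      rfl
    rw [e2, div_le_iff₀ (by positivity)]
    refine (sum_card_collision_le n k).trans (le_of_eq ?_)
    have hcard : (S.card : ℝ) = n.choose k * 2 ^ k := by
      rw [hS, card_sparseVectors]
      push_cast
      rfl
    rw [← hS, hcard, ← hM, ← hQ]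
    field_simp
  have hvar : ∑ D, ∑ y, (c D y - 1 / Q) ^ 2 ≤ M / n.choose k := by
    have : ∀ D, ∑ y, (c D y - 1 / Q) ^ 2 = ∑ y, (c D y) ^ 2 - 1 / Q := fun D => by
      simp only [sub_sq, Finset.sum_add_distrib, Finset.sum_sub_distrib, ← Finset.sum_mul,
        ← Finset.mul_sum, hsum]
      rw [Finset.sum_const, Finset.card_univ, nsmul_eq_mul, ← hQ]
      field_simp
      ring
    simp_rw [this]
    rw [Finset.sum_sub_distrib, Finset.sum_const, Finset.card_univ, nsmul_eq_mul, ← hM]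
    have : M * (1 / Q) = M / Q := by ring
    linarith
  -- Cauchy–Schwarz over the M · Q pairs (D, y).
  have hcs : (∑ D, ∑ y, |c D y - 1 / Q|) ^ 2 ≤ M * Q * (M / n.choose k) := by
    rw [← Fintype.sum_prod_type' (f := fun D y => |c D y - 1 / Q|)]
    refine (sq_sum_le_card_mul_sum_sq).trans ?_
    simp only [sq_abs]
    rw [Fintype.sum_prod_type' (f := fun D y => (c D y - 1 / Q) ^ 2), Finset.card_univ,
      Fintype.card_prod]
    push_cast
    rw [← hM, ← hQ]
    gcongr
  have habs : ∑ D, ∑ y, |c D y - 1 / Q| ≤ M * √(Q / n.choose k) := by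
    refine abs_le_of_sq_le_sq' ?_ (by positivity) |>.2
    rw [mul_pow, Real.sq_sqrt (by positivity)]
    refine hcs.trans (le_of_eq ?_)
    ring
  simp_rw [h1]
  rw [div_le_iff₀ hM0, add_mul, div_mul_cancel₀ _ hM0.ne', mul_comm (√_)]
  refine le_trans ?_ (add_le_add_right habs _)
  rw [← Finset.sum_add_distrib]
  refine Finset.sum_le_sum fun D _ => ?_
  rw [← Finset.sum_add_distrib]
  refine Finset.sum_le_sum fun y _ => ?_
  have h2 : a D y * (c D y - 1 / Q) ≤ |c D y - 1 / Q| := by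
    calc _ ≤ a D y * |c D y - 1 / Q| := by gcongr; exacts [ha0 _ _, le_abs_self _]
      _ ≤ 1 * |c D y - 1 / Q| := by gcongr; exact ha1 _ _
      _ = _ := one_mul _
  have : a D y * c D y = a D y / Q + a D y * (c D y - 1 / Q) := by ring
  linarith

/-- The uniform distribution on the sparse vectors. -/
noncomputable def unifSparse {n k : ℕ} (h : k ≤ n) : PMF (Fin n → ℤ) :=
  PMF.uniformOfFinset (sparseVectors n k) (sparseVectors_nonempty h)

theorem expect_unifSparse {n k : ℕ} (h : k ≤ n) (f : (Fin n → ℤ) → ℝ≥0∞) :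
    expect (unifSparse h) f =
      ∑ s ∈ sparseVectors n k, ((sparseVectors n k).card : ℝ≥0∞)⁻¹ * f s := by
  unfold expect unifSparse
  rw [tsum_eq_sum (s := sparseVectors n k)]
  · refine Finset.sum_congr rfl fun s hs => ?_
    rw [PMF.uniformOfFinset_apply_of_mem _ hs]
  · intro s hs
    rw [PMF.uniformOfFinset_apply_of_notMem _ hs, zero_mul]

/-- The random combination of uniform group elements with sparse ternary coefficients is close to
uniform. -/
theorem near_leftover_hash [Nonempty G] {n k : ℕ} (hkn : k ≤ n) {Ω : Type}
    (F : (Fin n → G) → G → PMF Ω) {a : Ω → ℝ≥0∞} (ha : ∀ x, a x ≤ 1) :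
    Near a (ENNReal.ofReal √(Fintype.card G / n.choose k))
      ((unif (Fin n → G)).bind fun D => (unifSparse hkn).bind fun s => F D (∑ j, s j • D j))
      ((unif (Fin n → G)).bind fun D => (unif G).bind (F D)) := by
  refine near_of_forall_le (fun a ha => ?_) ha
  have hS0 : (0 : ℝ) < (sparseVectors n k).card := by
    exact_mod_cast (sparseVectors_nonempty hkn).card_pos
  have hG0 : (0 : ℝ) < Fintype.card G := by exact_mod_cast Fintype.card_pos
  have hM0 : (0 : ℝ) < Fintype.card (Fin n → G) := by exact_mod_cast Fintype.card_pos
  set f : (Fin n → G) → G → ℝ := fun D y => (expect (F D y) a).toReal with hf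
  have hf' : ∀ D y, expect (F D y) a = ENNReal.ofReal (f D y) := fun D y =>
    (ENNReal.ofReal_toReal (ne_top_of_le_ne_top ENNReal.one_ne_top (expect_le_one _ ha))).symm
  have hinv : ∀ N : ℕ, (0 : ℝ) < N → ((N : ℝ≥0∞))⁻¹ = ENNReal.ofReal ((N : ℝ)⁻¹) :=
    fun N hN => by rw [ENNReal.ofReal_inv_of_pos hN, ENNReal.ofReal_natCast]
  have hf0 : ∀ D y, 0 ≤ f D y := fun _ _ => ENNReal.toReal_nonneg
  have hreal := leftover_hash_real hkn f hf0
    (fun D y => by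
      have := ENNReal.toReal_mono ENNReal.one_ne_top (expect_le_one (F D y) ha)
      simpa using this)
  simp only [expect_bind, expect_unif, expect_unifSparse, hf', hinv _ hS0, hinv _ hG0, hinv _ hM0]
  have e : ∀ {ι : Type} (T : Finset ι) (x : ℝ) (g : ι → ℝ), 0 ≤ x → (∀ i, 0 ≤ g i) →
      ∑ i ∈ T, ENNReal.ofReal x * ENNReal.ofReal (g i) = ENNReal.ofReal (∑ i ∈ T, x * g i) :=
    fun T x g hx hg => by
      rw [ENNReal.ofReal_sum_of_nonneg fun i _ => mul_nonneg hx (hg i)]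
      refine Finset.sum_congr rfl fun i _ => ?_
      rw [ENNReal.ofReal_mul hx]
  simp only [e _ _ _ (inv_nonneg.2 hS0.le) fun s => hf0 _ _,
    e _ _ _ (inv_nonneg.2 hG0.le) fun s => hf0 _ _]
  rw [e _ _ _ (inv_nonneg.2 hM0.le) fun D => Finset.sum_nonneg fun s _ =>
      mul_nonneg (inv_nonneg.2 hS0.le) (hf0 _ _),
    e _ _ _ (inv_nonneg.2 hM0.le) fun D => Finset.sum_nonneg fun s _ =>
      mul_nonneg (inv_nonneg.2 hG0.le) (hf0 _ _),
    ← ENNReal.ofReal_add _ (Real.sqrt_nonneg _)]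
  · apply ENNReal.ofReal_le_ofReal
    convert hreal using 2
    · simp only [← Finset.mul_sum, ← Finset.sum_div]
      ring
    · simp only [← Finset.mul_sum, ← Finset.sum_div]
      ring
  · exact Finset.sum_nonneg fun D _ => mul_nonneg (inv_nonneg.2 hM0.le)
      (Finset.sum_nonneg fun s _ => mul_nonneg (inv_nonneg.2 hG0.le) (hf0 _ _))

end LeftoverHash

/-- The elementary lower bound on binomial coefficients. -/
theorem div_pow_le_choose : ∀ {n k : ℕ}, k ≤ n → ((n : ℝ) / k) ^ k ≤ n.choose k
  | _, 0, _ => by simp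
  | 0, k + 1, h => by omega
  | n + 1, k + 1, h => by
    have hk : k ≤ n := by omega
    have ih := div_pow_le_choose hk
    have h1 : ((n + 1).choose (k + 1) : ℝ) = ((n + 1 : ℕ) : ℝ) / ((k + 1 : ℕ) : ℝ) * n.choose k := by
      have := Nat.add_one_mul_choose_eq n k
      rw [div_mul_eq_mul_div, eq_div_iff (by positivity)]
      exact_mod_cast this.symm
    rw [h1, pow_succ']
    gcongr
    refine le_trans ?_ ih
    rcases Nat.eq_zero_or_pos k with rfl | hk0
    · simp
    · gcongr ?_ ^ k
      have hk' : (0 : ℝ) < k := by exact_mod_cast hk0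
      have hkn : (k : ℝ) ≤ n := by exact_mod_cast hk
      push_cast
      rw [div_le_div_iff₀ (by positivity) hk']
      nlinarith

/-! ## Rows of LWE samples -/

theorem pathMap_init_bijective {n : ℕ} {s : Fin n → ℤ} (hs : IsTernary s) {G : Type}
    [AddCommGroup G] [Finite G] :
    Function.Bijective fun (w : Fin n → G) (j : Fin n) => pathMap s w 0 0 0 j.castSucc := by
  rw [← Finite.injective_iff_bijective]
  exact fun w w' h => pathMap_injective hs w w' 0 (congrFun h)

theorem pathMap_last_zero {n : ℕ} {s : Fin n → ℤ} (hs : IsTernary s) {G : Type}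
    [AddCommGroup G] (w : Fin n → G) :
    pathMap s w 0 0 0 (Fin.last n) = ∑ j, s j • pathMap s w 0 0 0 j.castSucc := by
  rw [pathMap_last hs, sub_zero]

theorem pathMap_add_left {M : Type} [AddCommGroup M] {N : ℕ} (s : Fin N → ℤ) (w w' : Fin N → M) :
    pathMap s (w + w') 0 0 0 = pathMap s w 0 0 0 + pathMap s w' 0 0 0 := by
  have := pathMap_add s w 0 w' 0 0 0 0 0
  simpa using this

/-- The part of the noise on the path that is independent of the noise of the LWE samples. -/
noncomputable def restNoise (σ : ℝ) {N : ℕ} (s : Fin (N + 1) → ℤ) : PMF (Fin (N + 2) → ℤ) :=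
  (discreteGaussian σ).bind fun z => (pathNoise σ s).bind fun t =>
    (discreteGaussian (√2 * σ)).bind fun b => (discreteGaussian (√2 * σ)).map fun u =>
      pathMap s (Fin.cons z 0) t b u

/-- By linearity of the path map, the inputs z₁, …, z_N can be supplied by the errors of N = n - 1
LWE samples. Everything else, including z₀, is sampled by the reduction. -/
theorem noisePath_eq_bind_restNoise (σ : ℝ) {N : ℕ} (s : Fin (N + 1) → ℤ) :
    (discreteGaussian (√2 * σ)).bind (noisePath σ s) =
      (iid N (discreteGaussian σ)).bind fun z => (restNoise σ s).map fun x =>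
        pathMap s (Fin.cons 0 z) 0 0 0 + x := by
  have e : noisePath σ s = fun b => noisePath σ s b := rfl
  have key : ∀ (z : Fin N → ℤ) (z0 : ℤ) t b u, pathMap s (Fin.cons 0 z) 0 0 0 +
      pathMap s (Fin.cons z0 0) t b u = pathMap s (Fin.cons z0 z) t b u := fun z z0 t b u => by
    rw [← pathMap_add]
    congr 1
    · funext i
      refine Fin.cases ?_ (fun i => ?_) i <;> simp
    · simp
    · simp
    · simp
  rw [e]
  simp only [noisePath, restNoise, iid_succ, PMF.map_bind, PMF.map_comp, Function.comp_def, key,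
    PMF.bind_bind, PMF.bind_map]
  rw [PMF.bind_comm]
  conv_rhs => rw [PMF.bind_comm]
  congr 1
  funext z0
  rw [PMF.bind_comm]
  congr 1
  funext z
  rw [PMF.bind_comm]

section Vectors

variable {q : ℕ}

/-- An integer vector modulo `q`. -/
def castVec {N : ℕ} (x : Fin N → ℤ) : Fin N → ZMod q := fun i => (x i : ZMod q)

/-- A vector of length `n + 1` as an LWE sample in dimension `n`. -/
def toSample {n : ℕ} (x : Fin (n + 1) → ZMod q) : Sample q n :=
  (fun j => x j.castSucc, x (Fin.last n))

theorem toSample_bijective {n : ℕ} :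
    Function.Bijective (toSample : (Fin (n + 1) → ZMod q) → Sample q n) := by
  constructor
  · intro x y h
    funext j
    refine Fin.lastCases ?_ (fun j => ?_) j
    · exact congrArg Prod.snd h
    · exact congrFun (congrArg Prod.fst h) j
  · rintro ⟨a, y⟩
    exact ⟨Fin.snoc a y, by simp [toSample]⟩

/-- The path map of a random vector, masked by integer noise. -/
noncomputable def pathRow {n : ℕ} (s : Fin n → ℤ) (W : PMF (Fin n → ZMod q))
    (ν : PMF (Fin (n + 1) → ℤ)) : PMF (Sample q n) :=
  W.bind fun w => ν.map fun x => toSample (pathMap s w 0 0 0 + castVec x)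

theorem Dom.pathRow {n : ℕ} (s : Fin n → ℤ) (W : PMF (Fin n → ZMod q)) {c : ℝ≥0∞}
    {ν ν' : PMF (Fin (n + 1) → ℤ)} (h : Dom c ν ν') :
    Dom c (pathRow s W ν) (pathRow s W ν') :=
  Dom.bind_right _ fun _ => h.map _

theorem castVec_dotProduct {n : ℕ} (s : Fin n → ℤ) (a : Fin n → ZMod q) :
    castVec s ⬝ᵥ a = ∑ j, s j • a j := by
  simp [castVec, dotProduct]

theorem castVec_pathMap {N : ℕ} (s : Fin N → ℤ) (z t : Fin N → ℤ) (b u : ℤ) :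
    (castVec (pathMap s z t b u) : Fin (N + 1) → ZMod q) =
      pathMap s (castVec z) (castVec t) (b : ZMod q) (u : ZMod q) := by
  funext i
  exact pathMap_map (Int.castAddHom (ZMod q)) s z t b u i

theorem castVec_add {N : ℕ} (x y : Fin N → ℤ) :
    (castVec (x + y) : Fin N → ZMod q) = castVec x + castVec y := by
  funext i
  simp [castVec]

theorem castVec_cons_zero {N : ℕ} (z : Fin N → ℤ) :
    (castVec (Fin.cons 0 z) : Fin (N + 1) → ZMod q) = Fin.cons 0 (castVec z) := by
  funext i
  refine Fin.cases ?_ (fun i => ?_) i <;> simp [castVec]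

theorem castVec_zero {N : ℕ} : (castVec 0 : Fin N → ZMod q) = 0 := by
  funext i
  simp [castVec]

theorem cons_dotProduct_cons {d : ℕ} (w b : ZMod q) (S B : Fin d → ZMod q) :
    (Fin.cons w S : Fin (d + 1) → ZMod q) ⬝ᵥ (Fin.cons b B : Fin (d + 1) → ZMod q) =
      w * b + S ⬝ᵥ B := by
  simp [dotProduct, Fin.sum_univ_succ]

theorem pathRow_noisePath (σ : ℝ) {N : ℕ} (s : Fin (N + 1) → ℤ) (W : PMF (Fin (N + 1) → ZMod q)) :
    pathRow s W ((discreteGaussian (√2 * σ)).bind (noisePath σ s)) =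
      W.bind fun w => (iid N (discreteGaussian σ)).bind fun z => (restNoise σ s).map fun x =>
        toSample (pathMap s (w + Fin.cons 0 (castVec z)) 0 0 0 + castVec x) := by
  unfold pathRow
  simp only [noisePath_eq_bind_restNoise, PMF.map_bind, PMF.map_comp, Function.comp_def,
    castVec_add, castVec_pathMap, castVec_cons_zero, castVec_zero, Int.cast_zero,
    pathMap_add_left, ← add_assoc]

end Vectors

section Rows

variable {q : ℕ} [NeZero q]

/-- The distribution of the second components of the samples with the first components `B`,
for a uniform secret. -/
noncomputable def lweRow (σ : ℝ) {N d : ℕ} (B : Fin N → Fin d → ZMod q) : PMF (Fin N → ZMod q) :=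
  (unif (Fin d → ZMod q)).bind fun S =>
    (iid N (discreteGaussian σ)).map fun z t => S ⬝ᵥ B t + (z t : ZMod q)

/-- The second components of matrix-secret LWE samples, as a matrix. -/
noncomputable def lweMatrix (q : ℕ) [NeZero q] (σ : ℝ) (m N d : ℕ) :
    PMF (Fin m → Fin N → ZMod q) :=
  (unif (Fin N → Fin d → ZMod q)).bind fun B => iid m (lweRow σ B)

/-- The reduction from the matrix assumption discards the public vectors; transposition turns
samples into rows, one per row of the secret, with a common B. -/
theorem matrixLwe_map (σ : ℝ) (m N d : ℕ) :
    (matrixLwe q d m N (unif (Fin m → Fin d → ZMod q)) (iid m (discreteGaussian σ))).map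
      (fun x i t => (x t).2 i) = lweMatrix q σ m N d := by
  have h1 : ∀ S : Fin m → Fin d → ZMod q,
      iid N ((PMF.uniformOfFintype (Fin d → ZMod q)).bind fun a =>
        (iid m (discreteGaussian σ)).map fun e => (a, fun i => S i ⬝ᵥ a + (e i : ZMod q))) =
      (unif (Fin N → Fin d → ZMod q)).bind fun B =>
        (iid N (iid m (discreteGaussian σ))).map
          fun E t => (B t, fun i => S i ⬝ᵥ B t + (E t i : ZMod q)) := fun S => by
    rw [iid_bind, iid_unif]
    congr 1
    funext B
    exact indep_map _ fun t (e : Fin m → ℤ) => (B t, fun i => S i ⬝ᵥ B t + (e i : ZMod q))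
  have h2 : ∀ B : Fin N → Fin d → ZMod q, iid m (lweRow σ B) =
      (unif (Fin m → Fin d → ZMod q)).bind fun S =>
        (iid m (iid N (discreteGaussian σ))).map
          fun E i t => S i ⬝ᵥ B t + (E i t : ZMod q) := fun B => by
    unfold lweRow
    rw [iid_bind, iid_unif]
    congr 1
    funext S
    exact indep_map _ fun i (z : Fin N → ℤ) t => S i ⬝ᵥ B t + (z t : ZMod q)
  unfold matrixLwe lweMatrix
  simp_rw [h1, h2]
  simp only [PMF.map_bind, PMF.map_comp]
  rw [PMF.bind_comm]
  congr 1
  funext B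
  congr 1
  funext S
  rw [← iid_swap, PMF.map_comp]
  rfl

theorem unif_matrixSample_map (m N d : ℕ) :
    (unif (Fin N → MatrixSample q d m)).map (fun x i t => (x t).2 i) =
      unif (Fin m → Fin N → ZMod q) := by
  have h1 : (unif (MatrixSample q d m)).map Prod.snd = unif (Fin m → ZMod q) := by
    ext y
    rw [PMF.map_apply, tsum_fintype]
    simp only [PMF.uniformOfFintype_apply, Fintype.card_prod]
    rw [Fintype.sum_prod_type]
    simp only [Finset.sum_ite_eq, Finset.mem_univ, if_true, Finset.sum_const, Finset.card_univ,
      nsmul_eq_mul]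
    push_cast
    rw [ENNReal.mul_inv (by simp) (by simp), ← mul_assoc, ENNReal.mul_inv_cancel, one_mul]
    · simp [NeZero.ne q]
    · simp
  have h2 := iid_map N (unif (MatrixSample q d m)) Prod.snd
  rw [h1, iid_unif, iid_unif] at h2
  have h3 := congrArg (PMF.map Function.swap) h2
  rw [PMF.map_comp] at h3
  exact h3.symm.trans (unif_map_bijective Function.swap_bijective)

theorem lwe_eq (d N : ℕ) (𝒮 : PMF (Fin d → ZMod q)) (ℰ : PMF ℤ) :
    lwe q d N 𝒮 ℰ = 𝒮.bind fun s => iid N <| (unif (Fin d → ZMod q)).bind fun a =>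
      ℰ.map fun e : ℤ => (a, s ⬝ᵥ a + (e : ZMod q)) := by
  unfold lwe
  congr 1
  funext s
  congr 2
  funext a
  exact PMF.map_comp (fun e : ℤ => (e : ZMod q)) ℰ fun e => (a, s ⬝ᵥ a + e)

/-- The distribution of one sample with the sparse secret `s`. -/
noncomputable def sparseRow (q : ℕ) [NeZero q] (σ : ℝ) {n : ℕ} (s : Fin n → ℤ) :
    PMF (Sample q n) :=
  (unif (Fin n → ZMod q)).bind fun a =>
    (discreteGaussian σ).map fun e : ℤ => (a, castVec s ⬝ᵥ a + (e : ZMod q))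

theorem lwe_sparseSecret {n k : ℕ} (hkn : k ≤ n) (m : ℕ) (σ : ℝ) :
    lwe q n m (sparseSecret q hkn) (discreteGaussian σ) =
      (unifSparse hkn).bind fun s => iid m (sparseRow q σ s) := by
  rw [lwe_eq, sparseSecret, PMF.bind_map]
  rfl

/-- The path map masked by spherical noise is, up to the shape of the noise, a sparse LWE sample. -/
theorem dom_pathRow_sparseRow {σ : ℝ} (hσ : 0 < σ) {κ : ℝ≥0∞} (h : SmoothAbove κ (σ / 2))
    {n k : ℕ} {s : Fin n → ℤ} (hs : s ∈ sparseVectors n k) :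
    Dom (κ ^ n) (pathRow s (unif (Fin n → ZMod q)) (iid (n + 1) (discreteGaussian (2 * σ))))
      (sparseRow q (2 * σ * √(k + 1)) s) := by
  obtain ⟨hs1, hs2⟩ := mem_sparseVectors.1 hs
  have h1 := dom_gaussian_inner hσ h hs1 1 le_rfl
  rw [hs2] at h1
  have e1 : 2 * σ * √((1 : ℕ) : ℝ) = 2 * σ := by simp
  have e2 : ((1 + k : ℕ) : ℝ) = k + 1 := by push_cast; ring
  rw [e1, e2] at h1
  have h2 := Dom.bind_right (unif (Fin n → ZMod q)) fun a =>
    h1.map fun e : ℤ => ((a, castVec s ⬝ᵥ a + (e : ZMod q)) : Sample q n)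
  convert h2 using 1
  swap
  · rfl
  have h3 : iid (n + 1) (discreteGaussian (2 * σ)) =
      (discreteGaussian (2 * σ)).bind fun e => (iid n (discreteGaussian (2 * σ))).map
        fun x => (Fin.snoc (α := fun _ => ℤ) x e : Fin (n + 1) → ℤ) := by
    ext y
    rw [PMF.bind_apply, tsum_eq_single (y (Fin.last n))]
    · rw [PMF.map_apply, tsum_eq_single (Fin.init y)]
      · simp [iid_eq_indep, indep_apply, Fin.prod_univ_castSucc, mul_comm, Fin.init]
      · intro b hb
        rw [if_neg]
        rintro h
        exact hb (by rw [h, Fin.init_snoc])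
    · intro b hb
      rw [PMF.map_apply, ENNReal.tsum_eq_zero.2, mul_zero]
      intro x
      rw [if_neg]
      rintro h
      exact hb (by rw [h, Fin.snoc_last])
  unfold pathRow
  rw [h3]
  simp only [PMF.map_bind, PMF.map_comp]
  rw [PMF.bind_comm]
  conv_rhs => rw [PMF.bind_comm]
  congr 1
  funext e
  simp only [← PMF.bind_pure_comp]
  rw [PMF.bind_comm]
  conv_rhs => rw [PMF.bind_comm]
  congr 1
  funext x
  simp only [Function.comp_def]
  -- For fixed noise x the first component a = path + x is uniform. As the last path coordinate is
  -- ⟨s, a - x⟩, the error of the sample becomes e - ⟨s,x⟩.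
  have hb : Function.Bijective fun (w : Fin n → ZMod q) (j : Fin n) =>
      pathMap s w 0 0 0 j.castSucc + castVec x j :=
    (Equiv.addRight (castVec x : Fin n → ZMod q)).bijective.comp (pathMap_init_bijective hs1)
  conv_rhs => rw [← unif_map_bijective hb]
  rw [PMF.bind_map]
  congr 1
  funext w
  simp only [Function.comp_apply]
  congr 1
  refine Prod.ext ?_ ?_
  · funext j
    simp [toSample, castVec]
  · simp only [toSample, Pi.add_apply, pathMap_last_zero hs1, castVec_dotProduct]
    simp [castVec, Finset.sum_add_distrib]

/-- The constants that the reduction adds to the path map of its challenge. -/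
noncomputable def hardwired (σ : ℝ) {N : ℕ} (s : Fin (N + 1) → ℤ) (b : Fin N → ZMod q) :
    PMF (Fin (N + 2) → ZMod q) :=
  (unif (ZMod q)).bind fun w => (restNoise σ s).map fun x =>
    pathMap s (Fin.cons w fun t => w * b t) 0 0 0 + castVec x

/-- The reduction: the path map of a row of the challenge, shifted by a constant. -/
def reduceRow {N : ℕ} (s : Fin (N + 1) → ℤ) (v : Fin N → ZMod q) (c : Fin (N + 2) → ZMod q) :
    Sample q (N + 1) :=
  toSample (pathMap s (Fin.cons 0 v) 0 0 0 + c)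

theorem bind_hardwired (σ : ℝ) {N : ℕ} (s : Fin (N + 1) → ℤ) (b : Fin N → ZMod q)
    (V : PMF (Fin N → ZMod q)) :
    (V.bind fun v => (hardwired σ s b).map (reduceRow s v)) =
      V.bind fun v => (unif (ZMod q)).bind fun w => (restNoise σ s).map fun x =>
        toSample (pathMap s (Fin.cons w fun t => v t + w * b t) 0 0 0 + castVec x) := by
  simp only [hardwired, PMF.map_bind, PMF.map_comp, Function.comp_def, reduceRow, ← add_assoc,
    ← pathMap_add_left]
  congr 1
  funext v
  congr 1
  funext w
  congr 1
  funext x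
  congr 4
  funext i
  refine Fin.cases ?_ (fun i => ?_) i <;> simp

/-- On a uniform challenge, the reduction yields the path map of a uniform vector. -/
theorem bind_hardwired_unif (σ : ℝ) {N : ℕ} (s : Fin (N + 1) → ℤ) (b : Fin N → ZMod q) :
    ((unif (Fin N → ZMod q)).bind fun v => (hardwired σ s b).map (reduceRow s v)) =
      pathRow s (unif _) ((discreteGaussian (√2 * σ)).bind (noisePath σ s)) := by
  rw [bind_hardwired, pathRow_noisePath]
  -- A uniform w absorbs the shift by z. Below, the uniform challenge absorbs w b_t in the same way.
  have h1 : ((unif (Fin (N + 1) → ZMod q)).bind fun w => (iid N (discreteGaussian σ)).bind fun z =>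
      (restNoise σ s).map fun x =>
        (toSample (pathMap s (w + Fin.cons 0 (castVec z)) 0 0 0 + castVec x) : Sample q (N + 1))) =
      (unif (Fin (N + 1) → ZMod q)).bind fun w => (restNoise σ s).map fun x =>
        toSample (pathMap s w 0 0 0 + castVec x) := by
    rw [PMF.bind_comm]
    conv_rhs => rw [← PMF.bind_const (iid N (discreteGaussian σ))
      ((unif (Fin (N + 1) → ZMod q)).bind fun w => (restNoise σ s).map fun x =>
        toSample (pathMap s w 0 0 0 + castVec x))]
    congr 1
    funext z
    conv_rhs => rw [← unif_map_bijective (Equiv.addRight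
      (Fin.cons 0 (castVec z) : Fin (N + 1) → ZMod q)).bijective]
    rw [PMF.bind_map]
    rfl
  rw [h1, ← iid_unif (N + 1), iid_succ, PMF.bind_comm, iid_unif]
  simp only [PMF.bind_bind, PMF.bind_map, Function.comp_def]
  congr 1
  funext w
  conv_rhs => rw [← unif_map_bijective (Equiv.addRight
      (fun t => w * b t : Fin N → ZMod q)).bijective]
  rw [PMF.bind_map]
  rfl

/-- The distribution of `S` times the columns `E`, for a uniform row `S`. -/
noncomputable def unifComb {N d : ℕ} (E : Fin N → Fin d → ZMod q) : PMF (Fin N → ZMod q) :=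
  (unif (Fin d → ZMod q)).map fun S j => S ⬝ᵥ E j

/-- On an LWE challenge, the reduction yields the path map of uniform combinations of columns in
dimension `d + 1`, the first of which is the first unit vector. -/
theorem bind_hardwired_lweRow (σ : ℝ) {N d : ℕ} (s : Fin (N + 1) → ℤ) (b : Fin N → ZMod q)
    (B : Fin N → Fin d → ZMod q) :
    ((lweRow σ B).bind fun v => (hardwired σ s b).map (reduceRow s v)) =
      pathRow s (unifComb (Fin.cons (Pi.single 0 1)
        fun t => (Fin.cons (b t) (B t) : Fin (d + 1) → ZMod q)))
        ((discreteGaussian (√2 * σ)).bind (noisePath σ s)) := by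
  rw [bind_hardwired, pathRow_noisePath]
  unfold lweRow unifComb
  rw [← iid_unif (d + 1), iid_succ, iid_unif]
  simp only [PMF.bind_bind, PMF.bind_map, Function.comp_def, PMF.map_bind, PMF.map_comp]
  conv_rhs => rw [PMF.bind_comm]
  congr 1
  funext S
  rw [PMF.bind_comm]
  congr 1
  funext w
  congr 1
  funext z
  congr 1
  funext x
  congr 3
  funext i
  refine Fin.cases ?_ (fun i => ?_) i
  · simp
  · simp [castVec, cons_dotProduct_cons]
    ring

end Rows

/-! ## The chain of hybrids -/

theorem Near.bind_right_of_support {Ω Ω' : Type} {a : Ω' → ℝ≥0∞} {δ : ℝ≥0∞} (P : PMF Ω)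
    {F G : Ω → PMF Ω'} (h : ∀ x ∈ P.support, Near a δ (F x) (G x)) :
    Near a δ (P.bind F) (P.bind G) := by
  classical
  have e : ∀ F' : Ω → PMF Ω', expect (P.bind F') a =
      expect P fun x => if x ∈ P.support then expect (F' x) a else 0 := fun F' => by
    rw [expect_bind]
    refine tsum_congr fun x => ?_
    beta_reduce
    split_ifs with hx
    · rfl
    · rw [PMF.mem_support_iff, not_not] at hx
      simp [hx]
  constructor
  · rw [e, e, ← expect_const P δ, ← expect_add]
    refine expect_mono P fun x => ?_
    split_ifs with hx
    · exact (h x hx).1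
    · simp
  · rw [e, e, ← expect_const P δ, ← expect_add]
    refine expect_mono P fun x => ?_
    split_ifs with hx
    · exact (h x hx).2
    · simp

theorem Dom.bind_right_of_support {Ω Ω' : Type} {c : ℝ≥0∞} (P : PMF Ω) {F G : Ω → PMF Ω'}
    (h : ∀ x ∈ P.support, Dom c (F x) (G x)) : Dom c (P.bind F) (P.bind G) := fun y => by
  simp only [PMF.bind_apply, ← ENNReal.tsum_mul_left]
  refine ENNReal.tsum_le_tsum fun x => ?_
  by_cases hx : x ∈ P.support
  · rw [mul_left_comm]
    gcongr
    exact h x hx y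
  · rw [PMF.mem_support_iff, not_not] at hx
    simp [hx]

theorem mem_support_unifSparse {n k : ℕ} (h : k ≤ n) {s : Fin n → ℤ}
    (hs : s ∈ (unifSparse h).support) : s ∈ sparseVectors n k :=
  (PMF.mem_support_uniformOfFinset_iff _ _).1 hs

/-- Drawing the constants of all rows first allows them to be fixed, after which the reduction is a
deterministic map of the challenge. -/
theorem iid_bind_map {α β γ : Type} (m : ℕ) (V : PMF α) (C : PMF β) (f : α → β → γ) :
    iid m (V.bind fun v => C.map (f v)) =
      (iid m C).bind fun c => (iid m V).map fun v i => f (v i) (c i) := by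
  have h : ∀ v : Fin m → α, indep (fun i => C.map (f (v i))) =
      (iid m C).map fun c i => f (v i) (c i) := fun v => indep_map _ fun i => f (v i)
  rw [iid_bind]
  simp only [h]
  simp only [← PMF.bind_pure_comp]
  rw [PMF.bind_comm]
  rfl

section Chain

variable {q : ℕ} [NeZero q]

/-- Uniform combinations of columns, masked by spherical noise, as samples. -/
theorem pathRow_unifComb (σ : ℝ) {n d : ℕ} (s : Fin n → ℤ) (E : Fin n → Fin d → ZMod q) :
    pathRow s (unifComb E) (iid (n + 1) (discreteGaussian σ)) =
      (lweRow σ (pathMap s E 0 0 0)).map toSample := by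
  unfold pathRow unifComb lweRow
  simp only [PMF.bind_map, PMF.map_bind, PMF.map_comp, Function.comp_def]
  congr 1
  funext S
  congr 1
  funext x
  congr 1
  funext j
  have := pathMap_map (⟨⟨fun v => S ⬝ᵥ v, by simp⟩, by simp [dotProduct_add]⟩ :
    (Fin d → ZMod q) →+ ZMod q) s E 0 0 0 j
  simp only [AddMonoidHom.coe_mk, ZeroHom.coe_mk] at this
  simp only [Pi.add_apply, castVec, this]
  congr 2
  · funext i; simp
  · simp
  · simp

/-- R moves to the other side of the pairing, where it permutes the uniform secret row. This is the
invariance required by `near_unimodular`. -/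
theorem unifComb_mulVec {N d : ℕ} (R : Matrix (Fin d) (Fin d) (ZMod q)) (hR : IsUnit R)
    (E : Fin N → Fin d → ZMod q) : unifComb (fun j => R.mulVec (E j)) = unifComb E := by
  have hb : Function.Bijective fun S : Fin d → ZMod q => Matrix.vecMul S R := by
    rw [← Finite.injective_iff_bijective]
    exact Matrix.vecMul_injective_of_isUnit hR
  unfold unifComb
  conv_rhs => rw [← unif_map_bijective hb]
  rw [PMF.map_comp]
  congr 1
  funext S j
  simp [Matrix.dotProduct_mulVec]

theorem bind_unif_cons {N d : ℕ} {Ω : Type}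
    (F : (Fin N → Fin (d + 1) → ZMod q) → PMF Ω) :
    ((unif (Fin N → ZMod q)).bind fun b => (unif (Fin N → Fin d → ZMod q)).bind fun B =>
      F fun t => Fin.cons (b t) (B t)) = (unif (Fin N → Fin (d + 1) → ZMod q)).bind F := by
  have h1 : unif (Fin N → Fin (d + 1) → ZMod q) =
      iid N ((unif (ZMod q)).bind fun x => (unif (Fin d → ZMod q)).map
        (Fin.cons (α := fun _ => ZMod q) x)) := by
    rw [← iid_unif, ← iid_unif (d + 1), iid_succ, iid_unif]
  rw [h1, iid_bind, iid_unif, PMF.bind_bind]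
  congr 1
  funext b
  have h2 : (indep fun i => (unif (Fin d → ZMod q)).map
      (Fin.cons (α := fun _ => ZMod q) (b i))) =
      (iid N (unif (Fin d → ZMod q))).map fun B t => Fin.cons (b t) (B t) :=
    indep_map _ fun i (x : Fin d → ZMod q) => (Fin.cons (b i) x : Fin (d + 1) → ZMod q)
  rw [h2, iid_unif, PMF.bind_map]
  rfl

theorem bind_unif_snoc {n d : ℕ} {Ω : Type} (F : (Fin (n + 1) → Fin d → ZMod q) → PMF Ω) :
    ((unif (Fin n → Fin d → ZMod q)).bind fun D => (unif (Fin d → ZMod q)).bind fun y =>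
      F (Fin.snoc (α := fun _ => Fin d → ZMod q) D y)) =
      (unif (Fin (n + 1) → Fin d → ZMod q)).bind F := by
  rw [← iid_unif (n + 1), iid_succ, PMF.bind_bind, iid_unif]
  have h := unif_map_equiv ((Fin.snocEquiv fun _ : Fin (n + 1) => Fin d → ZMod q).symm.trans
    (Fin.consEquiv fun _ : Fin (n + 1) => Fin d → ZMod q))
  have h3 : ∀ (G : (Fin (n + 1) → Fin d → ZMod q) → PMF Ω),
      ((unif (Fin d → ZMod q)).bind fun y => (unif (Fin n → Fin d → ZMod q)).bind fun D =>
        G (Fin.cons y D)) = (unif (Fin (n + 1) → Fin d → ZMod q)).bind G := fun G => by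
    rw [← iid_unif (n + 1), iid_succ, PMF.bind_bind, iid_unif]
    simp only [PMF.bind_map]
    rfl
  rw [PMF.bind_comm]
  simp only [PMF.bind_map, Function.comp_def]
  rw [h3, ← h, PMF.bind_map]
  have h4 := h3 fun E => F (Fin.snoc (α := fun _ => Fin d → ZMod q) (Fin.tail E) (E 0))
  simp only [Fin.tail_cons, Fin.cons_zero] at h4
  rw [h4]
  have h5 := unif_map_equiv ((Fin.consEquiv fun _ : Fin (n + 1) => Fin d → ZMod q).symm.trans
    (Fin.snocEquiv fun _ : Fin (n + 1) => Fin d → ZMod q))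
  have h6 : (unif (Fin (n + 1) → Fin d → ZMod q)).bind F =
      (unif (Fin (n + 1) → Fin d → ZMod q)).bind
        fun E => F (Fin.snoc (α := fun _ => Fin d → ZMod q) (Fin.tail E) (E 0)) := by
    conv_lhs => rw [← h5]
    rw [PMF.bind_map]
    rfl
  rw [← h6]
  conv_lhs => rw [← h]
  rw [PMF.bind_map]

/-- Sparse LWE is close to uniform if matrix-secret LWE is pseudorandom for the tests that come from
the reductions. -/
theorem near_sparse_lwe {σ : ℝ} (hσ : 0 < σ) {κ δ : ℝ≥0∞} (h : SmoothAbove κ (σ / 2))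
    {m N ℓ k : ℕ} (hkn : k ≤ N + 1) (hκ : (κ ^ (N + 2) * κ ^ (N + 1)) ^ m ≤ 1 + δ)
    {a : (Fin m → Sample q (N + 1)) → ℝ≥0∞} (ha : ∀ x, a x ≤ 1) {e₁ e₂ : ℝ≥0∞}
    (h₁ : ∀ s ∈ sparseVectors (N + 1) k, ∀ c : Fin m → Fin (N + 2) → ZMod q,
      Near (fun V => a fun i => reduceRow s (V i) (c i)) e₁ (lweMatrix q σ m N ℓ)
        (unif (Fin m → Fin N → ZMod q)))
    (h₂ : Near (fun V => a fun i => toSample (V i)) e₂ (lweMatrix q (2 * σ) m (N + 2) (ℓ + 1))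
      (unif (Fin m → Fin (N + 2) → ZMod q))) :
    Near a (δ + e₁ + δ + q.primeFactors.card / 2 ^ (ℓ + 1) +
        ENNReal.ofReal √((q ^ (ℓ + 1) : ℕ) / (N + 1).choose k) + e₂)
      (lwe q (N + 1) m (sparseSecret q hkn) (discreteGaussian (2 * σ * √(k + 1))))
      (unif (Fin m → Sample q (N + 1))) := by
  set noise : (Fin (N + 1) → ℤ) → PMF (Fin (N + 2) → ℤ) := fun s =>
    (discreteGaussian (√2 * σ)).bind (noisePath σ s) with hnoise
  set sph := iid (N + 2) (discreteGaussian (2 * σ)) with hsph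
  -- the sparse samples as a path map of a uniform vector
  have s1 : Near a δ (lwe q (N + 1) m (sparseSecret q hkn) (discreteGaussian (2 * σ * √(k + 1))))
      ((unifSparse hkn).bind fun s => iid m (pathRow s (unif (Fin (N + 1) → ZMod q)) (noise s))) := by
    rw [lwe_sparseSecret]
    refine (Dom.near (Dom.mono (Dom.bind_right_of_support _ fun s hs => ?_) hκ) ha).symm
    have hs' := mem_support_unifSparse hkn hs
    exact Dom.iid m ((Dom.pathRow s _ (dom_noisePath hσ h (mem_sparseVectors.1 hs').1)).trans
      (dom_pathRow_sparseRow hσ h hs'))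
  -- the first use of the assumption
  have s2 : Near a e₁
      ((unifSparse hkn).bind fun s => iid m (pathRow s (unif (Fin (N + 1) → ZMod q)) (noise s)))
      ((unifSparse hkn).bind fun s => (unif (Fin N → Fin (ℓ + 1) → ZMod q)).bind fun C =>
        iid m (pathRow s (unifComb (Fin.cons (Pi.single 0 1) C)) (noise s))) := by
    refine Near.bind_right_of_support _ fun s hs => ?_
    have hs' := mem_support_unifSparse hkn hs
    -- The columns C are split into their first coordinates b, chosen by the reduction, and B from
    -- the challenge. On the uniform side b is drawn as a dummy, so that both sides can be compared
    -- for fixed b.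
    rw [← bind_unif_cons, ← PMF.bind_const (unif (Fin N → ZMod q))
      (iid m (pathRow s (unif (Fin (N + 1) → ZMod q)) (noise s)))]
    refine Near.bind_right _ fun b => ?_
    rw [hnoise, ← bind_hardwired_unif σ s b]
    simp only [← bind_hardwired_lweRow, iid_bind_map, iid_unif]
    rw [PMF.bind_comm]
    refine Near.bind_right _ fun c => ?_
    simp only [← PMF.map_bind]
    rw [near_map_iff]
    exact (h₁ s hs' c).symm
  -- the noise becomes spherical
  have s3 : Near a δ
      ((unifSparse hkn).bind fun s => (unif (Fin N → Fin (ℓ + 1) → ZMod q)).bind fun C =>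
        iid m (pathRow s (unifComb (Fin.cons (Pi.single 0 1) C)) (noise s)))
      ((unifSparse hkn).bind fun s => (unif (Fin N → Fin (ℓ + 1) → ZMod q)).bind fun C =>
        iid m (pathRow s (unifComb (Fin.cons (Pi.single 0 1) C)) sph)) := by
    have hκ' : (κ ^ (N + 2)) ^ m ≤ 1 + δ :=
      le_trans (pow_le_pow_left' (le_mul_of_one_le_right' (one_le_pow₀ h.1)) m) hκ
    refine Dom.near (Dom.mono (Dom.bind_right_of_support _ fun s hs => ?_) hκ') ha
    have hs' := mem_support_unifSparse hkn hs
    exact Dom.bind_right _ fun C => Dom.iid m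
      (Dom.pathRow s _ (dom_noisePath hσ h (mem_sparseVectors.1 hs').1))
  -- the first column becomes uniform
  have s4 : Near a (q.primeFactors.card / 2 ^ (ℓ + 1))
      ((unifSparse hkn).bind fun s => (unif (Fin N → Fin (ℓ + 1) → ZMod q)).bind fun C =>
        iid m (pathRow s (unifComb (Fin.cons (Pi.single 0 1) C)) sph))
      ((unifSparse hkn).bind fun s => (unif (Fin (N + 1) → Fin (ℓ + 1) → ZMod q)).bind fun E =>
        iid m (pathRow s (unifComb E) sph)) :=
    Near.bind_right _ fun s => (near_unimodular (fun E => iid m (pathRow s (unifComb E) sph))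
      (fun R hR E => by rw [unifComb_mulVec R hR]) ha).symm
  -- the leftover hash lemma
  have s5 : Near a (ENNReal.ofReal √((q ^ (ℓ + 1) : ℕ) / (N + 1).choose k))
      ((unifSparse hkn).bind fun s => (unif (Fin (N + 1) → Fin (ℓ + 1) → ZMod q)).bind fun E =>
        iid m (pathRow s (unifComb E) sph))
      ((lweMatrix q (2 * σ) m (N + 2) (ℓ + 1)).map fun V i => toSample (V i)) := by
    have hl := near_leftover_hash (G := Fin (ℓ + 1) → ZMod q) hkn
      (fun D y => iid m ((lweRow (2 * σ)
        (Fin.snoc (α := fun _ => Fin (ℓ + 1) → ZMod q) D y)).map toSample)) ha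
    have hc : Fintype.card (Fin (ℓ + 1) → ZMod q) = q ^ (ℓ + 1) := by simp
    rw [hc] at hl
    convert hl using 1
    · rw [PMF.bind_comm (unif _)]
      refine PMF.ext fun x => ?_
      rw [PMF.bind_apply, PMF.bind_apply]
      refine tsum_congr fun s => ?_
      by_cases hs : s ∈ (unifSparse hkn).support
      · have hs' := (mem_sparseVectors.1 (mem_support_unifSparse hkn hs)).1
        congr 2
        -- For fixed s the first n columns of `pathMap s E` are a bijective image of E, hence
        -- uniform and independent of s; the last column is ∑ s_j D_j.
        conv_rhs => rw [← unif_map_bijective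
          (pathMap_init_bijective hs' (G := Fin (ℓ + 1) → ZMod q))]
        rw [PMF.bind_map]
        congr 1
        funext E
        rw [hsph, pathRow_unifComb, Function.comp_apply]
        congr 3
        funext j
        refine Fin.lastCases ?_ (fun j => ?_) j
        · rw [Fin.snoc_last, pathMap_last_zero hs']
        · rw [Fin.snoc_castSucc]
      · rw [PMF.mem_support_iff, not_not] at hs
        simp [hs]
    · have := bind_unif_snoc fun E : Fin (N + 2) → Fin (ℓ + 1) → ZMod q =>
        iid m ((lweRow (2 * σ) E).map toSample)
      refine Eq.trans ?_ this.symm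
      unfold lweMatrix
      rw [PMF.map_bind]
      congr 1
      funext E
      rw [iid_map]
  -- the second use of the assumption
  have s6 : Near a e₂ ((lweMatrix q (2 * σ) m (N + 2) (ℓ + 1)).map fun V i => toSample (V i))
      (unif (Fin m → Sample q (N + 1))) := by
    rw [← iid_unif, ← unif_map_bijective (toSample_bijective (q := q) (n := N + 1)), iid_map,
      iid_unif, near_map_iff]
    exact h₂
  exact ((((s1.trans s2).trans s3).trans s4).trans s5).trans s6

/-- The reduction from LWE to LWE in one more dimension with one more sample and wider noise. -/
theorem near_lweMatrix_double {σ : ℝ} (hσ : 0 < σ) {κ δ : ℝ≥0∞} (h : SmoothAbove κ (σ / 2))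
    {m n ℓ : ℕ} (hκ : (κ ^ n) ^ m ≤ 1 + δ)
    {a : (Fin m → Fin (n + 1) → ZMod q) → ℝ≥0∞} (ha : ∀ x, a x ≤ 1) {e : ℝ≥0∞}
    (h₁ : ∀ c : Fin m → Fin (n + 1) → ZMod q,
      Near (fun V => a fun i => Fin.cons 0 (V i) + c i) e (lweMatrix q σ m n ℓ)
        (unif (Fin m → Fin n → ZMod q))) :
    Near a (q.primeFactors.card / 2 ^ (ℓ + 1) + δ + e)
      (lweMatrix q (2 * σ) m (n + 1) (ℓ + 1)) (unif (Fin m → Fin (n + 1) → ZMod q)) := by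
  -- The extra sample has column e₀ and is w + x, with fresh error x of the full width 2σ. The
  -- others gain w b_t and noise of width √3 σ, which widens the challenge error since σ² + 3σ² =
  -- (2σ)².
  set consts : (Fin n → ZMod q) → PMF (Fin (n + 1) → ZMod q) := fun b =>
    (unif (ZMod q)).bind fun w => (discreteGaussian (2 * σ)).bind fun x =>
      (iid n (discreteGaussian (√3 * σ))).map fun u =>
        Fin.cons (w + x) fun t => w * b t + u t with hconsts
  have s1 := near_unimodular (q := q) (d := ℓ) (N := n)
    (fun E => iid m (lweRow (2 * σ) E)) (fun R hR E => by
      have e : ∀ E : Fin (n + 1) → Fin (ℓ + 1) → ZMod q, lweRow (2 * σ) E =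
          (unifComb E).bind fun v => (iid (n + 1) (discreteGaussian (2 * σ))).map
            fun z t => v t + (z t : ZMod q) := fun E => by
        rw [unifComb, PMF.bind_map]
        rfl
      rw [e, e, unifComb_mulVec R hR]) ha
  have hrow : ∀ (b : Fin n → ZMod q) (B : Fin n → Fin ℓ → ZMod q),
      Dom (κ ^ n) ((lweRow σ B).bind fun v => (consts b).map fun c =>
        (Fin.cons 0 v + c : Fin (n + 1) → ZMod q))
      (lweRow (2 * σ) (Fin.cons (Pi.single 0 1)
        fun t => (Fin.cons (b t) (B t) : Fin (ℓ + 1) → ZMod q))) := fun b B => by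
    have hd := dom_gaussian_add (a := σ) (b := √3 * σ) (c := 2 * σ) (s := √3 / 2 * σ)
        hσ (by positivity) (by positivity) (by positivity)
        (by rw [mul_pow, mul_pow, Real.sq_sqrt (by norm_num)]; ring) (by ring)
        (h.2 _ (by
          have : (1 : ℝ) ≤ √3 := Real.one_le_sqrt.2 (by norm_num)
          nlinarith))
    have hd' := hd.iid n
    rw [iid_bind] at hd'
    have e2 : ∀ z : Fin n → ℤ, (indep fun i => (discreteGaussian (√3 * σ)).map fun y => z i + y) =
        (iid n (discreteGaussian (√3 * σ))).map fun u i => z i + u i :=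
      fun z => indep_map _ fun i y => z i + y
    simp only [e2] at hd'
    have := Dom.bind_right (unif (ZMod q)) fun w => Dom.bind_right (unif (Fin ℓ → ZMod q)) fun S =>
      Dom.bind_right (discreteGaussian (2 * σ)) fun x => hd'.map fun z =>
        (Fin.cons (w + x) fun t => w * b t + S ⬝ᵥ B t + (z t : ZMod q) : Fin (n + 1) → ZMod q)
    convert this using 1
    · unfold lweRow
      simp only [hconsts, PMF.map_bind, PMF.bind_map, PMF.map_comp, PMF.bind_bind,
        Function.comp_def]
      rw [PMF.bind_comm (unif (ZMod q))]
      congr 1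
      funext S
      rw [PMF.bind_comm]
      congr 1
      funext w
      rw [PMF.bind_comm]
      congr 1
      funext x
      congr 1
      funext z
      congr 1
      funext u j
      refine Fin.cases ?_ (fun j => ?_) j
      · simp
      · simp
        ring
    · unfold lweRow
      rw [← iid_unif (ℓ + 1), iid_succ, iid_unif, iid_succ]
      simp only [PMF.map_bind, PMF.bind_map, PMF.map_comp, PMF.bind_bind,
        Function.comp_def]
      congr 1
      funext w
      congr 1
      funext S
      congr 1
      funext x
      congr 1
      funext z j
      refine Fin.cases ?_ (fun j => ?_) j
      · simp
      · simp [cons_dotProduct_cons]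
  have hunif : ∀ b : Fin n → ZMod q, ((unif (Fin n → ZMod q)).bind fun v => (consts b).map fun c =>
      (Fin.cons 0 v + c : Fin (n + 1) → ZMod q)) = unif (Fin (n + 1) → ZMod q) := fun b => by
    simp only [hconsts, PMF.map_bind, PMF.map_comp, Function.comp_def]
    have e1 : ∀ (w : ZMod q) (x : ℤ) (u : Fin n → ℤ),
        ((unif (Fin n → ZMod q)).map fun v => (Fin.cons 0 v + Fin.cons (w + x)
          fun t => w * b t + u t : Fin (n + 1) → ZMod q)) =
        (unif (Fin n → ZMod q)).map fun v => (Fin.cons (w + x) v : Fin (n + 1) → ZMod q) := by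
      intro w x u
      conv_rhs => rw [← unif_map_bijective (Equiv.addRight
        (fun t => w * b t + u t : Fin n → ZMod q)).bijective]
      rw [PMF.map_comp]
      congr 1
      funext v j
      refine Fin.cases ?_ (fun j => ?_) j <;> simp
    have e2 : ∀ x : ℤ, ((unif (ZMod q)).bind fun w => (unif (Fin n → ZMod q)).map
        fun v => (Fin.cons (w + x) v : Fin (n + 1) → ZMod q)) = unif (Fin (n + 1) → ZMod q) := by
      intro x
      rw [← iid_unif (n + 1), iid_succ, iid_unif]
      conv_rhs => rw [← unif_map_bijective (Equiv.addRight (x : ZMod q)).bijective]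
      rw [PMF.bind_map]
      rfl
    have e3 : ∀ (w : ZMod q) (x : ℤ), ((unif (Fin n → ZMod q)).bind fun v =>
        (iid n (discreteGaussian (√3 * σ))).map fun u => (Fin.cons 0 v + Fin.cons (w + x)
          fun t => w * b t + u t : Fin (n + 1) → ZMod q)) =
        (unif (Fin n → ZMod q)).map fun v => (Fin.cons (w + x) v : Fin (n + 1) → ZMod q) := by
      intro w x
      rw [← PMF.bind_const (iid n (discreteGaussian (√3 * σ))) ((unif (Fin n → ZMod q)).map
        fun v => (Fin.cons (w + x) v : Fin (n + 1) → ZMod q))]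
      refine Eq.trans ?_ (congrArg (PMF.bind _) (funext fun u => e1 w x u))
      simp only [← PMF.bind_pure_comp]
      rw [PMF.bind_comm]
      rfl
    rw [PMF.bind_comm]
    simp only [PMF.bind_comm (unif (Fin n → ZMod q)) (discreteGaussian (2 * σ)), e3]
    rw [PMF.bind_comm]
    simp only [e2, PMF.bind_const]
  have s2 : Near a δ
      ((unif (Fin n → Fin (ℓ + 1) → ZMod q)).bind fun C =>
        iid m (lweRow (2 * σ) (Fin.cons (Pi.single 0 1) C)))
      ((unif (Fin n → ZMod q)).bind fun b => (unif (Fin n → Fin ℓ → ZMod q)).bind fun B =>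
        iid m ((lweRow σ B).bind fun v => (consts b).map fun c =>
          (Fin.cons 0 v + c : Fin (n + 1) → ZMod q))) := by
    rw [← bind_unif_cons]
    exact (Dom.near (Dom.mono (Dom.bind_right _ fun b => Dom.bind_right _ fun B =>
      Dom.iid m (hrow b B)) hκ) ha).symm
  have s3 : Near a e
      ((unif (Fin n → ZMod q)).bind fun b => (unif (Fin n → Fin ℓ → ZMod q)).bind fun B =>
        iid m ((lweRow σ B).bind fun v => (consts b).map fun c =>
          (Fin.cons 0 v + c : Fin (n + 1) → ZMod q)))
      (unif (Fin m → Fin (n + 1) → ZMod q)) := by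
    rw [← PMF.bind_const (unif (Fin n → ZMod q)) (unif (Fin m → Fin (n + 1) → ZMod q))]
    refine Near.bind_right _ fun b => ?_
    rw [← iid_unif m, ← hunif b]
    have hm := fun V : PMF (Fin n → ZMod q) => iid_bind_map m V (consts b)
      fun v c => (Fin.cons 0 v + c : Fin (n + 1) → ZMod q)
    simp only [hm, iid_unif]
    rw [PMF.bind_comm]
    refine Near.bind_right _ fun c => ?_
    simp only [← PMF.map_bind]
    rw [near_map_iff]
    exact h₁ c
  exact (s1.trans s2).trans s3

end Chain

/-! ## Boolean circuits -/

section Circuits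

variable {ι X : Type} (inp : X → ι → Bool)

theorem runGates_append_singleton (x : ι → Bool) (gs : List (Gate ι)) (g : Gate ι) :
    runGates x (gs ++ [g]) = runGates x gs ++
      [g.op (g.fst.val x (runGates x gs)) (g.snd.val x (runGates x gs))] := by
  simp [runGates, List.foldl_append]

theorem length_runGates (x : ι → Bool) (gs : List (Gate ι)) :
    (runGates x gs).length = gs.length := by
  induction gs using List.reverseRecOn with
  | nil => rfl
  | append_singleton gs g ih => simp [runGates_append_singleton, ih]

theorem exists_runGates_append (x : ι → Bool) (gs ext : List (Gate ι)) :
    ∃ v, runGates x (gs ++ ext) = runGates x gs ++ v := by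
  induction ext using List.reverseRecOn with
  | nil => exact ⟨[], by simp⟩
  | append_singleton ext g ih =>
    obtain ⟨v, hv⟩ := ih
    rw [← List.append_assoc, runGates_append_singleton, hv, List.append_assoc]
    exact ⟨_, rfl⟩

/-- The Boolean function `F` of `x` is an input or the result of one of the steps `gs`, on the
input `inp x`. -/
def Avail (gs : List (Gate ι)) (F : X → Bool) : Prop :=
  ∃ o : Operand ι, (∀ t, o = .step t → t < gs.length) ∧
    ∀ x, o.val (inp x) (runGates (inp x) gs) = F x

variable {inp}

theorem avail_input (gs : List (Gate ι)) (i : ι) : Avail inp gs fun x => inp x i :=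
  ⟨.input i, by simp, fun _ => rfl⟩

/-- The operand must refer to an executed step: the default value of a dangling reference could
change when steps are appended. -/
theorem Avail.append {gs : List (Gate ι)} {F : X → Bool} (h : Avail inp gs F)
    (ext : List (Gate ι)) : Avail inp (gs ++ ext) F := by
  obtain ⟨o, ho, h⟩ := h
  refine ⟨o, fun t ht => (ho t ht).trans_le (by simp), fun x => ?_⟩
  rw [← h x]
  cases o with
  | input i => rfl
  | step t =>
    obtain ⟨v, hv⟩ := exists_runGates_append (inp x) gs ext
    have ht : t < (runGates (inp x) gs).length := by
      rw [length_runGates]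
      exact ho t rfl
    simp only [Operand.val, hv, List.getD_append _ _ _ _ ht]

theorem Avail.op {gs : List (Gate ι)} {F G : X → Bool} (hF : Avail inp gs F)
    (hG : Avail inp gs G) (op : Bool → Bool → Bool) :
    ∃ g, Avail inp (gs ++ [g]) fun x => op (F x) (G x) := by
  obtain ⟨o, _, ho⟩ := hF
  obtain ⟨o', _, ho'⟩ := hG
  refine ⟨⟨op, o, o'⟩, .step gs.length, fun t ht => ?_, fun x => ?_⟩
  · cases ht
    simp
  · rw [runGates_append_singleton, ho, ho', Operand.val,
      List.getD_append_right _ _ _ _ (length_runGates _ _).le, length_runGates]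
    simp

variable (inp)

/-- From the functions in `S`, the functions in `T` can be computed in at most `c` steps. -/
def Cost (S T : Set (X → Bool)) (c : ℕ) : Prop :=
  ∀ gs : List (Gate ι), (∀ F ∈ S, Avail inp gs F) →
    ∃ ext : List (Gate ι), ext.length ≤ c ∧ ∀ F ∈ T, Avail inp (gs ++ ext) F

variable {inp}

theorem Cost.of_subset {S T : Set (X → Bool)} (h : T ⊆ S) (c : ℕ) : Cost inp S T c :=
  fun gs hgs => ⟨[], by simp, fun F hF => by simpa using hgs F (h hF)⟩

theorem Cost.mono {S T S' T' : Set (X → Bool)} {c c' : ℕ} (h : Cost inp S T c) (hS : S ⊆ S')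
    (hT : T' ⊆ T) (hc : c ≤ c') : Cost inp S' T' c' := fun gs hgs => by
  obtain ⟨ext, h1, h2⟩ := h gs fun F hF => hgs F (hS hF)
  exact ⟨ext, h1.trans hc, fun F hF => h2 F (hT hF)⟩

theorem Cost.trans {S T U : Set (X → Bool)} {c d : ℕ} (h : Cost inp S T c)
    (h' : Cost inp (S ∪ T) U d) : Cost inp S (T ∪ U) (c + d) := fun gs hgs => by
  obtain ⟨e, h1, h2⟩ := h gs hgs
  obtain ⟨e', h1', h2'⟩ := h' (gs ++ e) fun F hF =>
    hF.elim (fun hF => (hgs F hF).append e) (h2 F)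
  refine ⟨e ++ e', by simp; omega, fun F hF => ?_⟩
  rw [← List.append_assoc]
  exact hF.elim (fun hF => (h2 F hF).append e') (h2' F)

theorem Cost.trans_right {S T U : Set (X → Bool)} {c d : ℕ} (h : Cost inp S T c)
    (h' : Cost inp (S ∪ T) U d) : Cost inp S U (c + d) :=
  (h.trans h').mono subset_rfl Set.subset_union_right le_rfl

theorem Cost.union {S T U : Set (X → Bool)} {c d : ℕ} (h : Cost inp S T c)
    (h' : Cost inp S U d) : Cost inp S (T ∪ U) (c + d) :=
  h.trans (h'.mono Set.subset_union_left subset_rfl le_rfl)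

theorem Cost.iUnion {κ : Type} [Fintype κ] {S : Set (X → Bool)} {T : κ → Set (X → Bool)} {c : ℕ}
    (h : ∀ i, Cost inp S (T i) c) : Cost inp S (⋃ i, T i) (Fintype.card κ * c) := by
  classical
  have : ∀ s : Finset κ, Cost inp S (⋃ i ∈ s, T i) (s.card * c) := fun s => by
    induction s using Finset.induction_on with
    | empty => exact Cost.of_subset (by simp) _
    | insert a s ha ih =>
      rw [Finset.set_biUnion_insert, Finset.card_insert_of_notMem ha]
      exact ((h a).union ih).mono subset_rfl subset_rfl (by ring_nf; rfl)
  simpa using this Finset.univ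

theorem Cost.of_op {S : Set (X → Bool)} {F G : X → Bool} (hF : F ∈ S) (hG : G ∈ S)
    (op : Bool → Bool → Bool) : Cost inp S {fun x => op (F x) (G x)} 1 := fun gs hgs => by
  obtain ⟨g, hg⟩ := (hgs F hF).op (hgs G hG) op
  exact ⟨[g], by simp, by simpa using hg⟩

theorem Cost.const (b : Bool) : Cost inp ∅ {fun _ => b} 1 := fun gs _ => by
  refine ⟨[⟨fun _ _ => b, .step 0, .step 0⟩], by simp, ?_⟩
  simp only [Set.mem_singleton_iff, forall_eq]
  refine ⟨.step gs.length, fun t ht => ?_, fun x => ?_⟩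
  · cases ht
    simp
  · simp [runGates_append_singleton, Operand.val, List.getD, length_runGates]

/-! ### Arithmetic circuits -/

/-- The lowest `M` bits of the number `a`. -/
def natBits (M : ℕ) (a : X → ℕ) : Set (X → Bool) := {F | ∃ i < M, F = fun x => (a x).testBit i}

theorem mem_natBits {M i : ℕ} (h : i < M) (a : X → ℕ) :
    (fun x => (a x).testBit i) ∈ natBits M a := ⟨i, h, rfl⟩

/-- The carry into position `i` when adding `a` and `b`. -/
def carryBit (a b i : ℕ) : Bool := decide (2 ^ i ≤ a % 2 ^ i + b % 2 ^ i)

theorem testBit_add_carryBit (a b i : ℕ) :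
    (a + b).testBit i = ((a.testBit i ^^ b.testBit i) ^^ carryBit a b i) := by
  have h := BitVec.getLsbD_add (w := i + 1) (i := i) (Nat.lt_succ_self i)
    (BitVec.ofNat (i + 1) a) (BitVec.ofNat (i + 1) b)
  have e : BitVec.carry i (BitVec.ofNat (i + 1) a) (BitVec.ofNat (i + 1) b) false =
      carryBit a b i := by
    simp [BitVec.carry, carryBit, Nat.mod_mod_of_dvd _ (pow_dvd_pow 2 (Nat.le_succ i))]
  rw [e, ← BitVec.ofNat_add] at h
  simp only [BitVec.getLsbD_ofNat, Nat.lt_succ_self, decide_true, Bool.true_and] at h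
  rw [h, Bool.xor_assoc]

theorem carryBit_succ (a b i : ℕ) :
    carryBit a b (i + 1) =
      ((a.testBit i && b.testBit i) || ((a.testBit i ^^ b.testBit i) && carryBit a b i)) := by
  have h := BitVec.carry_succ (w := i + 1) i
    (BitVec.ofNat (i + 1) a) (BitVec.ofNat (i + 1) b) false
  have e : BitVec.carry i (BitVec.ofNat (i + 1) a) (BitVec.ofNat (i + 1) b) false =
      carryBit a b i := by
    simp [BitVec.carry, carryBit, Nat.mod_mod_of_dvd _ (pow_dvd_pow 2 (Nat.le_succ i))]
  have e' : BitVec.carry (i + 1) (BitVec.ofNat (i + 1) a) (BitVec.ofNat (i + 1) b) false =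
      carryBit a b (i + 1) := by
    simp [BitVec.carry, carryBit]
  rw [e, e'] at h
  rw [h]
  simp only [BitVec.getLsbD_ofNat, Nat.lt_succ_self, decide_true, Bool.true_and]
  cases a.testBit i <;> cases b.testBit i <;> cases carryBit a b i <;> rfl

/-- The ripple-carry adder: five gates per position, where a ^^ b is shared by the sum bit and the
carry, and one gate for the initial carry 0. -/
theorem cost_add (M : ℕ) (a b : X → ℕ) :
    Cost inp (natBits M a ∪ natBits M b) (natBits M fun x => a x + b x) (5 * M + 1) := by
  have key : ∀ j ≤ M, Cost inp (natBits M a ∪ natBits M b)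
      ((natBits j fun x => a x + b x) ∪ {fun x => carryBit (a x) (b x) j}) (5 * j + 1) := by
    intro j
    induction j with
    | zero =>
      intro _
      refine (Cost.const false).mono (Set.empty_subset _) ?_ le_rfl
      rintro F (⟨i, hi, -⟩ | rfl)
      · omega
      · funext x
        simp [carryBit, Nat.mod_one]
    | succ j ih =>
      intro hj
      have hj' : j < M := hj
      have h0 := ih hj'.le
      set S := natBits M a ∪ natBits M b
      set T := (natBits j fun x => a x + b x) ∪ {fun x => carryBit (a x) (b x) j}
      have ha : (fun x => (a x).testBit j) ∈ S := Or.inl (mem_natBits hj' a)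
      have hb : (fun x => (b x).testBit j) ∈ S := Or.inr (mem_natBits hj' b)
      have hc : (fun x => carryBit (a x) (b x) j) ∈ T := Or.inr rfl
      have h1 := h0.trans (Cost.of_op (Or.inl ha) (Or.inl hb) xor)
      have h2 := h1.trans (Cost.of_op (Or.inr (Or.inr rfl)) (Or.inr (Or.inl hc)) xor)
      have h3 := h2.trans (Cost.of_op (Or.inr (Or.inl (Or.inr rfl)))
        (Or.inr (Or.inl (Or.inl hc))) and)
      have h4 := h3.trans (Cost.of_op (Or.inl ha) (Or.inl hb) and)
      have h5 := h4.trans (Cost.of_op (Or.inr (Or.inr rfl)) (Or.inr (Or.inl (Or.inr rfl))) or)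
      refine h5.mono subset_rfl ?_ (by omega)
      rintro F (⟨i, hi, rfl⟩ | rfl)
      · rcases Nat.lt_succ_iff_lt_or_eq.1 hi with hi | rfl
        · exact Or.inl (Or.inl (Or.inl (Or.inl (Or.inl (Or.inl ⟨i, hi, rfl⟩)))))
        · refine Or.inl (Or.inl (Or.inl (Or.inr ?_)))
          funext x
          exact testBit_add_carryBit _ _ _
      · refine Or.inr ?_
        funext x
        exact carryBit_succ _ _ _
  exact (key M le_rfl).mono subset_rfl Set.subset_union_left le_rfl

theorem cost_natConst (M c : ℕ) : Cost inp ∅ (natBits M fun _ : X => c) M := by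
  have := Cost.iUnion (inp := inp) fun i : Fin M => Cost.const (c.testBit i)
  refine this.mono subset_rfl ?_ (by simp)
  rintro F ⟨i, hi, rfl⟩
  exact Set.mem_iUnion.2 ⟨⟨i, hi⟩, rfl⟩

theorem cost_extend {L M : ℕ} {a : X → ℕ} (ha : ∀ x, a x < 2 ^ L) :
    Cost inp (natBits L a) (natBits M a) 1 := by
  refine ((Cost.of_subset subset_rfl 0).union
    ((Cost.const false).mono (Set.empty_subset _) subset_rfl le_rfl)).mono subset_rfl ?_ le_rfl
  rintro F ⟨i, hi, rfl⟩
  by_cases h : i < L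
  · exact Or.inl ⟨i, h, rfl⟩
  · refine Or.inr ?_
    funext x
    exact Nat.testBit_lt_two_pow ((ha x).trans_le (Nat.pow_le_pow_right two_pos (by omega)))

theorem cost_compl {M : ℕ} {a : X → ℕ} (ha : ∀ x, a x < 2 ^ M) :
    Cost inp (natBits M a) (natBits M fun x => 2 ^ M - (a x + 1)) M := by
  have := Cost.iUnion (inp := inp) fun i : Fin M =>
    Cost.of_op (mem_natBits i.2 a) (mem_natBits i.2 a) fun b _ => !b
  refine this.mono subset_rfl ?_ (by simp)
  rintro F ⟨i, hi, rfl⟩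
  refine Set.mem_iUnion.2 ⟨⟨i, hi⟩, ?_⟩
  funext x
  simp [Nat.testBit_two_pow_sub_succ (ha x), hi]

theorem cost_mux {L : ℕ} {a b c : X → ℕ} {F : X → Bool}
    (h : ∀ x, ∀ i < L, (c x).testBit i = if F x then (a x).testBit i else (b x).testBit i) :
    Cost inp (natBits L a ∪ natBits L b ∪ {F}) (natBits L c) (L * 3) := by
  set S := natBits L a ∪ natBits L b ∪ {F}
  have key : ∀ i : Fin L, Cost inp S {fun x => (c x).testBit i} 3 := fun i => by
    have ha : (fun x => (a x).testBit i) ∈ S := Or.inl (Or.inl (mem_natBits i.2 a))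
    have hb : (fun x => (b x).testBit i) ∈ S := Or.inl (Or.inr (mem_natBits i.2 b))
    have hF : F ∈ S := Or.inr rfl
    have h1 := Cost.of_op (inp := inp) hF ha and
    have h2 := h1.trans (Cost.of_op (Or.inl hF) (Or.inl hb) fun u v => !u && v)
    have h3 := h2.trans_right (Cost.of_op (Or.inr (Or.inl rfl)) (Or.inr (Or.inr rfl)) or)
    convert h3 using 2
    funext x
    rw [h x i i.2]
    cases F x <;> simp
  have := Cost.iUnion key
  refine this.mono subset_rfl ?_ (by simp)
  rintro F ⟨i, hi, rfl⟩
  exact Set.mem_iUnion.2 ⟨⟨i, hi⟩, rfl⟩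

/-- Addition modulo `q` of numbers with a sum below `2 q`. -/
theorem cost_add_mod {q L : ℕ} (hqL : q ≤ 2 ^ L) {a b : X → ℕ}
    (hab : ∀ x, a x + b x < 2 * q) :
    Cost inp (natBits (L + 2) a ∪ natBits (L + 2) b) (natBits L fun x => (a x + b x) % q)
      (14 * (L + 2) + 2) := by
  have hM : 2 ^ (L + 2) = 4 * 2 ^ L := by ring
  have h1 := cost_add (inp := inp) (L + 2) a b
  have h2 := h1.trans ((cost_natConst (L + 2) (2 ^ (L + 2) - q)).mono (Set.empty_subset _)
    subset_rfl le_rfl)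
  have h3 := h2.trans ((cost_add (L + 2) (fun x => a x + b x) fun _ => 2 ^ (L + 2) - q).mono
    (Set.union_subset_iff.2 ⟨fun F hF => Or.inr (Or.inl hF), fun F hF => Or.inr (Or.inr hF)⟩)
    subset_rfl le_rfl)
  -- Subtract q modulo 2^(L+2): bit L + 1 of the result is set exactly when a + b < q, and it
  -- selects between a + b and a + b - q.
  have hbit : ∀ x, ∀ i < L, ((a x + b x) % q).testBit i =
      if (a x + b x + (2 ^ (L + 2) - q)).testBit (L + 1) then (a x + b x).testBit i
      else (a x + b x + (2 ^ (L + 2) - q)).testBit i := fun x i hi => by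
    have hx := hab x
    by_cases h : q ≤ a x + b x
    · have e : a x + b x + (2 ^ (L + 2) - q) = 2 ^ (L + 2) + (a x + b x - q) := by omega
      have e2 : (a x + b x - q).testBit (L + 1) = false :=
        Nat.testBit_lt_two_pow (by rw [pow_succ]; omega)
      rw [e, Nat.testBit_two_pow_add_gt (by omega), e2, Nat.testBit_two_pow_add_gt (by omega),
        Nat.mod_eq_sub_mod h, Nat.mod_eq_of_lt (by omega)]
      simp
    · have e2 : (a x + b x + (2 ^ (L + 2) - q)).testBit (L + 1) = true := by
        have e : a x + b x + (2 ^ (L + 2) - q) =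
            2 ^ (L + 1) + (2 ^ (L + 1) - q + (a x + b x)) := by
          rw [pow_succ 2 (L + 1), pow_succ] at *
          omega
        rw [e, Nat.testBit_two_pow_add_eq, Nat.testBit_lt_two_pow]
        · rfl
        · rw [pow_succ]
          omega
      rw [e2, if_pos rfl, Nat.mod_eq_of_lt (by omega)]
  have hs : (fun x => (a x + b x + (2 ^ (L + 2) - q)).testBit (L + 1)) ∈
      natBits (L + 2) fun x => a x + b x + (2 ^ (L + 2) - q) := mem_natBits (by omega) _
  have hsub : ∀ c : X → ℕ, natBits L c ⊆ natBits (L + 2) c := by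
    rintro c F ⟨i, hi, rfl⟩
    exact ⟨i, by omega, rfl⟩
  refine (h3.trans_right ((cost_mux hbit).mono ?_ subset_rfl le_rfl)).mono subset_rfl subset_rfl
    (by omega)
  rintro F ((hF | hF) | rfl)
  · exact Or.inr (Or.inl (Or.inl (hsub _ hF)))
  · exact Or.inr (Or.inr (hsub _ hF))
  · exact Or.inr (Or.inr hs)

/-! ### Arithmetic modulo q. -/

variable {q : ℕ}

/-- The bits of an element of `ℤ_q`. -/
def zBits (a : X → ZMod q) : Set (X → Bool) := natBits (Nat.clog 2 q) fun x => (a x).val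

/-- A bound for the number of steps of an operation modulo `q`. -/
def opCost (q : ℕ) : ℕ := 24 * (Nat.clog 2 q + 2)

theorem le_two_pow_clog (q : ℕ) : q ≤ 2 ^ Nat.clog 2 q := Nat.le_pow_clog one_lt_two q

theorem cost_zConst (c : ZMod q) : Cost inp ∅ (zBits fun _ : X => c) (opCost q) :=
  (cost_natConst _ _).mono subset_rfl subset_rfl (by unfold opCost; omega)

theorem cost_zSum {κ : Type} {S : Set (X → Bool)} {a : X → ZMod q} {f : κ → X → ZMod q} {c₀ c₁ : ℕ}
    (h₀ : Cost inp S (zBits a) c₀)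
    (h₁ : ∀ i (b : X → ZMod q), Cost inp (S ∪ zBits b) (zBits fun x => b x + f i x) c₁)
    (s : Finset κ) :
    Cost inp S (zBits fun x => a x + ∑ i ∈ s, f i x) (c₀ + s.card * c₁) := by
  classical
  induction s using Finset.induction_on with
  | empty => simpa using h₀
  | insert i s hi ih =>
    have := ih.trans_right (h₁ i _)
    rw [Finset.card_insert_of_notMem hi]
    refine this.mono subset_rfl ?_ (by ring_nf; rfl)
    have e : ∀ x, a x + ∑ i ∈ insert i s, f i x = a x + ∑ i ∈ s, f i x + f i x := fun x => by
      rw [Finset.sum_insert hi]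
      ring
    simp only [e]
    exact subset_rfl

variable [NeZero q]

theorem val_lt_two_pow_clog (a : ZMod q) : a.val < 2 ^ Nat.clog 2 q :=
  (ZMod.val_lt a).trans_le (le_two_pow_clog q)

theorem cost_zAdd (a b : X → ZMod q) :
    Cost inp (zBits a ∪ zBits b) (zBits fun x => a x + b x) (opCost q) := by
  set L := Nat.clog 2 q with hL
  have h1 : Cost inp (zBits a ∪ zBits b) (natBits (L + 2) fun x => (a x).val) 1 :=
    (cost_extend fun x => val_lt_two_pow_clog (a x)).mono Set.subset_union_left subset_rfl le_rfl
  have h2 : Cost inp (zBits a ∪ zBits b) (natBits (L + 2) fun x => (b x).val) 1 :=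
    (cost_extend fun x => val_lt_two_pow_clog (b x)).mono Set.subset_union_right subset_rfl le_rfl
  have h3 := (h1.union h2).trans_right ((cost_add_mod (le_two_pow_clog q)
    fun x => (by have := ZMod.val_lt (a x); have := ZMod.val_lt (b x); omega)).mono
      Set.subset_union_right subset_rfl le_rfl)
  refine h3.mono subset_rfl ?_ (by unfold opCost; omega)
  simp only [zBits, ZMod.val_add]
  exact subset_rfl

theorem cost_zSub (a b : X → ZMod q) :
    Cost inp (zBits a ∪ zBits b) (zBits fun x => b x - a x) (opCost q) := by
  set L := Nat.clog 2 q with hL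
  have hq : q ≤ 2 ^ L := le_two_pow_clog q
  have hM : 2 ^ (L + 2) = 4 * 2 ^ L := by ring
  have ha : ∀ x, (a x).val < 2 ^ (L + 2) := fun x => by
    have : (a x).val < 2 ^ L := val_lt_two_pow_clog (a x)
    omega
  have h1 : Cost inp (zBits a ∪ zBits b) (natBits (L + 2) fun x => (a x).val) 1 :=
    (cost_extend fun x => val_lt_two_pow_clog (a x)).mono Set.subset_union_left subset_rfl le_rfl
  have h2 := h1.trans_right ((cost_compl ha).mono Set.subset_union_right subset_rfl le_rfl)
  have h3 := h2.union ((cost_natConst (L + 2) (q + 1)).mono (Set.empty_subset _) subset_rfl le_rfl)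
  have h4 := h3.trans_right ((cost_add _ _ _).mono Set.subset_union_right subset_rfl le_rfl)
  have h5 : Cost inp (zBits a ∪ zBits b) (natBits (L + 2) fun x => q - (a x).val) _ :=
    h4.mono subset_rfl (by
      rintro F ⟨i, hi, rfl⟩
      refine ⟨i, hi, ?_⟩
      funext x
      have := ZMod.val_lt (a x)
      have := ha x
      -- Two's complement: the bitwise complement of a plus q + 1 agrees with q - a in the lowest L
      -- + 2 bits.
      have e : 2 ^ (L + 2) - ((a x).val + 1) + (q + 1) = 2 ^ (L + 2) + (q - (a x).val) := by omega
      beta_reduce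
      rw [e, Nat.testBit_two_pow_add_gt hi]) le_rfl
  have h6 : Cost inp (zBits a ∪ zBits b) (natBits (L + 2) fun x => (b x).val) 1 :=
    (cost_extend fun x => val_lt_two_pow_clog (b x)).mono Set.subset_union_right subset_rfl le_rfl
  have h7 := (h6.union h5).trans_right ((cost_add_mod hq
    fun x => (by have := ZMod.val_lt (a x); have := ZMod.val_lt (b x); omega)).mono
      Set.subset_union_right subset_rfl le_rfl)
  -- The count is 21(L+2) + 5, which is at most 24(L+2); subtraction is thus the operation behind
  -- the constant in `opCost`.
  refine h7.mono subset_rfl ?_ (by unfold opCost; omega)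
  have e : ∀ x, (b x - a x).val = ((b x).val + (q - (a x).val)) % q := fun x => by
    rw [← ZMod.val_natCast]
    congr 1
    rw [Nat.cast_add, Nat.cast_sub (ZMod.val_lt (a x)).le]
    simp
    ring
  simp only [zBits, e]
  exact subset_rfl

theorem cost_zTernary (a b : X → ZMod q) {c : ℤ} (hc : c = -1 ∨ c = 0 ∨ c = 1) :
    Cost inp (zBits a ∪ zBits b) (zBits fun x => b x + c • a x) (opCost q) := by
  rcases hc with rfl | rfl | rfl
  · simpa [← sub_eq_add_neg] using cost_zSub (inp := inp) a b
  · simpa using Cost.of_subset Set.subset_union_right _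
  · have := cost_zAdd (inp := inp) b a
    rw [Set.union_comm] at this
    simpa using this

/-- The element a is added `c.val` < q times. This crude multiplication makes the second running
time polynomial in q rather than in log q. -/
theorem cost_zMul (a b : X → ZMod q) (c : ZMod q) :
    Cost inp (zBits a ∪ zBits b) (zBits fun x => b x + c * a x) (q * opCost q) := by
  have := cost_zSum (inp := inp) (S := zBits a ∪ zBits b) (a := b) (c₀ := 0)
    (f := fun (_ : Fin c.val) => a)
    (Cost.of_subset Set.subset_union_right 0) (c₁ := opCost q) (fun i b' =>
      (cost_zAdd b' a).mono (by
        rintro F (hF | hF)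
        · exact Or.inr hF
        · exact Or.inl (Or.inl hF)) subset_rfl le_rfl) Finset.univ
  refine this.mono subset_rfl ?_ ?_
  · simp
  · simp only [Finset.card_univ, Fintype.card_fin, zero_add]
    gcongr
    exact (ZMod.val_lt c).le

end Circuits

/-! ### Composition of a distinguisher with a reduction -/

section Composition

variable {Ω Ω' : Type} [BitEncoding Ω] [BitEncoding Ω']

/-- The probability that the algorithm accepts. -/
noncomputable def Algorithm.accept (A : Algorithm (BitEncoding.Idx Ω)) (ω : Ω) : ℝ≥0∞ :=
  ((unif (Fin A.coins → Bool)).map fun r => A.eval (BitEncoding.enc ω) r) true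

theorem Algorithm.accept_le_one (A : Algorithm (BitEncoding.Idx Ω)) (ω : Ω) : A.accept ω ≤ 1 :=
  PMF.coe_le_one _ _

theorem Algorithm.output_true (A : Algorithm (BitEncoding.Idx Ω)) (D : PMF Ω) :
    A.output D true = expect D A.accept := rfl

/-- The input of a circuit that reads a sample and coin tosses. -/
def circuitInput (Ω : Type) [BitEncoding Ω] (C : ℕ) (x : Ω × (Fin C → Bool)) :
    BitEncoding.Idx Ω ⊕ Fin C → Bool :=
  Sum.elim (BitEncoding.enc x.1) x.2

/-- The bits that such a circuit reads. -/
def circuitBits (Ω : Type) [BitEncoding Ω] (C : ℕ) : Set (Ω × (Fin C → Bool) → Bool) :=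
  {F | ∃ i, F = fun x => circuitInput Ω C x i}

/-- The map `φ` can be computed in at most `c` steps. -/
def Computable (φ : Ω → Ω') (c : ℕ) : Prop :=
  ∀ C : ℕ, Cost (circuitInput Ω C) (circuitBits Ω C)
    {F | ∃ j, F = fun x => BitEncoding.enc (φ x.1) j} c

/-- The circuit of φ is put in front, with the same coins. Input references become the operands that
compute the bits of φ, and step references are shifted. -/
theorem exists_algorithm_comp {φ : Ω → Ω'} {c : ℕ} (hφ : Computable φ c)
    (A : Algorithm (BitEncoding.Idx Ω')) :
    ∃ A' : Algorithm (BitEncoding.Idx Ω), A'.time ≤ A.time + c ∧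
      ∀ ω, A'.accept ω = A.accept (φ ω) := by
  obtain ⟨pre, hlen, hpre⟩ := hφ A.coins [] (by
    rintro F ⟨i, rfl⟩
    exact avail_input _ _)
  simp only [List.nil_append] at hpre
  have hpre' : ∀ j, ∃ o : Operand (BitEncoding.Idx Ω ⊕ Fin A.coins),
      (∀ t, o = .step t → t < pre.length) ∧
      ∀ x, o.val (circuitInput Ω A.coins x) (runGates (circuitInput Ω A.coins x) pre) =
        BitEncoding.enc (φ x.1) j := fun j => hpre _ ⟨j, rfl⟩
  choose o ho ho' using hpre'
  let tr : Operand (BitEncoding.Idx Ω' ⊕ Fin A.coins) → Operand (BitEncoding.Idx Ω ⊕ Fin A.coins)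
    | .input (.inl j) => o j
    | .input (.inr r) => .input (.inr r)
    | .step t => .step (t + pre.length)
  let trG : Gate (BitEncoding.Idx Ω' ⊕ Fin A.coins) → Gate (BitEncoding.Idx Ω ⊕ Fin A.coins) :=
    fun g => ⟨g.op, tr g.fst, tr g.snd⟩
  have htr : ∀ (ω : Ω) (r : Fin A.coins → Bool) (v : List Bool) (p),
      (tr p).val (Sum.elim (BitEncoding.enc ω) r)
        (runGates (Sum.elim (BitEncoding.enc ω) r) pre ++ v) =
      p.val (Sum.elim (BitEncoding.enc (φ ω)) r) v := fun ω r v p => by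
    match p with
    | .input (.inl j) =>
      have h := ho' j (ω, r)
      simp only [circuitInput] at h
      simp only [tr, Operand.val, Sum.elim_inl]
      rw [← h]
      generalize hoj : o j = oj
      cases oj with
      | input i => rfl
      | step t =>
        have ht := ho j t hoj
        rw [← length_runGates (Sum.elim (BitEncoding.enc ω) r)] at ht
        simp only [Operand.val, List.getD_append _ _ _ _ ht]
    | .input (.inr r) => rfl
    | .step t =>
      simp only [tr, Operand.val]
      rw [List.getD_append_right _ _ _ _ (by rw [length_runGates]; omega), length_runGates,
        Nat.add_sub_cancel]
  have hrun : ∀ (ω : Ω) (r : Fin A.coins → Bool) (gs : List (Gate _)),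
      runGates (Sum.elim (BitEncoding.enc ω) r) (pre ++ gs.map trG) =
        runGates (Sum.elim (BitEncoding.enc ω) r) pre ++
          runGates (Sum.elim (BitEncoding.enc (φ ω)) r) gs := fun ω r gs => by
    induction gs using List.reverseRecOn with
    | nil => simp [runGates]
    | append_singleton gs g ih =>
      rw [List.map_append, List.map_singleton, ← List.append_assoc, runGates_append_singleton, ih,
        runGates_append_singleton, List.append_assoc]
      simp only [trG, htr]
  refine ⟨⟨A.coins, pre ++ A.gates.map trG, tr A.out⟩, ?_, fun ω => ?_⟩
  · simp only [Algorithm.time, List.length_append, List.length_map]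
    omega
  · unfold Algorithm.accept
    congr 2
    funext r
    simp only [Algorithm.eval, hrun, htr]

end Composition

/-! ## From indistinguishability to closeness for the tests of the reductions -/

section Bridge

variable {Ω Ω' : Type} [BitEncoding Ω] [BitEncoding Ω']

theorem expect_accept_ne_top (A : Algorithm (BitEncoding.Idx Ω)) (D : PMF Ω) :
    expect D A.accept ≠ ∞ :=
  ne_top_of_le_ne_top ENNReal.one_ne_top (expect_le_one D A.accept_le_one)

theorem near_accept_of_advantage_le {A : Algorithm (BitEncoding.Idx Ω)} {D₁ D₂ : PMF Ω} {ε : ℝ}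
    (h : A.advantage D₁ D₂ ≤ ε) : Near A.accept (ENNReal.ofReal ε) D₁ D₂ := by
  have hε : 0 ≤ ε := (abs_nonneg _).trans h
  unfold Algorithm.advantage at h
  rw [A.output_true, A.output_true] at h
  have key : ∀ x y : ℝ≥0∞, x ≠ ∞ → y ≠ ∞ → x.toReal - y.toReal ≤ ε →
      x ≤ y + ENNReal.ofReal ε := fun x y hx hy hxy => by
    rw [← ENNReal.ofReal_toReal hx, ← ENNReal.ofReal_toReal hy,
      ← ENNReal.ofReal_add ENNReal.toReal_nonneg hε]
    exact ENNReal.ofReal_le_ofReal (by linarith)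
  exact ⟨key _ _ (expect_accept_ne_top A _) (expect_accept_ne_top A _) (abs_le.1 h).2,
    key _ _ (expect_accept_ne_top A _) (expect_accept_ne_top A _)
      (by linarith [(abs_le.1 h).1])⟩

theorem advantage_le_of_near {A : Algorithm (BitEncoding.Idx Ω)} {D₁ D₂ : PMF Ω} {ε : ℝ}
    (hε : 0 ≤ ε) (h : Near A.accept (ENNReal.ofReal ε) D₁ D₂) : A.advantage D₁ D₂ ≤ ε := by
  unfold Algorithm.advantage
  rw [A.output_true, A.output_true]
  have key : ∀ x y : ℝ≥0∞, x ≠ ∞ → y ≠ ∞ → x ≤ y + ENNReal.ofReal ε →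
      x.toReal - y.toReal ≤ ε := fun x y hx hy hxy => by
    have := ENNReal.toReal_mono (by simp [hy]) hxy
    rw [ENNReal.toReal_add hy ENNReal.ofReal_ne_top, ENNReal.toReal_ofReal hε] at this
    linarith
  rw [abs_le]
  constructor
  · linarith [key _ _ (expect_accept_ne_top A D₂) (expect_accept_ne_top A D₁) h.2]
  · exact key _ _ (expect_accept_ne_top A D₁) (expect_accept_ne_top A D₂) h.1

theorem advantage_le_one (A : Algorithm (BitEncoding.Idx Ω)) (D₁ D₂ : PMF Ω) :
    A.advantage D₁ D₂ ≤ 1 :=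
  advantage_le_of_near zero_le_one (by simpa using near_one A.accept_le_one D₁ D₂)

/-- Positivity of ε is a by-product: the composed circuit has an advantage that is nonnegative and
below ε. -/
theorem near_accept_comp {φ : Ω → Ω'} {c : ℕ} (hφ : Computable φ c)
    (A : Algorithm (BitEncoding.Idx Ω')) {D₁ D₂ : PMF Ω} {T ε : ℝ}
    (hT : ((A.time + c : ℕ) : ℝ) ≤ T) (h : ¬ Distinguishable D₁ D₂ T ε) :
    0 < ε ∧ Near (fun ω => A.accept (φ ω)) (ENNReal.ofReal ε) D₁ D₂ := by
  obtain ⟨A', ht, hA'⟩ := exists_algorithm_comp hφ A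
  have hlt : A'.advantage D₁ D₂ < ε := by
    by_contra hc
    exact h ⟨A', le_trans (by exact_mod_cast ht) hT, not_lt.1 hc⟩
  refine ⟨(abs_nonneg _).trans_lt hlt, ?_⟩
  have := near_accept_of_advantage_le hlt.le
  rwa [funext hA'] at this

end Bridge

/-! ## The circuits of the reductions -/

section Reductions

variable {q : ℕ}

theorem computable_toSample {Ω : Type} [BitEncoding Ω] {m n c : ℕ}
    (f : Ω → Fin m → Fin (n + 1) → ZMod q)
    (h : ∀ C i j, Cost (circuitInput Ω C) (circuitBits Ω C)
      (zBits fun x => f x.1 i j) c) :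
    Computable (fun ω i => toSample (f ω i)) (m * ((n + 1) * c)) := fun C => by
  have := Cost.iUnion fun i => Cost.iUnion (h C i)
  refine this.mono subset_rfl ?_ (by simp)
  rintro F ⟨⟨i, (⟨j, b⟩ | b)⟩, rfl⟩
  · exact Set.mem_iUnion.2 ⟨i, Set.mem_iUnion.2 ⟨j.castSucc,
      ⟨Fin.val (n := Nat.clog 2 q) b, Fin.isLt (n := Nat.clog 2 q) b, rfl⟩⟩⟩
  · exact Set.mem_iUnion.2 ⟨i, Set.mem_iUnion.2 ⟨Fin.last n,
      ⟨Fin.val (n := Nat.clog 2 q) b, Fin.isLt (n := Nat.clog 2 q) b, rfl⟩⟩⟩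

theorem cost_matrixSample {N ℓ m : ℕ} (C : ℕ) (t : Fin N) (i : Fin m) (c : ℕ) :
    Cost (circuitInput (Fin N → MatrixSample q ℓ m) C)
      (circuitBits (Fin N → MatrixSample q ℓ m) C)
      (zBits fun x => (x.1 t).2 i) c := by
  refine Cost.of_subset ?_ c
  rintro F ⟨b, hb, rfl⟩
  exact ⟨Sum.inl (t, Sum.inr (i, ⟨b, hb⟩)), rfl⟩

theorem cost_sample_snd {N ℓ : ℕ} (C : ℕ) (t : Fin N) (c : ℕ) :
    Cost (circuitInput (Fin N → Sample q ℓ) C)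
      (circuitBits (Fin N → Sample q ℓ) C)
      (zBits fun x => (x.1 t).2) c := by
  refine Cost.of_subset ?_ c
  rintro F ⟨b, hb, rfl⟩
  exact ⟨Sum.inl (t, Sum.inr ⟨b, hb⟩), rfl⟩

theorem cost_sample_fst {N ℓ : ℕ} (C : ℕ) (t : Fin N) (d : Fin ℓ) (c : ℕ) :
    Cost (circuitInput (Fin N → Sample q ℓ) C)
      (circuitBits (Fin N → Sample q ℓ) C)
      (zBits fun x => (x.1 t).1 d) c := by
  refine Cost.of_subset ?_ c
  rintro F ⟨b, hb, rfl⟩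
  exact ⟨Sum.inl (t, Sum.inl (d, ⟨b, hb⟩)), rfl⟩

variable [NeZero q]

/-- By `pathMap_eq_sum` every coordinate is a sum of ± entries of the challenge and a constant, so
no multiplication is needed. -/
theorem cost_pathMap {X ι : Type} {inp : X → ι → Bool} {S : Set (X → Bool)} {N c₀ : ℕ}
    {s : Fin (N + 1) → ℤ} (hs : IsTernary s) (V : X → Fin N → ZMod q)
    (hV : ∀ t, Cost inp S (zBits fun x => V x t) c₀) (c : Fin (N + 2) → ZMod q) (j) :
    Cost inp S (zBits fun x =>
      (pathMap s (Fin.cons 0 (V x)) 0 0 0 + c : Fin (N + 2) → ZMod q) j)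
      (opCost q + N * (c₀ + opCost q)) := by
  obtain ⟨cf, d, hcf, -, h⟩ := pathMap_eq_sum (M := ZMod q) hs j
  have e : ∀ x, (pathMap s (Fin.cons 0 (V x)) 0 0 0 + c : Fin (N + 2) → ZMod q) j =
      c j + ∑ t : Fin N, cf t.succ • V x t := fun x => by
    rw [Pi.add_apply, h, Fin.sum_univ_succ]
    simp [add_comm]
  simp only [e]
  have := cost_zSum (S := S) (f := fun t x => cf t.succ • V x t)
    ((cost_zConst (c j)).mono (Set.empty_subset S) subset_rfl le_rfl)
    (c₁ := c₀ + opCost q) (fun t b => by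
      have h1 := (hV t).mono (Set.subset_union_left (t := zBits b)) subset_rfl le_rfl
      refine h1.trans_right ((cost_zTernary (fun x => V x t) b (hcf t.succ)).mono ?_
        subset_rfl le_rfl)
      rintro F (hF | hF)
      · exact Or.inr hF
      · exact Or.inl (Or.inr hF)) Finset.univ
  simpa using this

theorem computable_reduceRow {Ω : Type} [BitEncoding Ω] {m N c₀ : ℕ} {s : Fin (N + 1) → ℤ}
    (hs : IsTernary s) {V : Ω → Fin m → Fin N → ZMod q}
    (hV : ∀ C i t, Cost (circuitInput Ω C) (circuitBits Ω C)
      (zBits fun x => V x.1 i t) c₀) (c : Fin m → Fin (N + 2) → ZMod q) :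
    Computable (fun ω i => reduceRow s (V ω i) (c i))
      (m * ((N + 2) * (opCost q + N * (c₀ + opCost q)))) :=
  computable_toSample
    (fun ω i => (pathMap s (Fin.cons 0 (V ω i)) 0 0 0 + c i : Fin (N + 2) → ZMod q))
    fun C i j => by
      have := cost_pathMap (inp := circuitInput Ω C) (S := circuitBits Ω C) hs (fun x => V x.1 i)
        (fun t => hV C i t) (c i) j
      exact this

theorem cost_dotProduct_add {X ι : Type} {inp : X → ι → Bool} {S : Set (X → Bool)} {ℓ : ℕ}
    (f : X → Fin ℓ → ZMod q) (hf : ∀ d, Cost inp S (zBits fun x => f x d) 0)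
    (W : Fin ℓ → ZMod q) (c : ZMod q) :
    Cost inp S (zBits fun x => W ⬝ᵥ f x + c) (opCost q + ℓ * (q * opCost q)) := by
  have := cost_zSum (S := S) (f := fun d x => W d * f x d)
    ((cost_zConst c).mono (Set.empty_subset S) subset_rfl le_rfl)
    (c₁ := 0 + q * opCost q) (fun d b => by
      have h1 := (hf d).mono (Set.subset_union_left (t := zBits b)) subset_rfl le_rfl
      refine h1.trans_right ((cost_zMul (fun x => f x d) b (W d)).mono ?_
        subset_rfl le_rfl)
      rintro F (hF | hF)
      · exact Or.inr hF
      · exact Or.inl (Or.inr hF)) Finset.univ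
  simp only [zero_add, Finset.card_univ, Fintype.card_fin] at this
  have e : ∀ x, W ⬝ᵥ f x + c = c + ∑ d, W d * f x d := fun x => add_comm _ _
  simp only [e]
  exact this

theorem cost_add_const {X ι : Type} {inp : X → ι → Bool} {S : Set (X → Bool)} {c₀ : ℕ}
    {V : X → ZMod q} (hV : Cost inp S (zBits V) c₀) (a : ZMod q) :
    Cost inp S (zBits fun x => V x + a) (c₀ + 2 * opCost q) := by
  have h1 : Cost inp S (zBits fun _ => a) (opCost q) :=
    (cost_zConst a).mono (Set.empty_subset S) subset_rfl le_rfl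
  have h2 : Cost inp (S ∪ (zBits V ∪ zBits fun _ => a)) (zBits fun x => V x + a) (opCost q) :=
    (cost_zAdd V fun _ => a).mono Set.subset_union_right subset_rfl le_rfl
  exact ((hV.union h1).trans_right h2).mono subset_rfl subset_rfl (by omega)

/-- The matrix of a hybrid, with row `i` from the challenge. -/
def hybridMatrix {m N ℓ : ℕ} (i : Fin m) (S : Fin m → Fin ℓ → ZMod q)
    (c : Fin m → Fin N → ZMod q) (y : Fin N → Sample q ℓ) : Fin m → Fin N → ZMod q :=
  fun j t => if j = i then (y t).2 else S j ⬝ᵥ (y t).1 + c j t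

theorem cost_hybridMatrix {m N N' ℓ : ℕ} (ι : Fin N → Fin N') (i : Fin m)
    (S : Fin m → Fin ℓ → ZMod q) (c : Fin m → Fin N → ZMod q) (C : ℕ) (j : Fin m) (t : Fin N) :
    Cost (circuitInput (Fin N' → Sample q ℓ) C)
      (circuitBits (Fin N' → Sample q ℓ) C)
      (zBits fun x => hybridMatrix i S c (fun t => x.1 (ι t)) j t)
      (opCost q + ℓ * (q * opCost q)) := by
  unfold hybridMatrix
  by_cases h : j = i
  · simp only [h, if_true]
    exact cost_sample_snd C (ι t) _
  · simp only [h, if_false]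
    have h1 : ∀ d, Cost (circuitInput (Fin N' → Sample q ℓ) C)
        (circuitBits (Fin N' → Sample q ℓ) C) (zBits fun x => (x.1 (ι t)).1 d) 0 := fun d =>
      cost_sample_fst C (ι t) d 0
    have h2 := cost_dotProduct_add
      (fun (x : (Fin N' → Sample q ℓ) × (Fin C → Bool)) d => (x.1 (ι t)).1 d) h1 (S j) (c j t)
    exact h2

theorem cost_cons_add {Ω : Type} [BitEncoding Ω] {m N c₀ : ℕ}
    {V : Ω → Fin m → Fin (N + 1) → ZMod q}
    (hV : ∀ C i t, Cost (circuitInput Ω C) (circuitBits Ω C) (zBits fun x => V x.1 i t) c₀)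
    (c : Fin m → Fin (N + 2) → ZMod q) (C i j) :
    Cost (circuitInput Ω C) (circuitBits Ω C)
      (zBits fun x => (Fin.cons 0 (V x.1 i) + c i : Fin (N + 2) → ZMod q) j)
      (c₀ + 2 * opCost q) := by
  refine Fin.cases ?_ (fun t => ?_) j
  · have h : Cost (circuitInput Ω C) (circuitBits Ω C) (zBits fun _ => c i 0) (opCost q) :=
      (cost_zConst (c i 0)).mono (Set.empty_subset _) subset_rfl le_rfl
    simp only [Pi.add_apply, Fin.cons_zero, zero_add]
    exact h.mono subset_rfl subset_rfl (by omega)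
  · have h := cost_add_const (hV C i t) (c i t.succ)
    simp only [Pi.add_apply, Fin.cons_succ]
    exact h

theorem computable_cons_add {Ω : Type} [BitEncoding Ω] {m N c₀ : ℕ}
    {V : Ω → Fin m → Fin (N + 1) → ZMod q}
    (hV : ∀ C i t, Cost (circuitInput Ω C) (circuitBits Ω C) (zBits fun x => V x.1 i t) c₀)
    (c : Fin m → Fin (N + 2) → ZMod q) :
    Computable (fun ω i => toSample (Fin.cons 0 (V ω i) + c i : Fin (N + 2) → ZMod q))
      (m * ((N + 2) * (c₀ + 2 * opCost q))) := by
  have h := cost_cons_add hV c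
  set f : Ω → Fin m → Fin (N + 1 + 1) → ZMod q :=
    fun ω i => (Fin.cons 0 (V ω i) + c i : Fin (N + 2) → ZMod q) with hf
  have := computable_toSample (n := N + 1) f (c := c₀ + 2 * opCost q) fun C i j => h C i j
  exact this

/-! ## The hybrid argument over the rows of the secret matrix -/

theorem lwe_unif_eq (σ : ℝ) (ℓ N : ℕ) :
    lwe q ℓ N (unif (Fin ℓ → ZMod q)) (discreteGaussian σ) =
      (unif (Fin N → Fin ℓ → ZMod q)).bind fun B => (lweRow σ B).map fun v t => (B t, v t) := by
  rw [lwe_eq]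
  unfold lweRow
  simp only [PMF.map_bind, PMF.map_comp]
  rw [PMF.bind_comm (unif (Fin N → Fin ℓ → ZMod q))]
  congr 1
  funext S
  rw [iid_bind, iid_unif]
  congr 1
  funext B
  exact indep_map _ fun t (e : ℤ) => (B t, S ⬝ᵥ B t + (e : ZMod q))

theorem unif_sample_eq (ℓ N : ℕ) :
    unif (Fin N → Sample q ℓ) =
      (unif (Fin N → Fin ℓ → ZMod q)).bind fun B =>
        (unif (Fin N → ZMod q)).map fun v t => (B t, v t) := by
  have h1 : unif (Sample q ℓ) =
      (unif (Fin ℓ → ZMod q)).bind fun a => (unif (ZMod q)).map fun v => (a, v) := by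
    ext ⟨a, v⟩
    rw [PMF.bind_apply, tsum_eq_single a, PMF.map_apply, tsum_eq_single v, if_pos rfl]
    · simp only [PMF.uniformOfFintype_apply, Fintype.card_prod]
      push_cast
      rw [ENNReal.mul_inv (by simp) (by simp)]
    · intro v' hv
      rw [if_neg]
      rintro h
      exact hv (congrArg Prod.snd h).symm
    · intro b hb
      rw [PMF.map_apply, ENNReal.tsum_eq_zero.2, mul_zero]
      intro v'
      rw [if_neg]
      rintro h
      exact hb (congrArg Prod.fst h).symm
  rw [← iid_unif, h1, iid_bind, iid_unif]
  congr 1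
  funext B
  have := indep_map (fun _ : Fin N => unif (ZMod q)) fun t v => (B t, v)
  rw [this, ← iid_eq_indep, iid_unif]

theorem lwe_unif_map_tail (σ : ℝ) (ℓ N : ℕ) :
    (lwe q ℓ (N + 1) (unif (Fin ℓ → ZMod q)) (discreteGaussian σ)).map (fun y t => y t.succ) =
      lwe q ℓ N (unif (Fin ℓ → ZMod q)) (discreteGaussian σ) := by
  rw [lwe_eq, lwe_eq, PMF.map_bind]
  congr 1
  funext s
  rw [iid_succ, PMF.map_bind]
  simp only [PMF.map_comp, Function.comp_def, Fin.cons_succ]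
  rw [PMF.bind_const]
  exact PMF.map_id _

theorem unif_map_tail {α : Type} [Fintype α] [Nonempty α] (N : ℕ) :
    (unif (Fin (N + 1) → α)).map (fun y t => y t.succ) = unif (Fin N → α) := by
  rw [← iid_unif, ← iid_unif, iid_succ, PMF.map_bind]
  simp only [PMF.map_comp, Function.comp_def, Fin.cons_succ]
  rw [PMF.bind_const]
  exact PMF.map_id _

/-- Matrix-secret LWE is pseudorandom if LWE is, for all hybrids of a test. -/
theorem near_lweMatrix_of_rows {σ : ℝ} {m N ℓ : ℕ} {a : (Fin m → Fin N → ZMod q) → ℝ≥0∞}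
    {e : ℝ≥0∞} (h : ∀ i S c, Near (fun y => a (hybridMatrix i S c y)) e
      (lwe q ℓ N (unif (Fin ℓ → ZMod q)) (discreteGaussian σ)) (unif (Fin N → Sample q ℓ))) :
    Near a (m * e) (lweMatrix q σ m N ℓ) (unif (Fin m → Fin N → ZMod q)) := by
  classical
  -- In hybrid r the first r rows are uniform and the others are LWE rows, all for the same B.
  set H : ℕ → PMF (Fin m → Fin N → ZMod q) := fun r =>
    (unif (Fin N → Fin ℓ → ZMod q)).bind fun B => indep fun j : Fin m =>
      if (j : ℕ) < r then unif (Fin N → ZMod q) else lweRow σ B with hH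
  have h0 : H 0 = lweMatrix q σ m N ℓ := by
    simp [hH, lweMatrix, iid_eq_indep]
  have hm : H m = unif (Fin m → Fin N → ZMod q) := by
    simp only [hH, Fin.is_lt, if_true]
    rw [← iid_eq_indep, iid_unif, PMF.bind_const]
  have hstep : ∀ r, r < m → Near a e (H r) (H (r + 1)) := fun r hr => by
    set i : Fin m := ⟨r, hr⟩ with hi
    -- Every row other than the challenge row is S_j B + c_j for data independent of B: a uniform
    -- row takes S_j = 0 and c_j uniform, an LWE row takes its own secret and error. Row r is drawn
    -- too and then overwritten by the challenge.
    let K : Fin m → PMF ((Fin ℓ → ZMod q) × (Fin N → ZMod q)) := fun j =>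
      if (j : ℕ) < r then (unif (Fin N → ZMod q)).map fun u => (0, u)
      else (unif (Fin ℓ → ZMod q)).bind fun S =>
        (iid N (discreteGaussian σ)).map fun z => (S, castVec z)
    have hK : ∀ (B : Fin N → Fin ℓ → ZMod q),
        (fun j : Fin m => if (j : ℕ) < r then unif (Fin N → ZMod q) else lweRow σ B) =
          fun j => (K j).map fun p t => p.1 ⬝ᵥ B t + p.2 t := fun B => by
      funext j
      simp only [K]
      split_ifs
      · simp only [PMF.map_comp, Function.comp_def, zero_dotProduct, zero_add]
        exact (PMF.map_id _).symm
      · simp only [PMF.map_bind, PMF.map_comp]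
        rfl
    have hr0 : ∀ B : Fin N → Fin ℓ → ZMod q,
        (fun j : Fin m => if (j : ℕ) < r then unif (Fin N → ZMod q) else lweRow σ B) =
        Function.update (fun j : Fin m => (K j).map fun p t => p.1 ⬝ᵥ B t + p.2 t) i
          (lweRow σ B) := fun B => by
      rw [← hK, eq_comm, Function.update_eq_self_iff]
      simp [hi]
    have hr1 : ∀ B : Fin N → Fin ℓ → ZMod q,
        (fun j : Fin m => if (j : ℕ) < r + 1 then unif (Fin N → ZMod q) else lweRow σ B) =
        Function.update (fun j : Fin m => (K j).map fun p t => p.1 ⬝ᵥ B t + p.2 t) i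
          (unif (Fin N → ZMod q)) := fun B => by
      rw [← hK]
      funext j
      by_cases hj : j = i
      · subst hj
        simp [hi]
      · rw [Function.update_of_ne hj]
        have : (j : ℕ) ≠ r := fun h => hj (Fin.ext h)
        have : (j : ℕ) < r + 1 ↔ (j : ℕ) < r := by omega
        simp only [this]
    have key : ∀ (V : (Fin N → Fin ℓ → ZMod q) → PMF (Fin N → ZMod q)),
        ((unif (Fin N → Fin ℓ → ZMod q)).bind fun B => indep (Function.update
          (fun j : Fin m => (K j).map fun p t => p.1 ⬝ᵥ B t + p.2 t) i (V B))) =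
        (indep K).bind fun p => ((unif (Fin N → Fin ℓ → ZMod q)).bind fun B =>
          (V B).map fun v t => (B t, v t)).map
            (hybridMatrix i (fun j => (p j).1) fun j => (p j).2) := fun V => by
      simp only [PMF.map_bind]
      rw [PMF.bind_comm (indep K)]
      congr 1
      funext B
      rw [indep_update, indep_map, PMF.bind_map]
      congr 1
      funext p
      rw [PMF.map_comp, Function.comp_apply]
      congr 1
      funext v j t
      by_cases hj : j = i
      · subst hj
        simp [hybridMatrix]
      · simp [hybridMatrix, hj]
    simp only [hH, hr0, hr1]
    rw [key, key (fun _ => unif (Fin N → ZMod q)), ← lwe_unif_eq, ← unif_sample_eq]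
    refine Near.bind_right _ fun p => ?_
    rw [near_map_iff]
    exact h _ _ _
  have hind : ∀ r ≤ m, Near a (r * e) (H 0) (H r) := fun r => by
    induction r with
    | zero =>
      intro _
      simpa using Near.refl a (H 0)
    | succ r ih =>
      intro hr
      refine ((ih (by omega)).trans (hstep r hr)).mono (le_of_eq ?_)
      push_cast
      ring
  rw [← h0, ← hm]
  exact hind m le_rfl

end Reductions

/-! ## The error terms of the reductions -/

section Errors

/-- Eventually a f(λ) ≥ (z + 1) log λ, so the exponential is at most λ^(-(z+1)). -/
theorem SuperLogarithmic.negligible_exp {f : ℕ → ℝ} (hf : SuperLogarithmic f) {a : ℝ} (ha : 0 < a) :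
    Negligible fun lam => Real.exp (-(a * f lam)) := fun z => by
  have h1 : ∀ᶠ lam : ℕ in Filter.atTop,
      (lam : ℝ) ^ z * Real.exp (-(a * f lam)) ≤ ((lam : ℝ))⁻¹ := by
    filter_upwards [hf.eventually_ge_atTop ((z + 1) / a), Filter.eventually_ge_atTop 2]
      with lam h hlam
    have hl : (2 : ℝ) ≤ lam := by exact_mod_cast hlam
    have hlog : 0 < Real.log lam := Real.log_pos (by linarith)
    rw [le_div_iff₀ hlog, div_mul_eq_mul_div, div_le_iff₀ ha] at h
    have h2 : Real.exp (-(a * f lam)) ≤ ((lam : ℝ) ^ (z + 1))⁻¹ := by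
      rw [← Real.exp_log (show (0 : ℝ) < lam by linarith), ← Real.exp_nat_mul, ← Real.exp_neg,
        Real.exp_le_exp]
      push_cast
      linarith
    calc (lam : ℝ) ^ z * Real.exp (-(a * f lam)) ≤ (lam : ℝ) ^ z * ((lam : ℝ) ^ (z + 1))⁻¹ := by
          gcongr
      _ = (lam : ℝ)⁻¹ := by
          field_simp
          rw [pow_succ]
  exact squeeze_zero' (Filter.Eventually.of_forall fun lam => by positivity) h1
    (tendsto_inv_atTop_zero.comp tendsto_natCast_atTop_atTop)

/-- A bound for the sum of the statistical errors. -/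
noncomputable def totalError (μ f g : ℕ → ℝ) (lam : ℕ) : ℝ :=
  256 * Real.exp (-f lam) + |μ lam| + Real.exp (-(Real.log 2 / 2 * g lam))

theorem negligible_totalError {μ f g : ℕ → ℝ} (hμ : Negligible μ) (hf : SuperLogarithmic f)
    (hg : SuperLogarithmic g) : Negligible (totalError μ f g) := by
  have h1 : Negligible fun lam => Real.exp (-f lam) := by
    simpa using hf.negligible_exp one_pos
  have h2 : Negligible fun lam => |μ lam| :=
    Asymptotics.SuperpolynomialDecay.trans_abs_le hμ fun x => by simp
  exact ((h1.const_mul 256).add h2).add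
    (hg.negligible_exp (half_pos (Real.log_pos one_lt_two)))

theorem totalError_pos (μ f g : ℕ → ℝ) (lam : ℕ) : 0 < totalError μ f g lam := by
  unfold totalError
  positivity

theorem one_add_ofReal_pow_le {t u : ℝ} (ht : 0 ≤ t) {p : ℕ} (hp : p * t ≤ u) (hu : u ≤ 1) :
    (1 + ENNReal.ofReal t) ^ p ≤ 1 + ENNReal.ofReal (2 * u) := by
  have hu0 : 0 ≤ u := le_trans (by positivity) hp
  rw [← ENNReal.ofReal_one, ← ENNReal.ofReal_add zero_le_one ht,
    ← ENNReal.ofReal_add zero_le_one (by positivity), ← ENNReal.ofReal_pow (by positivity)]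
  refine ENNReal.ofReal_le_ofReal ?_
  calc (1 + t) ^ p ≤ Real.exp t ^ p := by
        gcongr
        linarith [Real.add_one_le_exp t]
    _ = Real.exp (p * t) := (Real.exp_nat_mul t p).symm
    _ ≤ Real.exp u := Real.exp_le_exp.2 hp
    _ ≤ 1 + 2 * u := by
        have := Real.abs_exp_sub_one_le (x := u) (by rwa [abs_of_nonneg hu0])
        rw [abs_of_nonneg hu0] at this
        linarith [(abs_le.1 this).2]

/-- The terms log n and log m in the bound on σ pay for all (2n + 1)m ≤ 3nm smoothing steps: κ = 1 +
16t with t n m ≤ exp(-F), so the exponent sum is at most 48 exp(-F), and it doubles when passing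
from exp(u) to 1 + 2u. -/
theorem exists_smoothAbove {σ F : ℝ} (hσ : 0 < σ) {m n : ℕ} (hn : 0 < n)
    (h : 4 * √(F + Real.log n + Real.log m) ≤ σ) (hF : 256 * Real.exp (-F) < 1) :
    ∃ κ : ℝ≥0∞, SmoothAbove κ (σ / 2) ∧
      (κ ^ (n + 1) * κ ^ n) ^ m ≤ 1 + ENNReal.ofReal (96 * Real.exp (-F)) := by
  set t := Real.exp (-(Real.pi * (σ / 2) ^ 2)) with ht
  have hlogn : 0 ≤ Real.log n := Real.log_natCast_nonneg n
  have hlogm : 0 ≤ Real.log m := Real.log_natCast_nonneg m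
  have hF0 : 0 < F := by
    by_contra hc
    have := Real.one_le_exp (x := -F) (by linarith)
    linarith
  have hσ2 : F + Real.log n + Real.log m ≤ Real.pi * (σ / 2) ^ 2 := by
    have h1 := pow_le_pow_left₀ (by positivity) h 2
    rw [mul_pow, Real.sq_sqrt (by linarith)] at h1
    nlinarith [Real.pi_gt_three, sq_nonneg σ]
  have htF : t ≤ Real.exp (-F) := Real.exp_le_exp.2 (by linarith)
  refine ⟨1 + ENNReal.ofReal (16 * t), ⟨le_self_add, fun s hs t' t'' =>
    thetaSum_le (by positivity) hs (by rw [← ht]; linarith) t' t''⟩, ?_⟩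
  rw [← pow_add, ← pow_mul]
  refine (one_add_ofReal_pow_le (u := 48 * Real.exp (-F)) (by positivity) ?_
    (by linarith)).trans (by rw [← mul_assoc]; norm_num)
  rcases Nat.eq_zero_or_pos m with rfl | hm
  · simp
    positivity
  have hm' : (0 : ℝ) < m := by exact_mod_cast hm
  have hn' : (1 : ℝ) ≤ n := by exact_mod_cast hn
  have ht2 : t * (n * m) ≤ Real.exp (-F) := by
    rw [← Real.exp_log (show (0 : ℝ) < n * m by positivity), ht, ← Real.exp_add,
      Real.exp_le_exp, Real.log_mul (by positivity) (by positivity)]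
    linarith
  push_cast
  have h3 : 16 * t * m * (2 * n + 1) ≤ 16 * t * m * (3 * n) := by
    gcongr
    linarith
  calc ((n : ℝ) + 1 + n) * m * (16 * t) = 16 * t * m * (2 * n + 1) := by ring
    _ ≤ 48 * (t * (n * m)) := by linarith
    _ ≤ 48 * Real.exp (-F) := by linarith

/-- The product of the distinct primes dividing q is at most q, and 1/log 2 < 2. The factor 2 is
later absorbed by passing from 2^ℓ to 2^(ℓ+1). -/
theorem card_primeFactors_le_two_mul_log {q : ℕ} (hq : q ≠ 0) :
    (q.primeFactors.card : ℝ) ≤ 2 * Real.log q := by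
  have h1 : 2 ^ q.primeFactors.card ≤ q :=
    (Finset.pow_card_le_prod _ _ _ fun p hp => (Nat.prime_of_mem_primeFactors hp).two_le).trans
      (Nat.le_of_dvd (Nat.pos_of_ne_zero hq) (Nat.prod_primeFactors_dvd q))
  have h2 : Real.log (2 ^ q.primeFactors.card) ≤ Real.log q :=
    Real.log_le_log (by positivity) (by exact_mod_cast h1)
  rw [Real.log_pow] at h2
  have : (0 : ℝ) ≤ q.primeFactors.card := by positivity
  nlinarith [Real.log_two_gt_d9]

theorem card_primeFactors_div_le {q : ℕ} [NeZero q] {ℓ : ℕ} {b : ℝ}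
    (h : Real.log q / 2 ^ ℓ ≤ b) :
    (q.primeFactors.card : ℝ≥0∞) / 2 ^ (ℓ + 1) ≤ ENNReal.ofReal |b| := by
  have h1 := card_primeFactors_le_two_mul_log (NeZero.ne q)
  have h2 : (q.primeFactors.card : ℝ) / 2 ^ (ℓ + 1) ≤ |b| := by
    refine le_trans ?_ (h.trans (le_abs_self b))
    rw [pow_succ, div_le_div_iff₀ (by positivity) (by positivity)]
    nlinarith [pow_pos (two_pos (α := ℝ)) ℓ]
  refine le_trans (le_of_eq ?_) (ENNReal.ofReal_le_ofReal h2)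
  rw [ENNReal.ofReal_div_of_pos (by positivity), ENNReal.ofReal_natCast,
    ENNReal.ofReal_pow (by norm_num)]
  norm_num

theorem pow_mul_exp_le_choose {q n k ℓ : ℕ} [NeZero q] (hk : 0 < k) (hkn : k ≤ n) {G : ℝ}
    (h : (ℓ + 1) * Real.logb 2 q + G ≤ k * Real.logb 2 (n / k)) :
    (q : ℝ) ^ (ℓ + 1) * Real.exp (Real.log 2 * G) ≤ n.choose k := by
  refine le_trans ?_ (div_pow_le_choose hkn)
  have hk' : (0 : ℝ) < k := by exact_mod_cast hk
  have hn' : (0 : ℝ) < n := hk'.trans_le (by exact_mod_cast hkn)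
  have hq : (0 : ℝ) < q := by exact_mod_cast Nat.pos_of_ne_zero (NeZero.ne q)
  have h2 : (0 : ℝ) < Real.log 2 := Real.log_pos one_lt_two
  rw [← Real.log_le_log_iff (by positivity) (by positivity), Real.log_mul (by positivity)
    (by positivity), Real.log_pow, Real.log_pow, Real.log_exp]
  have e : ∀ x, Real.log x = Real.log 2 * Real.logb 2 x := fun x => by
    rw [Real.logb]
    field_simp
  rw [e q, e (n / k)]
  push_cast
  nlinarith

theorem sqrt_div_choose_le {q n k ℓ : ℕ} [NeZero q] (hk : 0 < k) (hkn : k ≤ n) {G : ℝ}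
    (h : (ℓ + 1) * Real.logb 2 q + G ≤ k * Real.logb 2 (n / k)) :
    √((q ^ (ℓ + 1) : ℕ) / n.choose k) ≤ Real.exp (-(Real.log 2 / 2 * G)) := by
  have h1 := pow_mul_exp_le_choose hk hkn h
  have hc : (0 : ℝ) < n.choose k := by exact_mod_cast Nat.choose_pos hkn
  rw [Real.sqrt_le_left (Real.exp_pos _).le, ← Real.exp_nat_mul, div_le_iff₀ hc]
  have e : ((2 : ℕ) : ℝ) * -(Real.log 2 / 2 * G) = -(Real.log 2 * G) := by
    push_cast
    ring
  rw [e, Real.exp_neg, inv_mul_eq_div, le_div_iff₀ (Real.exp_pos _)]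
  exact_mod_cast h1

/-- From 2^(ℓ+1) ≤ q^(ℓ+1) ≤ C(n,k) ≤ 2^n. It eliminates ℓ from the running time of the second
reduction. -/
theorem succ_le_of_entropy {q n k ℓ : ℕ} (hq : 2 ≤ q) (hk : 0 < k) (hkn : k ≤ n) {G : ℝ}
    (hG : 0 ≤ G) (h : (ℓ + 1) * Real.logb 2 q + G ≤ k * Real.logb 2 (n / k)) : ℓ + 1 ≤ n := by
  have : NeZero q := ⟨by omega⟩
  have h1 := pow_mul_exp_le_choose hk hkn h
  have h2 : (1 : ℝ) ≤ Real.exp (Real.log 2 * G) :=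
    Real.one_le_exp (mul_nonneg (Real.log_nonneg one_le_two) hG)
  have h3 : (q : ℝ) ^ (ℓ + 1) ≤ n.choose k := le_trans (le_mul_of_one_le_right (by positivity) h2) h1
  have h4 : q ^ (ℓ + 1) ≤ n.choose k := by exact_mod_cast h3
  refine (Nat.pow_le_pow_iff_right one_lt_two).1 ?_
  exact (Nat.pow_le_pow_left hq _).trans (h4.trans (Nat.choose_le_two_pow n k))

theorem clog_two_le_two_mul_log_add_one (q : ℕ) :
    (Nat.clog 2 q : ℝ) ≤ 2 * Real.log q + 1 := by
  have h1 : Nat.clog 2 q ≤ Nat.log 2 q + 1 := by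
    refine Nat.clog_le_of_le_pow ?_
    exact (Nat.lt_pow_succ_log_self one_lt_two q).le
  have h2 : (Nat.log 2 q : ℝ) ≤ Real.logb 2 q := by exact_mod_cast Real.natLog_le_logb q 2
  have h3 : Real.logb 2 q ≤ 2 * Real.log q := by
    rw [Real.logb, div_le_iff₀ (Real.log_pos one_lt_two)]
    nlinarith [Real.log_two_gt_d9, Real.log_natCast_nonneg q]
  have h4 : (Nat.clog 2 q : ℝ) ≤ Nat.log 2 q + 1 := by exact_mod_cast h1
  linarith

theorem clog_two_le (q : ℕ) : Nat.clog 2 q ≤ q :=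
  Nat.clog_le_of_le_pow Nat.lt_two_pow_self.le

end Errors

/-! ## The reductions -/

section Main

theorem opCost_le_log (q : ℕ) : (opCost q : ℝ) ≤ 24 * (2 * Real.log q + 3) := by
  have := clog_two_le_two_mul_log_add_one q
  unfold opCost
  push_cast
  linarith

theorem opCost_le (q : ℕ) : opCost q ≤ 24 * (q + 2) := by
  have := clog_two_le q
  unfold opCost
  omega

variable {q : ℕ} [NeZero q]

theorem near_sparse_lwe_of_bounds {μ f g : ℕ → ℝ} {lam m N ℓ k : ℕ} {σ : ℝ} (hσ : 0 < σ)
    (hk : 0 < k) (hkn : k ≤ N + 1) (hμ : Real.log q / 2 ^ ℓ ≤ μ lam)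
    (hf : 4 * √(f lam + Real.log (N + 1 : ℕ) + Real.log m) ≤ σ)
    (hg : (ℓ + 1) * Real.logb 2 q + g lam ≤ k * Real.logb 2 ((N + 1 : ℕ) / k))
    (hη : 256 * Real.exp (-f lam) < 1)
    {a : (Fin m → Sample q (N + 1)) → ℝ≥0∞} (ha : ∀ x, a x ≤ 1) {e₁ e₂ : ℝ}
    (he₁ : 0 ≤ e₁) (he₂ : 0 ≤ e₂)
    (h₁ : ∀ s ∈ sparseVectors (N + 1) k, ∀ c : Fin m → Fin (N + 2) → ZMod q,
      Near (fun V => a fun i => reduceRow s (V i) (c i)) (ENNReal.ofReal e₁) (lweMatrix q σ m N ℓ)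
        (unif (Fin m → Fin N → ZMod q)))
    (h₂ : Near (fun V => a fun i => toSample (V i)) (ENNReal.ofReal e₂)
      (lweMatrix q (2 * σ) m (N + 2) (ℓ + 1)) (unif (Fin m → Fin (N + 2) → ZMod q))) :
    Near a (ENNReal.ofReal (192 * Real.exp (-f lam) + |μ lam| +
        Real.exp (-(Real.log 2 / 2 * g lam)) + e₁ + e₂))
      (lwe q (N + 1) m (sparseSecret q hkn) (discreteGaussian (2 * σ * √(k + 1))))
      (unif (Fin m → Sample q (N + 1))) := by
  obtain ⟨κ, hκ, hκ'⟩ := exists_smoothAbove hσ (Nat.succ_pos N) hf hη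
  refine (near_sparse_lwe hσ hκ hkn hκ' ha h₁ h₂).mono ?_
  have e : 192 * Real.exp (-f lam) + |μ lam| + Real.exp (-(Real.log 2 / 2 * g lam)) + e₁ + e₂ =
      96 * Real.exp (-f lam) + e₁ + 96 * Real.exp (-f lam) + |μ lam| +
        Real.exp (-(Real.log 2 / 2 * g lam)) + e₂ := by ring
  rw [e, ENNReal.ofReal_add (by positivity) he₂, ENNReal.ofReal_add (by positivity) (by positivity),
    ENNReal.ofReal_add (by positivity) (by positivity),
    ENNReal.ofReal_add (by positivity) (by positivity),
    ENNReal.ofReal_add (by positivity) he₁]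
  gcongr
  · exact card_primeFactors_div_le hμ
  · exact sqrt_div_choose_le hk hkn hg

theorem near_double_of_bounds {μ f : ℕ → ℝ} {lam m N ℓ : ℕ} {σ : ℝ} (hσ : 0 < σ)
    (hμ : Real.log q / 2 ^ ℓ ≤ μ lam)
    (hf : 4 * √(f lam + Real.log (N + 1 : ℕ) + Real.log m) ≤ σ)
    (hη : 256 * Real.exp (-f lam) < 1)
    {a : (Fin m → Fin (N + 2) → ZMod q) → ℝ≥0∞} (ha : ∀ x, a x ≤ 1) {e : ℝ} (he : 0 ≤ e)
    (h₁ : ∀ c : Fin m → Fin (N + 2) → ZMod q,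
      Near (fun V => a fun i => Fin.cons 0 (V i) + c i) (ENNReal.ofReal e)
        (lweMatrix q σ m (N + 1) ℓ) (unif (Fin m → Fin (N + 1) → ZMod q))) :
    Near a (ENNReal.ofReal (|μ lam| + 96 * Real.exp (-f lam) + e))
      (lweMatrix q (2 * σ) m (N + 2) (ℓ + 1)) (unif (Fin m → Fin (N + 2) → ZMod q)) := by
  obtain ⟨κ, hκ, hκ'⟩ := exists_smoothAbove hσ (Nat.succ_pos N) hf hη
  have hκ'' : (κ ^ (N + 1)) ^ m ≤ 1 + ENNReal.ofReal (96 * Real.exp (-f lam)) :=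
    le_trans (by gcongr; exact le_mul_of_one_le_left' (one_le_pow₀ hκ.1)) hκ'
  refine (near_lweMatrix_double hσ hκ hκ'' ha h₁).mono ?_
  rw [ENNReal.ofReal_add (by positivity) he, ENNReal.ofReal_add (by positivity) (by positivity)]
  gcongr
  exact card_primeFactors_div_le hμ

theorem near_reduceRow_of_matrixLwe {σ T ε : ℝ} {m N ℓ : ℕ} {s : Fin (N + 1) → ℤ}
    (hs : IsTernary s) (c : Fin m → Fin (N + 2) → ZMod q)
    (A : Algorithm (BitEncoding.Idx (Fin m → Sample q (N + 1))))
    (hT : (A.time : ℝ) + m * ((N + 2) * ((N + 1) * opCost q)) ≤ T)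
    (h : ¬ Distinguishable
      (matrixLwe q ℓ m N (unif (Fin m → Fin ℓ → ZMod q)) (iid m (discreteGaussian σ)))
      (unif (Fin N → MatrixSample q ℓ m)) T ε) :
    Near (fun V => A.accept fun i => reduceRow s (V i) (c i)) (ENNReal.ofReal ε)
      (lweMatrix q σ m N ℓ) (unif (Fin m → Fin N → ZMod q)) := by
  have h1 := near_accept_comp (computable_reduceRow hs
    (V := fun (ω : Fin N → MatrixSample q ℓ m) i t => (ω t).2 i)
    (fun C i t => cost_matrixSample C t i 0) c) A (le_trans (by push_cast; linarith) hT) h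
  rw [← matrixLwe_map, ← unif_matrixSample_map m N ℓ, near_map_iff]
  exact h1.2

theorem near_toSample_of_matrixLwe {σ T ε : ℝ} {m n ℓ : ℕ}
    (A : Algorithm (BitEncoding.Idx (Fin m → Sample q n))) (hT : (A.time : ℝ) ≤ T)
    (h : ¬ Distinguishable
      (matrixLwe q ℓ m (n + 1) (unif (Fin m → Fin ℓ → ZMod q)) (iid m (discreteGaussian σ)))
      (unif (Fin (n + 1) → MatrixSample q ℓ m)) T ε) :
    0 < ε ∧ Near (fun V => A.accept fun i => toSample (V i)) (ENNReal.ofReal ε)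
      (lweMatrix q σ m (n + 1) ℓ) (unif (Fin m → Fin (n + 1) → ZMod q)) := by
  have h1 := near_accept_comp (computable_toSample
    (fun (ω : Fin (n + 1) → MatrixSample q ℓ m) i t => (ω t).2 i)
    (fun C i t => cost_matrixSample C t i 0)) A (le_trans (by push_cast; linarith) hT) h
  rw [← matrixLwe_map, ← unif_matrixSample_map m (n + 1) ℓ, near_map_iff]
  exact h1

theorem near_reduceRow_of_lwe {σ T ε : ℝ} {m N ℓ : ℕ} {s : Fin (N + 1) → ℤ}
    (hs : IsTernary s) (c : Fin m → Fin (N + 2) → ZMod q)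
    (A : Algorithm (BitEncoding.Idx (Fin m → Sample q (N + 1))))
    (hT : (A.time : ℝ) + m * ((N + 2) * (opCost q + N * (opCost q + ℓ * (q * opCost q) +
      opCost q))) ≤ T)
    (h : ¬ Distinguishable
      (lwe q ℓ (N + 1) (unif (Fin ℓ → ZMod q)) (discreteGaussian σ))
      (unif (Fin (N + 1) → Sample q ℓ)) T ε) :
    Near (fun V => A.accept fun i => reduceRow s (V i) (c i)) (m * ENNReal.ofReal ε)
      (lweMatrix q σ m N ℓ) (unif (Fin m → Fin N → ZMod q)) := by
  refine near_lweMatrix_of_rows fun i S c' => ?_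
  have h1 := near_accept_comp (computable_reduceRow hs
    (V := fun (ω : Fin (N + 1) → Sample q ℓ) => hybridMatrix i S c' fun t => ω t.succ)
    (fun C j t => cost_hybridMatrix Fin.succ i S c' C j t) c) A
    (le_trans (by push_cast; linarith) hT) h
  rw [← lwe_unif_map_tail, ← unif_map_tail (α := Sample q ℓ) N, near_map_iff]
  exact h1.2

theorem near_cons_add_of_lwe {σ T ε : ℝ} {m N ℓ : ℕ} (c : Fin m → Fin (N + 2) → ZMod q)
    (A : Algorithm (BitEncoding.Idx (Fin m → Sample q (N + 1))))
    (hT : (A.time : ℝ) + m * ((N + 2) * (opCost q + ℓ * (q * opCost q) + 2 * opCost q)) ≤ T)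
    (h : ¬ Distinguishable
      (lwe q ℓ (N + 1) (unif (Fin ℓ → ZMod q)) (discreteGaussian σ))
      (unif (Fin (N + 1) → Sample q ℓ)) T ε) :
    Near (fun V => A.accept fun i => toSample (Fin.cons 0 (V i) + c i : Fin (N + 2) → ZMod q))
      (m * ENNReal.ofReal ε)
      (lweMatrix q σ m (N + 1) ℓ) (unif (Fin m → Fin (N + 1) → ZMod q)) := by
  refine near_lweMatrix_of_rows fun i S c' => ?_
  exact (near_accept_comp (computable_cons_add
    (V := fun (ω : Fin (N + 1) → Sample q ℓ) => hybridMatrix i S c' ω)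
    (fun C j t => cost_hybridMatrix id i S c' C j t) c) A
    (le_trans (by push_cast; linarith) hT) h).2

theorem not_distinguishable_of_matrixLwe {μ f g : ℕ → ℝ} {lam m n ℓ k : ℕ} {σ ε T T' : ℝ}
    (hσ : 0 < σ) (hk : 0 < k) (hkn : k < n) (hμ : Real.log q / 2 ^ ℓ ≤ μ lam)
    (hf : 4 * √(f lam + Real.log n + Real.log m) ≤ σ)
    (hg : (ℓ + 1) * Real.logb 2 q + g lam ≤ k * Real.logb 2 (n / k))
    (hT : T + m * ((n + 1) * (n * (24 * (2 * Real.log q + 3)))) ≤ T')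
    (h₁ : ¬ Distinguishable
      (matrixLwe q ℓ m (n - 1) (unif (Fin m → Fin ℓ → ZMod q)) (iid m (discreteGaussian σ)))
      (unif (Fin (n - 1) → MatrixSample q ℓ m)) T' (ε - totalError μ f g lam))
    (h₂ : ¬ Distinguishable
      (matrixLwe q (ℓ + 1) m (n + 1) (unif (Fin m → Fin (ℓ + 1) → ZMod q))
        (iid m (discreteGaussian (2 * σ))))
      (unif (Fin (n + 1) → MatrixSample q (ℓ + 1) m)) T' (ε - totalError μ f g lam)) :
    ¬ Distinguishable
      (lwe q n m (sparseSecret q hkn.le) (discreteGaussian (2 * σ * √(k + 1))))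
      (unif (Fin m → Sample q n)) T (2 * ε) := by
  rintro ⟨A, hA, hadv⟩
  obtain ⟨N, rfl⟩ : ∃ N, n = N + 1 := ⟨n - 1, by omega⟩
  have hlog := Real.log_natCast_nonneg q
  have hη := totalError_pos μ f g lam
  have hcost : (A.time : ℝ) + m * ((N + 2) * ((N + 1) * opCost q)) ≤ T' := by
    have e : (m : ℝ) * ((N + 2) * ((N + 1) * opCost q)) ≤
        m * ((((N + 1 : ℕ) : ℝ) + 1) * ((N + 1 : ℕ) * (24 * (2 * Real.log q + 3)))) := by
      push_cast
      rw [add_assoc, one_add_one_eq_two]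
      gcongr
      exact opCost_le_log q
    linarith
  have hA' : (A.time : ℝ) ≤ T' := le_trans (le_add_of_nonneg_right (by positivity)) hcost
  obtain ⟨hε, h₂'⟩ := near_toSample_of_matrixLwe A hA' h₂
  have h1 := advantage_le_one A (lwe q (N + 1) m (sparseSecret q hkn.le)
    (discreteGaussian (2 * σ * √(k + 1)))) (unif (Fin m → Sample q (N + 1)))
  have hexp := Real.exp_pos (-f lam)
  have hexp' := Real.exp_pos (-(Real.log 2 / 2 * g lam))
  have habs := abs_nonneg (μ lam)
  have ht : totalError μ f g lam = 256 * Real.exp (-f lam) + |μ lam| +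
    Real.exp (-(Real.log 2 / 2 * g lam)) := rfl
  -- Otherwise `totalError` is at least 1. As ε exceeds it by `hε`, an advantage of 2ε is
  -- impossible.
  by_cases hη1 : 256 * Real.exp (-f lam) < 1
  · have := advantage_le_of_near (by positivity) (near_sparse_lwe_of_bounds hσ hk hkn.le hμ hf hg
      hη1 A.accept_le_one hε.le hε.le
      (fun s hs c => near_reduceRow_of_matrixLwe (mem_sparseVectors.1 hs).1 c A hcost h₁) h₂')
    linarith
  · linarith

theorem not_distinguishable_of_lwe {μ f g : ℕ → ℝ} {lam m n ℓ k : ℕ} {σ ε T T' : ℝ}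
    (hσ : 0 < σ) (hε : 0 < ε) (hk : 0 < k) (hkn : k < n) (hμ : Real.log q / 2 ^ ℓ ≤ μ lam)
    (hf : 4 * √(f lam + Real.log n + Real.log m) ≤ σ)
    (hg : (ℓ + 1) * Real.logb 2 q + g lam ≤ k * Real.logb 2 (n / k))
    (hT : T + m * ((n + 1) * ((n + 1) * (24 * (q + 2) * (4 + n * q)))) ≤ T')
    (h : ¬ Distinguishable
      (lwe q ℓ n (unif (Fin ℓ → ZMod q)) (discreteGaussian σ))
      (unif (Fin n → Sample q ℓ)) T' ε) :
    ¬ Distinguishable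
      (lwe q n m (sparseSecret q hkn.le) (discreteGaussian (2 * σ * √(k + 1))))
      (unif (Fin m → Sample q n)) T (2 * ε * m + 2 * totalError μ f g lam) := by
  rintro ⟨A, hA, hadv⟩
  obtain ⟨N, rfl⟩ : ∃ N, n = N + 1 := ⟨n - 1, by omega⟩
  have hη := totalError_pos μ f g lam
  have hm : 0 ≤ 2 * ε * m := by positivity
  have h1 := advantage_le_one A (lwe q (N + 1) m (sparseSecret q hkn.le)
    (discreteGaussian (2 * σ * √(k + 1)))) (unif (Fin m → Sample q (N + 1)))
  have hexp := Real.exp_pos (-f lam)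
  have hexp' := Real.exp_pos (-(Real.log 2 / 2 * g lam))
  have habs := abs_nonneg (μ lam)
  have ht : totalError μ f g lam = 256 * Real.exp (-f lam) + |μ lam| +
    Real.exp (-(Real.log 2 / 2 * g lam)) := rfl
  -- Otherwise the claimed advantage exceeds 1.
  by_cases hη1 : totalError μ f g lam < 1
  swap
  · linarith
  -- For q = 1 the entropy condition does not bound ℓ, but the sample space has a single point and
  -- both distributions agree.
  rcases (Nat.one_le_iff_ne_zero.2 (NeZero.ne q)).eq_or_lt with rfl | hq
  · have e : lwe 1 (N + 1) m (sparseSecret 1 hkn.le) (discreteGaussian (2 * σ * √(k + 1))) =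
        unif (Fin m → Sample 1 (N + 1)) := by
      have : Subsingleton (ZMod 1) := inferInstanceAs (Subsingleton (Fin 1))
      have key : ∀ (P : PMF (Fin m → Sample 1 (N + 1))) x, P x = 1 := fun P x => by
        rw [← P.tsum_coe, tsum_eq_single x fun y hy => (hy (Subsingleton.elim _ _)).elim]
      exact PMF.ext fun x => by rw [key, key]
    rw [e] at hadv
    have := advantage_le_of_near le_rfl
      ((Near.refl A.accept (unif (Fin m → Sample 1 (N + 1)))).mono bot_le)
    linarith
  -- A negative value of g would make the last term of `totalError` at least 1.
  have hG : 0 ≤ g lam := by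
    by_contra hc
    have := Real.one_le_exp (x := -(Real.log 2 / 2 * g lam))
      (by nlinarith [Real.log_pos one_lt_two])
    linarith
  have hℓ : (ℓ : ℝ) ≤ N + 1 := by
    have := succ_le_of_entropy hq hk hkn.le hG hg
    exact_mod_cast (by omega : ℓ ≤ N + 1)
  have ho : (opCost q : ℝ) ≤ 24 * (q + 2) := by exact_mod_cast opCost_le q
  have hcost : ∀ x : ℝ, x ≤ (N + 2) * (opCost q * (4 + (N + 1) * q)) →
      (A.time : ℝ) + m * ((N + 2) * x) ≤ T' := fun x hx => by
    have e : (m : ℝ) * ((N + 2) * x) ≤ m * ((((N + 1 : ℕ) : ℝ) + 1) * ((((N + 1 : ℕ) : ℝ) + 1) *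
        (24 * (q + 2) * (4 + (N + 1 : ℕ) * q)))) := by
      push_cast
      rw [add_assoc (N : ℝ), one_add_one_eq_two]
      gcongr
      refine hx.trans ?_
      gcongr
    linarith
  have hlq : (ℓ : ℝ) * (q * opCost q) ≤ (N + 1) * (q * opCost q) := by gcongr
  have ho0 : (0 : ℝ) ≤ opCost q := Nat.cast_nonneg _
  have hN : (0 : ℝ) ≤ N := Nat.cast_nonneg _
  have hw : (0 : ℝ) ≤ (N + 1) * (q * opCost q) := by positivity
  have hcost₁ := hcost (opCost q + N * (opCost q + ℓ * (q * opCost q) + opCost q)) (by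
    have : (N : ℝ) * (ℓ * (q * opCost q)) ≤ N * ((N + 1) * (q * opCost q)) := by gcongr
    nlinarith [mul_nonneg hN ho0])
  have hcost₂ := hcost (opCost q + ℓ * (q * opCost q) + 2 * opCost q) (by
    nlinarith [mul_nonneg hN ho0, mul_nonneg hN hw])
  have hme : (m : ℝ≥0∞) * ENNReal.ofReal ε = ENNReal.ofReal (m * ε) := by
    rw [ENNReal.ofReal_mul (by positivity), ENNReal.ofReal_natCast]
  have hη2 : 256 * Real.exp (-f lam) < 1 := by linarith
  have hd := near_double_of_bounds hσ hμ hf hη2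
    (a := fun V => A.accept fun i => toSample (V i)) (fun _ => A.accept_le_one _)
    (e := m * ε) (by positivity) fun c => by
      rw [← hme]
      exact near_cons_add_of_lwe c A hcost₂ h
  -- Each of the two uses of the assumption costs mε. The statistical errors add up to 288 exp(-f) +
  -- 2|μ| + exp(-(log 2 / 2) g), less than twice `totalError`.
  have := advantage_le_of_near (by positivity) (near_sparse_lwe_of_bounds hσ hk hkn.le hμ hf hg
    hη2 A.accept_le_one (e₁ := m * ε) (by positivity) (by positivity)
    (fun s hs c => by
      rw [← hme]
      exact near_reduceRow_of_lwe (mem_sparseVectors.1 hs).1 c A hcost₁ h) hd)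
  linarith

end Main

end SparseLWE

theorem theorem4p2 :
    -- matrix-secret LWE to k-sparse LWE
    (∃ P : MvPolynomial (Fin 4) ℝ,
      ∀ (μ f g : ℕ → ℝ), Negligible μ → SuperLogarithmic f → SuperLogarithmic g →
      ∃ ν : ℕ → ℝ, Negligible ν ∧
      ∀ (lam q m n ℓ k : ℕ) [NeZero q] (_ : 1 < k) (hkn : k < n) (σ ε T : ℝ),
        0 < σ → 0 < ε →
        Real.log q / 2 ^ ℓ ≤ μ lam →
        4 * √(f lam + Real.log n + Real.log m) ≤ σ →
        (ℓ + 1) * Real.logb 2 q + g lam ≤ k * Real.logb 2 (n / k) →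
        ¬ Distinguishable
            (matrixLwe q ℓ m (n - 1) (unif (Fin m → Fin ℓ → ZMod q))
              (iid m (discreteGaussian σ)))
            (unif (Fin (n - 1) → MatrixSample q ℓ m))
            (T + MvPolynomial.eval ![(n : ℝ), (m : ℝ), Real.log q, Real.log lam] P)
            (ε - ν lam) →
        ¬ Distinguishable
            (matrixLwe q (ℓ + 1) m (n + 1) (unif (Fin m → Fin (ℓ + 1) → ZMod q))
              (iid m (discreteGaussian (2 * σ))))
            (unif (Fin (n + 1) → MatrixSample q (ℓ + 1) m))
            (T + MvPolynomial.eval ![(n : ℝ), (m : ℝ), Real.log q, Real.log lam] P)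
            (ε - ν lam) →
        ¬ Distinguishable
            (lwe q n m (sparseSecret q hkn.le) (discreteGaussian (2 * σ * √(k + 1))))
            (unif (Fin m → Sample q n))
            T (2 * ε)) ∧
    -- standard LWE to k-sparse LWE
    (∃ P : MvPolynomial (Fin 4) ℝ,
      ∀ (μ f g : ℕ → ℝ), Negligible μ → SuperLogarithmic f → SuperLogarithmic g →
      ∃ ν : ℕ → ℝ, Negligible ν ∧
      ∀ (lam q m n ℓ k : ℕ) [NeZero q] (_ : 1 < k) (hkn : k < n) (σ ε T : ℝ),
        0 < σ → 0 < ε →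
        Real.log q / 2 ^ ℓ ≤ μ lam →
        4 * √(f lam + Real.log n + Real.log m) ≤ σ →
        (ℓ + 1) * Real.logb 2 q + g lam ≤ k * Real.logb 2 (n / k) →
        ¬ Distinguishable
            (lwe q ℓ n (unif (Fin ℓ → ZMod q)) (discreteGaussian σ))
            (unif (Fin n → Sample q ℓ))
            (T + MvPolynomial.eval ![(n : ℝ), (m : ℝ), (q : ℝ), (lam : ℝ)] P)
            ε →
        ¬ Distinguishable
            (lwe q n m (sparseSecret q hkn.le) (discreteGaussian (2 * σ * √(k + 1))))
            (unif (Fin m → Sample q n))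
            T (2 * ε * m + ν lam)) := by
  -- Both polynomials count m(n + 1) output elements times the cost of one. In the first, n modular
  -- operations of cost at most 24(2 log q + 3) suffice. The second also pays for multiplications by
  -- repeated addition, with ℓ bounded by n. Neither uses the fourth variable.
  refine ⟨⟨.X 1 * ((.X 0 + 1) * (.X 0 * (24 * (2 * .X 2 + 3)))), fun μ f g hμ hf hg =>
      ⟨totalError μ f g, negligible_totalError hμ hf hg, ?_⟩⟩,
    ⟨.X 1 * ((.X 0 + 1) * ((.X 0 + 1) * (24 * (.X 2 + 2) * (4 + .X 0 * .X 2)))),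
      fun μ f g hμ hf hg => ⟨fun lam => 2 * totalError μ f g lam,
        (negligible_totalError hμ hf hg).const_mul 2, ?_⟩⟩⟩
  · intro lam q m n ℓ k _ hk hkn σ ε T hσ _ h1 h2 h3 h4 h5
    exact not_distinguishable_of_matrixLwe hσ (by omega) hkn h1 h2 h3 (by simp) h4 h5
  · intro lam q m n ℓ k _ hk hkn σ ε T hσ hε h1 h2 h3 h4
    exact not_distinguishable_of_lwe hσ hε (by omega) hkn h1 h2 h3 (by simp) h4
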